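/- **Setting.** Let $\omega\in(0,2\pi)$, and in polar coordinates $(r,\theta)$ of $\mathbb{R}^2\setminus\{0\}\cong\mathbb{C}\setminus\{0\}$, $\theta\in(-\pi,\pi]$, $z=re^{i\theta}$, put $$\mathcal{S}_-=\{|\theta|<\omega/2\},\qquad \mathcal{S}_+=\{|\theta|>\omega/2\}.$$ For $\lambda\in\mathbb{Z}$ let $\mathsf{S}^\lambda$ be the span of the functions $r^\lambda\log^q r\,\Phi(\theta)$, where $q\in\mathbb{N}$ and $\Phi$ is $2\pi$-periodic, of class $C^1$ on $\mathbb{R}/2\pi\mathbb{Z}$, and of class $C^\infty$ on each of the closed arcs $|\theta|\le\omega/2$ and $|\theta|\ge\omega/2$. *Leading terms.* For $k\in\mathbb{N}$, $p\in\{0,1\}$: $\mathfrak{s}^{k,p}_0=r^k\cos(k\theta-p\pi/2)$ (so $\mathfrak s^{0,0}_0=1$, $\mathfrak s^{0,1}_0=0$); $\mathfrak{k}^{k,p}_0=\frac{1}{2k\pi}r^{-k}\cos(k\theta-p\pi/2)$ if $k\ge1$; $\mathfrak{k}^{0,0}_0=-\frac1{2\pi}\log r$ and $\mathfrak{k}^{0,1}_0=\frac{\theta}{2\pi}$.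 *Real shadows.* Primal shadows generated by $\mathfrak{s}^{k,p}_0$ are real functions $\mathfrak{s}^{k,p}_j\in\mathsf{S}^{k+2j}$, $j\ge1$, even in $\theta$ if $p=0$ and odd in $\theta$ if $p=1$, with $$\Delta\mathfrak{s}^{k,p}_j=0\ \text{in }\mathcal{S}_+,\qquad \Delta\mathfrak{s}^{k,p}_j=4\,\mathfrak{s}^{k,p}_{j-1}\ \text{in }\mathcal{S}_-.$$ Dual shadows $\mathfrak{k}^{k,p}_j\in\mathsf{S}^{-k+2j}$ are defined in the same way from $\mathfrak{k}^{k,p}_0$. *Shadows in complex variables.* With $z_-=z$ and $z_+=-z$, $\mathrm{s}^k_j=(\chi^k_j(z_-),\xi^k_j(z_+))$ and $\mathrm{k}^k_j=(\zeta^k_j(z_-),\eta^k_j(z_+))$ are the couples representing $\mathfrak{s}^{k,0}_j+i\,\mathfrak{s}^{k,1}_j$ and $\mathfrak{k}^{k,0}_j-i\,\mathfrak{k}^{k,1}_j$ respectively: the first function of a couple gives the values for $|\theta|\le\omega/2$, the second one those for $|\theta|\ge\omega/2$. *Ansatz spaces.* For $\lambda\in\mathbb{Z}$ and $\ell,n\in\mathbb{N}$,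 let $$\mathscr{Z}^{\lambda,\pm}_{\ell,n}=\mathrm{Span}_{\mathbb{R}}\{z_\pm^{\lambda-\mu}\,\bar z_\pm^{\,\mu}\log^q z_\pm:\ 0\le\mu\le\ell,\ 0\le q\le n\},\qquad \mathbb{S}^{\lambda,\pm}_{\ell,n}=\mathscr{Z}^{\lambda,\pm}_{\ell,n}+\overline{\mathscr{Z}^{\lambda,\pm}_{\ell,n}},$$ with $\log$ the principal logarithm, $|\arg z_-|\le\omega/2$ and $|\arg z_+|\le\pi-\omega/2$, and let $\mathbb{S}^{\lambda}_{\ell,n}$ be the real vector space of couples $(v(z_-),w(z_+))$ with $v\in\mathbb{S}^{\lambda,-}_{\ell,n}$, $w\in\mathbb{S}^{\lambda,+}_{\ell,n}$. **Theorem.** Let $k\in\mathbb{N}$. Sequences of primal shadows $(\mathfrak{s}^{k,p}_j)_{j\ge1}$ and of dual shadows $(\mathfrak{k}^{k,p}_j)_{j\ge1}$, $p=0,1$, exist, and for every choice of them and every $j\ge1$: 1. $\mathrm{s}^k_j\in\mathbb{S}^{k+2j}_{j,j}$; 2. $\mathrm{k}^k_j\in\mathbb{S}^{-k+2j}_{j,j}$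 if $-k+2j<0$, and $\mathrm{k}^k_j\in\mathbb{S}^{-k+2j}_{j,j+1}$ if $-k+2j\ge0$; 3. for all $r>0$ and $\theta\in\mathbb{R}$, $\mathfrak{s}^{k,0}_j(r,\theta)=\mathrm{Re}\,\mathrm{s}^k_j(re^{i\theta})$ and $\mathfrak{k}^{k,0}_j(r,\theta)=\mathrm{Re}\,\mathrm{k}^k_j(re^{i\theta})$, and, if $k\ne0$, $\mathfrak{s}^{k,1}_j(r,\theta)=\mathrm{Im}\,\mathrm{s}^k_j(re^{i\theta})$ and $\mathfrak{k}^{k,1}_j(r,\theta)=-\mathrm{Im}\,\mathrm{k}^k_j(re^{i\theta})$. -/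

import Mathlib

namespace CornerShadow

noncomputable section

/-- The open infinite sector `{r e^{iθ} : r > 0, |θ| < ω/2}` (the conductor). -/
def sectorMinus (ω : ℝ) : Set ℂ := {z | z ≠ 0 ∧ |z.arg| < ω / 2}

/-- The complement of the closure of `sectorMinus ω`. -/
def sectorPlus (ω : ℝ) : Set ℂ := {z | z ≠ 0 ∧ ω / 2 < |z.arg|}

/-- Admissible angular functions on the circle `ℝ / 2πℤ`, written as `2π`-periodic functions on `ℝ`:
globally of class `C^1`, and of class `C^∞` on each of the two closed arcs cut out by the
directions `± ω/2`. -/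
structure IsAngular (ω : ℝ) (Φ : ℝ → ℂ) : Prop where
  periodic : Function.Periodic Φ (2 * Real.pi)
  contDiff : ContDiff ℝ 1 Φ
  smooth_minus : ContDiffOn ℝ ((⊤ : ℕ∞) : WithTop ℕ∞) Φ (Set.Icc (-(ω / 2)) (ω / 2))
  smooth_plus : ContDiffOn ℝ ((⊤ : ℕ∞) : WithTop ℕ∞) Φ (Set.Icc (ω / 2) (2 * Real.pi - ω / 2))

/-- The space of quasi-homogeneous functions of degree `d` on the punctured plane: the complex span
of the functions `r^d log^q r Φ(θ)` with `q ∈ ℕ` and `Φ` admissible. The continuity of the function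
and of its angular derivative across the rays `θ = ± ω/2` is part of the definition, through
`Φ ∈ C^1`. -/
def quasiHom (ω : ℝ) (d : ℤ) : Submodule ℂ (({0}ᶜ : Set ℂ) → ℂ) :=
  Submodule.span ℂ {u | ∃ (q : ℕ) (Φ : ℝ → ℂ), IsAngular ω Φ ∧
    u = fun z : ({0}ᶜ : Set ℂ) => (‖(z : ℂ)‖ : ℂ) ^ d * (Real.log ‖(z : ℂ)‖ : ℂ) ^ q * Φ (z : ℂ).arg}

/-- `HasParity p u`: on the punctured plane, `u` is an even function of `θ` if `p = 0`, and an odd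
function of `θ` if `p = 1`. -/
def HasParity (p : Fin 2) (u : ℂ → ℝ) : Prop :=
  ∀ z : ℂ, z ≠ 0 → u (starRingEnd ℂ z) = (-1) ^ (p : ℕ) * u z

/-- The sequence `u 0, u 1, …` of real functions on the punctured plane (the value at the origin is
irrelevant) is a sequence of successive shadows of the leading term `u 0`, quasi-homogeneous of
degree `d`, with parity `p`. -/
structure IsShadowSeq (ω : ℝ) (d : ℤ) (p : Fin 2) (u : ℕ → ℂ → ℝ) : Prop where
  mem : ∀ j : ℕ, 1 ≤ j → (fun z : ({0}ᶜ : Set ℂ) => (u j z : ℂ)) ∈ quasiHom ω (d + 2 * (j : ℤ))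
  laplacian_plus : ∀ j : ℕ, 1 ≤ j → ∀ z ∈ sectorPlus ω, Laplacian.laplacian (u j) z = 0
  laplacian_minus : ∀ j : ℕ, 1 ≤ j → ∀ z ∈ sectorMinus ω,
    Laplacian.laplacian (u j) z = 4 * u (j - 1) z
  parity : ∀ j : ℕ, 1 ≤ j → HasParity p (u j)

/-- The leading primal singularity `r^k cos(kθ - pπ/2)`. It is `1` for `(k, p) = (0, 0)` and `0` for
`(k, p) = (0, 1)`. -/
def primalLeading (k : ℕ) (p : Fin 2) (z : ℂ) : ℝ :=
  ‖z‖ ^ k * Real.cos (k * z.arg - (p : ℕ) * Real.pi / 2)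

/-- The leading dual singularity: `r^{-k} cos(kθ - pπ/2) / (2kπ)` for `k ≥ 1`; for `k = 0` it is
`- log r / (2π)` if `p = 0` and `θ / (2π)` if `p = 1`, so that the function with `p = 0` minus `i`
times the function with `p = 1` is `- log z / (2π)`. -/
def dualLeading (k : ℕ) (p : Fin 2) (z : ℂ) : ℝ :=
  if k = 0 then
    if p = 0 then -(1 / (2 * Real.pi)) * Real.log ‖z‖ else z.arg / (2 * Real.pi)
  else
    1 / (2 * k * Real.pi) * (‖z‖ ^ k)⁻¹ * Real.cos (k * z.arg - (p : ℕ) * Real.pi / 2)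

/-- `s p j` is a choice of the real primal shadow of order `j` with parity `p` generated by the
primal leading term of index `k` (and `s p 0` is that leading term). -/
def IsPrimalShadows (ω : ℝ) (k : ℕ) (s : Fin 2 → ℕ → ℂ → ℝ) : Prop :=
  ∀ p, (∀ z, z ≠ 0 → s p 0 z = primalLeading k p z) ∧ IsShadowSeq ω (k : ℤ) p (s p)

/-- `κ p j` is a choice of the real dual shadow of order `j` with parity `p` generated by the
dual leading term of index `k` (and `κ p 0` is that leading term). -/
def IsDualShadows (ω : ℝ) (k : ℕ) (κ : Fin 2 → ℕ → ℂ → ℝ) : Prop :=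
  ∀ p, (∀ z, z ≠ 0 → κ p 0 z = dualLeading k p z) ∧ IsShadowSeq ω (-(k : ℤ)) p (κ p)

/-- The domain of the variable `z_- = z`: the closure of `sectorMinus ω`, without the origin. -/
def domMinus (ω : ℝ) : Set ℂ := {z | z ≠ 0 ∧ |z.arg| ≤ ω / 2}

/-- The domain of the variable `z_+ = -z`, for `z` in the closure of `sectorPlus ω`, without the
origin. -/
def domPlus (ω : ℝ) : Set ℂ := {w | w ≠ 0 ∧ |w.arg| ≤ Real.pi - ω / 2}

/-- Couples of functions `(v(z_-), w(z_+))`. -/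
abbrev Couple (ω : ℝ) : Type := (domMinus ω → ℂ) × (domPlus ω → ℂ)

open Classical in
/-- The value at the point `z` of the plane of the function represented by a couple: `v(z)` if
`|θ| ≤ ω/2`, and `w(-z)` otherwise. -/
def Couple.at {ω : ℝ} (P : Couple ω) (z : ℂ) : ℂ :=
  if h : z ∈ domMinus ω then P.1 ⟨z, h⟩
  else if h' : -z ∈ domPlus ω then P.2 ⟨-z, h'⟩ else 0

/-- The primal shadow of order `j` in complex variables: the couple representing
`s^{k,0}_j + i s^{k,1}_j`. -/
def primalCouple (ω : ℝ) (s : Fin 2 → ℕ → ℂ → ℝ) (j : ℕ) : Couple ω :=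
  (fun z => (s 0 j z : ℂ) + Complex.I * (s 1 j z : ℂ),
   fun w => (s 0 j (-(w : ℂ)) : ℂ) + Complex.I * (s 1 j (-(w : ℂ)) : ℂ))

/-- The dual shadow of order `j` in complex variables: the couple representing
`κ^{k,0}_j - i κ^{k,1}_j`. -/
def dualCouple (ω : ℝ) (κ : Fin 2 → ℕ → ℂ → ℝ) (j : ℕ) : Couple ω :=
  (fun z => (κ 0 j z : ℂ) - Complex.I * (κ 1 j z : ℂ),
   fun w => (κ 0 j (-(w : ℂ)) : ℂ) - Complex.I * (κ 1 j (-(w : ℂ)) : ℂ))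

/-- The real span of the functions `z^{d-μ} z̄^μ log^q z`, `0 ≤ μ ≤ ℓ`, `0 ≤ q ≤ n`, of a variable
`z ∈ D`. -/
def ansatzZ (D : Set ℂ) (d : ℤ) (ℓ n : ℕ) : Submodule ℝ (D → ℂ) :=
  Submodule.span ℝ {u | ∃ μ q : ℕ, μ ≤ ℓ ∧ q ≤ n ∧
    u = fun z : D => (z : ℂ) ^ (d - (μ : ℤ)) * (starRingEnd ℂ (z : ℂ)) ^ μ * Complex.log (z : ℂ) ^ q}

/-- The sum of `ansatzZ D d ℓ n` and of the space of the conjugates of its elements. -/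
def ansatzS (D : Set ℂ) (d : ℤ) (ℓ n : ℕ) : Submodule ℝ (D → ℂ) :=
  ansatzZ D d ℓ n ⊔ (ansatzZ D d ℓ n).map (Complex.conjAe.toLinearMap.compLeft D)

/-- The Ansatz space of couples `(v, w)`. -/
def ansatz (ω : ℝ) (d : ℤ) (ℓ n : ℕ) : Submodule ℝ (Couple ω) :=
  (ansatzS (domMinus ω) d ℓ n).prod (ansatzS (domPlus ω) d ℓ n)

end

end CornerShadow

namespace CornerShadow

open Complex Filter Topology InnerProductSpace ComplexConjugate

/-! Put z = e^s with s = x + iθ. Then Δ becomes e^{-2x}(∂_x² + ∂_θ²), a quasi-homogeneous function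
of degree d becomes e^{dx} times a polynomial in x with angular coefficients Φ_q(θ) (`polar`), and
the shadow equations become a triangular system of ODEs in θ (`angOp`, `laplacian_polar`). The
Ansatz functions become the exponential monomials `expMono` in s or s̄, on which the Laplacian acts
explicitly.

Membership goes by induction on j. The source in the sector |θ| < ω/2 is a combination of monomials,
so it has an explicit particular solution (`exists_particular`), which gains a logarithm only when
the exponent of z reaches 0. The remainder is quasi-homogeneous and harmonic in each sector, hence a
combination of z^d log^q z and conjugates (`exists_mem_logAnsatz_of_harmonic`). The bound on q is
global. If the source has log powers below N, the coefficients of rank at least N solve homogeneous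
ODEs on both arcs; as they are periodic and C^1 on the circle, a Fredholm condition kills every rank
above N when the degree is nonzero, and leaves only a constant of rank N + 1 in degree 0
(`IsAngular.exists_bound`). So each step costs one logarithm, plus one when the degree arrives at 0;
for k = 0 the dual leading term already contains this extra logarithm. The relation `admissible`
does this count (`complex_shadows_mem_logAnsatz`). Finally the parities give v(z̄) = conj v(z), and
averaging over this symmetry makes the coefficients real (`mem_ansatzS_of_logAnsatz`).

Existence: the ODEs are solved on the two arcs from the highest log power downwards. The failure to
close up after one turn is repaired by a resonant term, whose right-hand side is absorbed by a
higher log power (`exists_matched_family`). Iterating, then taking real parts of even or odd parts,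
gives real shadows (`exists_isShadowSeq`). -/

/-! ### The Laplacian in the logarithmic variable -/

theorem secondDeriv_along_line {f : ℂ → ℂ} {s v : ℂ} (hf : ContDiffAt ℝ 2 f s) {g : ℝ → ℂ} {l : ℂ}
    (h1 : ∀ᶠ t in 𝓝 (0 : ℝ), HasDerivAt (fun t : ℝ => f (s + t * v)) (g t) t)
    (h2 : HasDerivAt g l 0) : iteratedFDeriv ℝ 2 f s ![v, v] = l := by
  have hline : ∀ t : ℝ, HasDerivAt (fun t : ℝ => s + t * v) v t := fun t => by
    simpa using ((Complex.ofRealCLM.hasDerivAt (x := t)).mul_const v).const_add s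
  have hd : ∀ᶠ z in 𝓝 s, ContDiffAt ℝ 2 f z := hf.eventually (by simp)
  have htend : Tendsto (fun t : ℝ => s + t * v) (𝓝 0) (𝓝 s) := by
    have := (hline 0).continuousAt.tendsto
    simpa using this
  have hg : g =ᶠ[𝓝 0] fun t : ℝ => fderiv ℝ f (s + t * v) v := by
    filter_upwards [h1, htend.eventually hd] with t ht hdt
    have hdf := (hdt.differentiableAt (by norm_num)).hasFDerivAt
    exact ht.unique (hdf.comp_hasDerivAt t (hline t))
  have hf' : HasFDerivAt (fderiv ℝ f) (fderiv ℝ (fderiv ℝ f) s) s :=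
    ((hf.fderiv_right (m := 1) (by norm_num)).differentiableAt (by norm_num)).hasFDerivAt
  have hs0 : s + ((0 : ℝ) : ℂ) * v = s := by simp
  have h3 : HasDerivAt (fun t : ℝ => fderiv ℝ f (s + t * v)) (fderiv ℝ (fderiv ℝ f) s v) 0 := by
    have hf'' := hf'
    rw [← hs0] at hf''
    have := hf''.comp_hasDerivAt (0 : ℝ) (hline 0)
    rw [hs0] at this
    exact this
  have h4 : HasDerivAt g (fderiv ℝ (fderiv ℝ f) s v v) 0 :=
    (h3.clm_apply (hasDerivAt_const _ v)).congr_of_eventuallyEq hg |>.congr_deriv (by simp)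
  rw [iteratedFDeriv_two_apply, h2.unique h4]
  simp

theorem laplacian_eq_of_hasDerivAt {f : ℂ → ℂ} {s : ℂ} (hf : ContDiffAt ℝ 2 f s)
    {gx gy : ℝ → ℂ} {lx ly : ℂ}
    (h1 : ∀ᶠ t in 𝓝 (0 : ℝ), HasDerivAt (fun t : ℝ => f (s + t)) (gx t) t)
    (h2 : HasDerivAt gx lx 0)
    (h3 : ∀ᶠ t in 𝓝 (0 : ℝ), HasDerivAt (fun t : ℝ => f (s + t * I)) (gy t) t)
    (h4 : HasDerivAt gy ly 0) : Laplacian.laplacian f s = lx + ly := by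
  rw [laplacian_eq_iteratedFDeriv_complexPlane]
  simp only
  rw [secondDeriv_along_line (v := 1) hf (by simpa using h1) h2,
    secondDeriv_along_line hf h3 h4]

theorem hasDerivAt_line (s v : ℂ) (t : ℝ) : HasDerivAt (fun t : ℝ => s + t * v) v t := by
  simpa using ((Complex.ofRealCLM.hasDerivAt (x := t)).mul_const v).const_add s

/-- `exp` is conformal: the first-order terms Df(e^s v²) for v = 1 and v = i cancel because 1 + i² =
0, and in the second-order terms the mixed products cancel, leaving the factor |e^s|². -/
theorem laplacian_comp_exp {f : ℂ → ℂ} {s : ℂ} (hf : ContDiffAt ℝ 2 f (exp s)) :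
    Laplacian.laplacian (fun s => f (exp s)) s =
      (Real.exp (2 * s.re) : ℂ) * Laplacian.laplacian f (exp s) := by
  have hexp : ∀ z : ℂ, ContDiffAt ℝ 2 exp z := fun z => (Complex.contDiff_exp (𝕜 := ℝ)).contDiffAt
  have hcomp : ContDiffAt ℝ 2 (fun s => f (exp s)) s := hf.comp s (hexp s)
  have hd : ∀ᶠ z in 𝓝 (exp s), ContDiffAt ℝ 2 f z := hf.eventually (by simp)
  have hf' : HasFDerivAt (fderiv ℝ f) (fderiv ℝ (fderiv ℝ f) (exp s)) (exp s) :=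
    ((hf.fderiv_right (m := 1) (by norm_num)).differentiableAt (by norm_num)).hasFDerivAt
  have hline : ∀ (v : ℂ) (t : ℝ),
      HasDerivAt (fun t : ℝ => exp (s + t * v)) (exp (s + t * v) * v) t := fun v t =>
    (hasDerivAt_line s v t).cexp
  have htend : ∀ v : ℂ, Tendsto (fun t : ℝ => exp (s + t * v)) (𝓝 0) (𝓝 (exp s)) := fun v => by
    have := (hline v 0).continuousAt.tendsto
    simpa using this
  have key : ∀ v : ℂ, iteratedFDeriv ℝ 2 (fun s => f (exp s)) s ![v, v] =
      fderiv ℝ (fderiv ℝ f) (exp s) (exp s * v) (exp s * v) +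
        fderiv ℝ f (exp s) (exp s * v * v) := by
    intro v
    refine secondDeriv_along_line (g := fun t : ℝ =>
      fderiv ℝ f (exp (s + t * v)) (exp (s + t * v) * v)) hcomp ?_ ?_
    · filter_upwards [(htend v).eventually hd] with t hdt
      exact (hdt.differentiableAt (by norm_num)).hasFDerivAt.comp_hasDerivAt t (hline v t)
    · have hs0 : exp (s + ((0 : ℝ) : ℂ) * v) = exp s := by simp
      have hf'' := hf'
      rw [← hs0] at hf''
      have h5 := hf''.comp_hasDerivAt (0 : ℝ) (hline v 0)
      have h6 := h5.clm_apply ((hline v 0).mul_const v)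
      rw [hs0] at h6
      refine h6.congr_deriv ?_
      simp
  have hlin : ∀ (B : ℂ →L[ℝ] ℂ →L[ℝ] ℂ) (w : ℂ),
      B w w + B (w * I) (w * I) = ((w.re ^ 2 + w.im ^ 2 : ℝ) : ℂ) * (B 1 1 + B I I) := by
    intro B w
    have e1 : w = w.re • (1 : ℂ) + w.im • I := by
      simp
    have e2 : w * I = (-w.im) • (1 : ℂ) + w.re • I := by
      simp [Complex.ext_iff]
    rw [e2]
    nth_rewrite 1 2 [e1]
    simp only [map_add, map_smul, _root_.add_apply, _root_.smul_apply]
    simp only [real_smul]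
    push_cast
    ring
  rw [laplacian_eq_iteratedFDeriv_complexPlane, laplacian_eq_iteratedFDeriv_complexPlane]
  simp only [key, iteratedFDeriv_two_apply]
  have := hlin (fderiv ℝ (fderiv ℝ f) (exp s)) (exp s)
  have hn : (exp s).re ^ 2 + (exp s).im ^ 2 = Real.exp (2 * s.re) := by
    rw [Complex.exp_re, Complex.exp_im, two_mul, Real.exp_add]
    linear_combination Real.exp s.re ^ 2 * (Real.cos_sq_add_sin_sq s.im)
  rw [hn] at this
  simp only [mul_one, mul_assoc, I_mul_I, Matrix.cons_val_zero, Matrix.cons_val_one] at this ⊢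
  rw [← this]
  simp
  ring

/-- The local inverse log(z / e^s) + s of `exp` is centred at e^s, so the branch cut never
interferes and s may lie in any strip. -/
theorem contDiffAt_of_comp_exp {f : ℂ → ℂ} {s : ℂ} {n : WithTop ℕ∞}
    (hf : ContDiffAt ℝ n (fun s => f (exp s)) s) : ContDiffAt ℝ n f (exp s) := by
  have hne := Complex.exp_ne_zero s
  have hlog : ContDiffAt ℝ n (fun z => Complex.log (z / exp s) + s) (exp s) := by
    refine ContDiffAt.add ?_ contDiffAt_const
    refine ContDiffAt.comp (g := Complex.log) (f := fun z : ℂ => z / exp s) _ ?_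
      (contDiffAt_id.div_const _)
    refine ContDiffAt.restrict_scalars ℝ (𝕜' := ℂ) ?_
    refine Complex.contDiffAt_log ?_
    simp [hne]
  have h0 : Complex.log (exp s / exp s) + s = s := by simp [hne]
  have hf' : ContDiffAt ℝ n (fun s => f (exp s)) (Complex.log (exp s / exp s) + s) := by
    rwa [h0]
  refine (hf'.comp (exp s) hlog).congr_of_eventuallyEq ?_
  filter_upwards [isOpen_ne.mem_nhds hne] with z hz
  simp only [Function.comp]
  rw [Complex.exp_add, Complex.exp_log (div_ne_zero hz hne), div_mul_cancel₀ _ hne]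

/-! ### Polynomials in log r with angular coefficients -/

/-- `e^{d x} ∑_{q < M} x^q Φ_q(θ)` at `s = x + iθ`. -/
noncomputable def polar (d : ℤ) (M : ℕ) (Φ : ℕ → ℝ → ℂ) (s : ℂ) : ℂ :=
  exp (d * s.re) * ∑ q ∈ Finset.range M, (s.re : ℂ) ^ q * Φ q s.im

/-- The action of `e^{-dx} (∂_x² + ∂_θ²) e^{dx}` on the coefficients of a polynomial in `x`. -/
noncomputable def angOp (d : ℤ) (Φ : ℕ → ℝ → ℂ) (q : ℕ) (θ : ℝ) : ℂ :=
  deriv (deriv (Φ q)) θ + d ^ 2 * Φ q θ + 2 * d * (q + 1) * Φ (q + 1) θ +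
    (q + 2) * (q + 1) * Φ (q + 2) θ

theorem contDiffAt_polar {n : WithTop ℕ∞} (d : ℤ) (M : ℕ) (Φ : ℕ → ℝ → ℂ) (s : ℂ)
    (h : ∀ q, ContDiffAt ℝ n (Φ q) s.im) : ContDiffAt ℝ n (polar d M Φ) s := by
  have hre : ContDiffAt ℝ n (fun s : ℂ => (s.re : ℂ)) s :=
    (Complex.ofRealCLM.contDiff.comp Complex.reCLM.contDiff).contDiffAt
  refine ContDiffAt.mul (ContDiffAt.cexp (contDiffAt_const.mul hre)) ?_
  refine ContDiffAt.sum fun q _ => (hre.pow q).mul ?_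
  exact (h q).comp s Complex.imCLM.contDiff.contDiffAt

theorem hasDerivAt_of_contDiffAt_two {φ : ℝ → ℂ} {θ : ℝ} (h : ContDiffAt ℝ 2 φ θ) :
    HasDerivAt φ (deriv φ θ) θ ∧ HasDerivAt (deriv φ) (deriv (deriv φ) θ) θ := by
  refine ⟨(h.differentiableAt (by norm_num)).hasDerivAt, ?_⟩
  have h1 : ContDiffAt ℝ 1 (fun x => fderiv ℝ φ x 1) θ :=
    (h.fderiv_right (m := 1) (by norm_num)).clm_apply contDiffAt_const
  have h2 : deriv φ = fun x => fderiv ℝ φ x 1 := by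
    ext x; exact fderiv_apply_one_eq_deriv.symm
  rw [← h2] at h1
  exact (h1.differentiableAt (by norm_num)).hasDerivAt

theorem laplacian_polar (d : ℤ) (M : ℕ) (Φ : ℕ → ℝ → ℂ) (s : ℂ)
    (h : ∀ q, ContDiffAt ℝ 2 (Φ q) s.im) (hM : ∀ q, M ≤ q → Φ q = 0) :
    Laplacian.laplacian (polar d M Φ) s = polar d M (angOp d Φ) s := by
  obtain ⟨x, θ⟩ := s
  have hx : ∀ (t : ℝ), polar d M Φ (⟨x, θ⟩ + t) =
      exp (d * ((x + t : ℝ) : ℂ)) * ∑ q ∈ Finset.range M, ((x + t : ℝ) : ℂ) ^ q * Φ q θ := by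
    intro t; simp [polar]
  have hy : ∀ (t : ℝ), polar d M Φ (⟨x, θ⟩ + t * I) =
      exp (d * x) * ∑ q ∈ Finset.range M, (x : ℂ) ^ q * Φ q (θ + t) := by
    intro t; simp [polar]
  have hlin : ∀ t : ℝ, HasDerivAt (fun t : ℝ => ((x + t : ℝ) : ℂ)) 1 t := fun t => by
    simpa using ((hasDerivAt_id t).const_add x).ofReal_comp
  have hexp : ∀ t : ℝ, HasDerivAt (fun t : ℝ => exp (d * ((x + t : ℝ) : ℂ)))
      (exp (d * ((x + t : ℝ) : ℂ)) * (d * 1)) t := fun t => ((hlin t).const_mul _).cexp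
  have hpow : ∀ (c : ℕ → ℂ) (t : ℝ),
      HasDerivAt (fun t : ℝ => ∑ q ∈ Finset.range M, ((x + t : ℝ) : ℂ) ^ q * c q)
      (∑ q ∈ Finset.range M, ((q : ℂ) * ((x + t : ℝ) : ℂ) ^ (q - 1) * 1) * c q) t := fun c t =>
    HasDerivAt.fun_sum fun q _ => ((hlin t).pow q).mul_const _
  have hpow' : ∀ (c : ℕ → ℂ) (t : ℝ),
      HasDerivAt (fun t : ℝ => ∑ q ∈ Finset.range M,
        ((q : ℂ) * ((x + t : ℝ) : ℂ) ^ (q - 1) * 1) * c q)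
      (∑ q ∈ Finset.range M,
        ((q : ℂ) * (((q - 1 : ℕ) : ℂ) * ((x + t : ℝ) : ℂ) ^ (q - 1 - 1) * 1) * 1) * c q) t :=
    fun c t => HasDerivAt.fun_sum fun q _ =>
      ((((hlin t).pow (q - 1)).const_mul (q : ℂ)).mul_const 1).mul_const _
  have hev : ∀ q, ∀ᶠ t in 𝓝 (0 : ℝ), ContDiffAt ℝ 2 (Φ q) (θ + t) := by
    intro q
    have h1 := (h q).eventually (by simp)
    have h2 : Tendsto (fun t : ℝ => θ + t) (𝓝 0) (𝓝 θ) := by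
      have : Continuous fun t : ℝ => θ + t := by fun_prop
      simpa using this.tendsto 0
    exact h2.eventually h1
  have hA := laplacian_eq_of_hasDerivAt (contDiffAt_polar d M Φ ⟨x, θ⟩ h)
    (Eventually.of_forall fun t => by
      simp only [hx]
      exact (hexp t).mul (hpow (fun q => Φ q θ) t))
    (((hexp 0).mul_const _ |>.mul (hpow (fun q => Φ q θ) 0)).add
      ((hexp 0).mul (hpow' (fun q => Φ q θ) 0)))
    (gy := fun t => exp (d * x) * ∑ q ∈ Finset.range M, (x : ℂ) ^ q * deriv (Φ q) (θ + t))
    (ly := exp (d * x) * ∑ q ∈ Finset.range M, (x : ℂ) ^ q * deriv (deriv (Φ q)) θ) (by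
      have : ∀ᶠ t in 𝓝 (0 : ℝ), ∀ q ∈ Finset.range M, ContDiffAt ℝ 2 (Φ q) (θ + t) := by
        rw [Filter.eventually_all_finset]
        exact fun q _ => hev q
      filter_upwards [this] with t ht
      simp only [hy]
      refine HasDerivAt.const_mul _ (HasDerivAt.fun_sum fun q hq => HasDerivAt.const_mul _ ?_)
      exact (hasDerivAt_of_contDiffAt_two (ht q hq)).1.comp_const_add θ t)
    (by
      refine HasDerivAt.const_mul _ (HasDerivAt.fun_sum fun q hq => HasDerivAt.const_mul _ ?_)
      have h2 := (hasDerivAt_of_contDiffAt_two (h q)).2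
      refine HasDerivAt.comp_const_add θ 0 ?_
      simpa using h2)
  rw [hA]
  -- Index shift after differentiating in x. The vanishing of the coefficients from rank M on
  -- removes the boundary term, so the same range serves before and after.
  have r1 : ∀ g c : ℕ → ℂ, (∀ q, M ≤ q → c q = 0) →
      ∑ q ∈ Finset.range M, (q : ℂ) * g (q - 1) * c q =
        ∑ q ∈ Finset.range M, g q * ((q + 1) * c (q + 1)) := by
    intro g c hc
    cases M with
    | zero => simp
    | succ M =>
      rw [Finset.sum_range_succ', Finset.sum_range_succ]
      simp only [Nat.cast_zero, zero_mul, add_zero, hc (M + 1) le_rfl, mul_zero]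
      refine Finset.sum_congr rfl fun q _ => ?_
      push_cast
      ring
  have hz : ∀ q, M ≤ q → Φ q θ = 0 := fun q hq => by simp [hM q hq]
  have e1 := r1 (fun n => (x : ℂ) ^ n) (fun q => Φ q θ) hz
  have e2 := (r1 (fun n => (n : ℂ) * (x : ℂ) ^ (n - 1)) (fun q => Φ q θ) hz).trans
    (r1 (fun n => (x : ℂ) ^ n) (fun q => ((q : ℂ) + 1) * Φ (q + 1) θ)
      (fun q hq => by simp [hz (q + 1) (by omega)]))
  simp only [add_zero, mul_one, e1, e2, polar, angOp]
  simp only [Finset.mul_sum, ← Finset.sum_add_distrib]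
  refine Finset.sum_congr rfl fun q _ => ?_
  push_cast
  ring

/-- For fixed θ this is a polynomial in x with infinitely many roots. -/
theorem eq_zero_of_polar_eq_zero {d : ℤ} {M : ℕ} {Φ : ℕ → ℝ → ℂ} {θ : ℝ}
    (h : ∀ x : ℝ, polar d M Φ ⟨x, θ⟩ = 0) : ∀ q < M, Φ q θ = 0 := by
  have h1 : ∀ x : ℝ, (∑ q ∈ Finset.range M, Polynomial.C (Φ q θ) * Polynomial.X ^ q).eval (x : ℂ)
      = 0 := by
    intro x
    have := h x
    rw [polar, mul_eq_zero, or_iff_right (exp_ne_zero _)] at this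
    rw [Polynomial.eval_finsetSum, ← this]
    exact Finset.sum_congr rfl fun q _ => by
      rw [Polynomial.eval_mul, Polynomial.eval_C, Polynomial.eval_pow, Polynomial.eval_X, mul_comm]
  have h2 := Polynomial.eq_zero_of_infinite_isRoot _
    (Set.infinite_of_injective_forall_mem Complex.ofReal_injective h1)
  intro q hq
  have := congrArg (fun P => Polynomial.coeff P q) h2
  simpa [Polynomial.finsetSum_coeff, hq] using this

/-! ### Logarithmic monomials -/

/-- `exp (a w + b w̄) w ^ q` with `w = x + iσθ` at `s = x + iθ`. -/
noncomputable def expMono (σ : ℝ) (a b : ℤ) (q : ℕ) (s : ℂ) : ℂ :=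
  exp (a * (s.re + σ * s.im * I) + b * (s.re - σ * s.im * I)) * (s.re + σ * s.im * I) ^ q

theorem contDiff_expMono {n : WithTop ℕ∞} (σ : ℝ) (a b : ℤ) (q : ℕ) :
    ContDiff ℝ n (expMono σ a b q) := by
  have hre : ContDiff ℝ n (fun s : ℂ => (s.re : ℂ)) :=
    Complex.ofRealCLM.contDiff.comp Complex.reCLM.contDiff
  have him : ContDiff ℝ n (fun s : ℂ => (s.im : ℂ)) :=
    Complex.ofRealCLM.contDiff.comp Complex.imCLM.contDiff
  unfold expMono
  fun_prop

/-- For either sign of σ the Laplacian is 4 ∂_w ∂_w̄: the factor b comes from ∂_w̄, while ∂_w gives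
a or lowers the power of w. At q = 0 the truncated `q - 1` is harmless, its coefficient being 0. -/
theorem laplacian_expMono {σ : ℝ} (hσ : σ ^ 2 = 1) (a b : ℤ) (q : ℕ) (s : ℂ) :
    Laplacian.laplacian (expMono σ a b q) s =
      4 * b * (a * expMono σ a b q s + q * expMono σ a b (q - 1) s) := by
  obtain ⟨x, θ⟩ := s
  have hσ' : (σ : ℂ) ^ 2 = 1 := by exact_mod_cast hσ
  set w : ℂ := x + σ * θ * I with hw
  set w' : ℂ := x - σ * θ * I with hw'
  have gen : ∀ u u' : ℂ, ∃ g : ℝ → ℂ, (∀ t : ℝ, HasDerivAt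
      (fun t : ℝ => exp (a * (w + t * u) + b * (w' + t * u')) * (w + t * u) ^ q) (g t) t) ∧
      HasDerivAt g (exp (a * w + b * w') * ((a * u + b * u') ^ 2 * w ^ q
        + 2 * (a * u + b * u') * (q * w ^ (q - 1) * u) +
          q * ((q - 1 : ℕ) * w ^ (q - 1 - 1)) * u ^ 2)) 0 := by
    intro u u'
    have hE : ∀ t : ℝ, HasDerivAt (fun t : ℝ => exp (a * (w + t * u) + b * (w' + t * u')))
        (exp (a * (w + t * u) + b * (w' + t * u')) * (a * u + b * u')) t := fun t =>
      (((hasDerivAt_line w u t).const_mul _).add ((hasDerivAt_line w' u' t).const_mul _)).cexp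
    have hP : ∀ (n : ℕ) (t : ℝ), HasDerivAt (fun t : ℝ => (w + t * u) ^ n)
        (n * (w + t * u) ^ (n - 1) * u) t := fun n t => (hasDerivAt_line w u t).pow n
    refine ⟨_, fun t => (hE t).mul (hP q t), ?_⟩
    refine ((((hE 0).mul_const _).mul (hP q 0)).add
      ((hE 0).mul (((hP (q - 1) 0).const_mul (q : ℂ)).mul_const u))).congr_deriv ?_
    simp only [ofReal_zero, zero_mul, add_zero]
    ring
  obtain ⟨gx, h1, h2⟩ := gen 1 1
  obtain ⟨gy, h3, h4⟩ := gen (σ * I) (-(σ * I))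
  rw [laplacian_eq_of_hasDerivAt (contDiff_expMono σ a b q).contDiffAt
    (Eventually.of_forall fun t => ?_) h2 (Eventually.of_forall fun t => ?_) h4]
  · have hI : (σ * I : ℂ) ^ 2 = -1 := by rw [mul_pow, hσ', I_sq]; ring
    simp only [expMono, ← hw, ← hw']
    linear_combination exp (a * w + b * w') * ((a - b) ^ 2 * w ^ q
        + 2 * (a - b) * (q * w ^ (q - 1)) + q * ((q - 1 : ℕ) * w ^ (q - 1 - 1))) * hI
  · refine (h1 t).congr_of_eventuallyEq (Eventually.of_forall fun t => ?_)
    simp only [expMono, hw, hw', add_re, add_im, ofReal_re, ofReal_im, add_zero, mul_one]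
    push_cast
    ring_nf
  · refine (h3 t).congr_of_eventuallyEq (Eventually.of_forall fun t => ?_)
    simp only [expMono, hw, hw', add_re, add_im, mul_re, mul_im, I_re, I_im, ofReal_re, ofReal_im]
    push_cast
    ring_nf

/-- The coefficients of `expMono` as a polynomial in `x`. -/
noncomputable def expCoeff (σ : ℝ) (κ : ℤ) (q m : ℕ) (θ : ℝ) : ℂ :=
  q.choose m * (σ * θ * I) ^ (q - m) * exp (κ * (σ * θ * I))

theorem contDiff_expCoeff {n : WithTop ℕ∞} (σ : ℝ) (κ : ℤ) (q m : ℕ) :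
    ContDiff ℝ n (expCoeff σ κ q m) := by
  have h : ContDiff ℝ n (fun s : ℝ => (s : ℂ)) := Complex.ofRealCLM.contDiff
  unfold expCoeff
  fun_prop

theorem expCoeff_eq_zero (σ : ℝ) (κ : ℤ) {q m : ℕ} (h : q < m) : expCoeff σ κ q m = 0 := by
  ext θ
  simp [expCoeff, Nat.choose_eq_zero_of_lt h]

/-- Binomial expansion of (x + iσθ)^q; the radial degree is a + b and the angular frequency a - b.
-/
theorem expMono_eq_polar (σ : ℝ) (a b : ℤ) {q M : ℕ} (hq : q < M) (s : ℂ) :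
    expMono σ a b q s = polar (a + b) M (expCoeff σ (a - b) q) s := by
  obtain ⟨k, rfl⟩ := Nat.exists_eq_add_of_lt hq
  have h0 : ∑ m ∈ Finset.range (q + k + 1), (s.re : ℂ) ^ m * expCoeff σ (a - b) q m s.im =
      ∑ m ∈ Finset.range (q + 1), (s.re : ℂ) ^ m * expCoeff σ (a - b) q m s.im := by
    symm
    refine Finset.sum_subset (Finset.range_mono (by omega)) fun m _ hm => ?_
    rw [expCoeff_eq_zero σ _ (by simpa using hm)]
    simp
  rw [polar, h0, expMono, add_pow, Finset.mul_sum, Finset.mul_sum]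
  refine Finset.sum_congr rfl fun m _ => ?_
  have : exp (a * (s.re + σ * s.im * I) + b * (s.re - σ * s.im * I)) =
      exp (((a + b : ℤ) : ℂ) * s.re) * exp (((a - b : ℤ) : ℂ) * (σ * s.im * I)) := by
    rw [← exp_add]
    push_cast
    ring_nf
  rw [this, expCoeff]
  ring

/-- The complex span of the functions `w^{d - μ} w̄^μ log^q w` of `s`, where `w = e^s` or
`w = e^{s̄}` and `(μ, q)` is admissible. -/
def logAnsatz (d : ℤ) (A : ℕ → ℕ → Prop) : Submodule ℂ (ℂ → ℂ) :=
  Submodule.span ℂ {f | ∃ (σ : ℝ) (μ q : ℕ), (σ = 1 ∨ σ = -1) ∧ A μ q ∧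
    f = expMono σ (d - μ) μ q}

theorem expMono_mem_logAnsatz {σ : ℝ} (hσ : σ = 1 ∨ σ = -1) {d a b : ℤ} {A : ℕ → ℕ → Prop}
    {μ q : ℕ} (h : A μ q) (ha : a = d - μ) (hb : b = μ) : expMono σ a b q ∈ logAnsatz d A := by
  subst ha hb
  exact Submodule.subset_span ⟨σ, μ, q, hσ, h, rfl⟩

theorem logAnsatz_mono {d : ℤ} {A B : ℕ → ℕ → Prop} (h : ∀ μ q, A μ q → B μ q) :
    logAnsatz d A ≤ logAnsatz d B := by
  refine Submodule.span_mono ?_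
  rintro f ⟨σ, μ, q, hσ, hA, rfl⟩
  exact ⟨σ, μ, q, hσ, h μ q hA, rfl⟩

theorem contDiff_of_mem_logAnsatz {n : WithTop ℕ∞} {d : ℤ} {A : ℕ → ℕ → Prop} {f : ℂ → ℂ}
    (hf : f ∈ logAnsatz d A) : ContDiff ℝ n f := by
  induction hf using Submodule.span_induction with
  | mem f hf => obtain ⟨σ, μ, q, -, -, rfl⟩ := hf; exact contDiff_expMono _ _ _ _
  | zero => exact contDiff_const
  | add f g _ _ hf hg => exact hf.add hg
  | smul c f _ hf => exact contDiff_const.smul hf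

theorem polar_add (d : ℤ) (M : ℕ) (Φ Ψ : ℕ → ℝ → ℂ) (s : ℂ) :
    polar d M (fun q => Φ q + Ψ q) s = polar d M Φ s + polar d M Ψ s := by
  simp only [polar, ← mul_add, ← Finset.sum_add_distrib, Pi.add_apply]

theorem polar_smul (d : ℤ) (M : ℕ) (c : ℂ) (Φ : ℕ → ℝ → ℂ) (s : ℂ) :
    polar d M (fun q => c • Φ q) s = c * polar d M Φ s := by
  simp only [polar, Pi.smul_apply, smul_eq_mul, Finset.mul_sum]
  exact Finset.sum_congr rfl fun q _ => by ring

theorem exists_polar_of_mem_logAnsatz {d : ℤ} {A : ℕ → ℕ → Prop} {N : ℕ}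
    (hA : ∀ μ q, A μ q → q < N) {f : ℂ → ℂ} (hf : f ∈ logAnsatz d A) :
    ∃ P : ℕ → ℝ → ℂ, (∀ q, ContDiff ℝ (⊤ : ℕ∞) (P q)) ∧ (∀ q, N ≤ q → P q = 0) ∧
      ∀ s, f s = polar d N P s := by
  induction hf using Submodule.span_induction with
  | mem f hf =>
    obtain ⟨σ, μ, q, -, h, rfl⟩ := hf
    have hq := hA μ q h
    refine ⟨_, fun m => contDiff_expCoeff σ (d - μ - μ) q m,
      fun m hm => expCoeff_eq_zero _ _ (by omega), fun s => ?_⟩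
    rw [expMono_eq_polar _ _ _ hq, sub_add_cancel]
  | zero =>
    exact ⟨fun _ => 0, fun _ => contDiff_const, fun _ _ => rfl, fun s => by simp [polar]⟩
  | add f g _ _ hf hg =>
    obtain ⟨P, h1, h2, h3⟩ := hf
    obtain ⟨Q, k1, k2, k3⟩ := hg
    refine ⟨fun q => P q + Q q, fun q => (h1 q).add (k1 q),
      fun q hq => by simp [h2 q hq, k2 q hq], fun s => ?_⟩
    rw [polar_add, Pi.add_apply, h3, k3]
  | smul c f _ hf =>
    obtain ⟨P, h1, h2, h3⟩ := hf
    refine ⟨fun q => c • P q, fun q => contDiff_const.smul (h1 q),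
      fun q hq => by simp [h2 q hq], fun s => ?_⟩
    rw [polar_smul, Pi.smul_apply, h3, smul_eq_mul]

/-! ### Particular solutions -/

/-- Both exponents a and μ + 1 are nonzero, so dividing by (μ + 1)a inverts the Laplacian up to a
monomial with a lower log power, which the induction on q removes. No logarithm is gained. -/
theorem exists_particular_expMono_of_ne {σ : ℝ} (hσ : σ = 1 ∨ σ = -1) {d a : ℤ}
    {B : ℕ → ℕ → Prop} {μ : ℕ} (ha : a = d - (μ + 1)) (ha0 : a ≠ 0) (q : ℕ)
    (hB : ∀ q' ≤ q, B (μ + 1) q') :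
    ∃ p ∈ logAnsatz d B, ∀ s, Laplacian.laplacian p s = 4 * expMono σ a (μ + 1) q s := by
  have hσ2 : σ ^ 2 = 1 := by rcases hσ with rfl | rfl <;> norm_num
  have ha' : (a : ℂ) ≠ 0 := by exact_mod_cast ha0
  have hμ : ((μ : ℂ) + 1) ≠ 0 := by exact_mod_cast Nat.succ_ne_zero μ
  have hmem : ∀ q, B (μ + 1) q → expMono σ a (μ + 1) q ∈ logAnsatz d B := fun q h =>
    expMono_mem_logAnsatz hσ h (by push_cast; exact ha) (by push_cast; rfl)
  have hsm : ∀ (c : ℂ) (q : ℕ) (s : ℂ), Laplacian.laplacian (c • expMono σ a (μ + 1) q) s =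
      c * (4 * (μ + 1) * (a * expMono σ a (μ + 1) q s + q * expMono σ a (μ + 1) (q - 1) s)) := by
    intro c q s
    rw [laplacian_smul c (contDiff_expMono σ a (μ + 1) q).contDiffAt, laplacian_expMono hσ2]
    push_cast
    rfl
  induction q with
  | zero =>
    refine ⟨((μ + 1 : ℂ) * a)⁻¹ • expMono σ a (μ + 1) 0, Submodule.smul_mem _ _
      (hmem 0 (hB 0 le_rfl)), fun s => ?_⟩
    rw [hsm]
    field_simp
    simp
    ring
  | succ q ih =>
    obtain ⟨p, hp, hps⟩ := ih fun q' h => hB q' (by omega)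
    refine ⟨((μ + 1 : ℂ) * a)⁻¹ • expMono σ a (μ + 1) (q + 1) + (-((q + 1 : ℂ) / a)) • p,
      Submodule.add_mem _ (Submodule.smul_mem _ _ (hmem _ (hB _ le_rfl)))
      (Submodule.smul_mem _ _ hp), fun s => ?_⟩
    rw [ContDiffAt.laplacian_add
      (contDiff_of_mem_logAnsatz (Submodule.smul_mem _ _ (hmem _ (hB _ le_rfl)))).contDiffAt
      (contDiff_of_mem_logAnsatz (Submodule.smul_mem _ _ hp)).contDiffAt, hsm,
      laplacian_smul _ (contDiff_of_mem_logAnsatz hp).contDiffAt, hps, smul_eq_mul]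
    simp only [Nat.add_sub_cancel]
    push_cast
    field_simp
    ring

/-- When a = 0 the Laplacian only lowers the log power, so the power q + 1 is needed to reach q.
This is the only way a particular solution gains a logarithm. -/
theorem exists_particular_expMono_zero {σ : ℝ} (hσ : σ = 1 ∨ σ = -1) {d : ℤ}
    {B : ℕ → ℕ → Prop} {μ : ℕ} (ha : d = μ + 1) (q : ℕ) (hB : B (μ + 1) (q + 1)) :
    ∃ p ∈ logAnsatz d B, ∀ s, Laplacian.laplacian p s = 4 * expMono σ 0 (μ + 1) q s := by
  have hσ2 : σ ^ 2 = 1 := by rcases hσ with rfl | rfl <;> norm_num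
  have hμ : ((μ : ℂ) + 1) ≠ 0 := by exact_mod_cast Nat.succ_ne_zero μ
  have hq : ((q : ℂ) + 1) ≠ 0 := by exact_mod_cast Nat.succ_ne_zero q
  refine ⟨((μ + 1 : ℂ) * (q + 1))⁻¹ • expMono σ 0 (μ + 1) (q + 1), Submodule.smul_mem _ _
    (expMono_mem_logAnsatz hσ hB (by push_cast; omega) (by push_cast; rfl)), fun s => ?_⟩
  rw [laplacian_smul _ (contDiff_expMono σ 0 (μ + 1) _).contDiffAt, laplacian_expMono hσ2,
    smul_eq_mul]
  simp only [Nat.add_sub_cancel]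
  push_cast
  field_simp
  ring

theorem exp_two_mul_expMono {σ : ℝ} (a b : ℤ) (q : ℕ) (s : ℂ) :
    (Real.exp (2 * s.re) : ℂ) * expMono σ a b q s = expMono σ (a + 1) (b + 1) q s := by
  rw [expMono, expMono, ← mul_assoc, ofReal_exp, ← exp_add]
  congr 2
  push_cast
  ring

/-- The factor e^{2x} raises both exponents by one: that of w̄ becomes μ + 1, never 0, and that of w
becomes d - μ + 1, which is 0 exactly in the resonant case of the second hypothesis. -/
theorem exists_particular {d : ℤ} {A B : ℕ → ℕ → Prop}
    (h1 : ∀ μ q q', A μ q → q' ≤ q → B (μ + 1) q')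
    (h2 : ∀ μ q, A μ q → d + 1 = μ → B (μ + 1) (q + 1)) {f : ℂ → ℂ} (hf : f ∈ logAnsatz d A) :
    ∃ p ∈ logAnsatz (d + 2) B, ∀ s,
      Laplacian.laplacian p s = 4 * (Real.exp (2 * s.re) : ℂ) * f s := by
  induction hf using Submodule.span_induction with
  | mem f hf =>
    obtain ⟨σ, μ, q, hσ, h, rfl⟩ := hf
    simp only [mul_assoc, exp_two_mul_expMono]
    by_cases h0 : d + 1 = μ
    · have : d - μ + 1 = 0 := by omega
      rw [this]
      exact exists_particular_expMono_zero hσ (by omega) q (h2 μ q h h0)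
    · exact exists_particular_expMono_of_ne hσ (by omega) (by omega) q fun q' => h1 μ q q' h
  | zero => exact ⟨0, Submodule.zero_mem _, fun s => by
      have := congrFun (laplacian_const (E := ℂ) (F := ℂ) (c := 0)) s
      simp [Pi.zero_def] at this ⊢⟩
  | add f g _ _ hf hg =>
    obtain ⟨p, hp, hps⟩ := hf
    obtain ⟨p', hp', hps'⟩ := hg
    refine ⟨p + p', Submodule.add_mem _ hp hp', fun s => ?_⟩
    rw [ContDiffAt.laplacian_add (contDiff_of_mem_logAnsatz hp).contDiffAt
      (contDiff_of_mem_logAnsatz hp').contDiffAt, hps, hps', Pi.add_apply]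
    ring
  | smul c f _ hf =>
    obtain ⟨p, hp, hps⟩ := hf
    refine ⟨c • p, Submodule.smul_mem _ _ hp, fun s => ?_⟩
    rw [laplacian_smul _ (contDiff_of_mem_logAnsatz hp).contDiffAt, hps, Pi.smul_apply,
      smul_eq_mul, smul_eq_mul]
    ring

/-! ### Periodic angular equations and the bound on log powers -/

theorem eq_left_of_hasDerivAt_zero {f : ℝ → ℂ} {a b : ℝ} (hf : ContinuousOn f (Set.Icc a b))
    (h : ∀ x ∈ Set.Ioo a b, HasDerivAt f 0 x) : ∀ x ∈ Set.Icc a b, f x = f a := by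
  intro x hx
  have := intervalIntegral.integral_eq_sub_of_hasDerivAt_of_le hx.1
    (hf.mono (Set.Icc_subset_Icc le_rfl hx.2)) (f' := fun _ => 0)
    (fun y hy => h y ⟨hy.1, hy.2.trans_le hx.2⟩) (by simp)
  simpa [sub_eq_zero, eq_comm] using this

/-- The two open arcs of directions, as a subset of a fundamental domain. -/
def openArcs (ω : ℝ) : Set ℝ :=
  Set.Ioo (-(ω / 2)) (ω / 2) ∪ Set.Ioo (ω / 2) (2 * Real.pi - ω / 2)

/-- The derivative is needed only off the two rays; continuity carries the constant across ω/2. This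
is what lets C^1 matching replace smoothness on the circle. -/
theorem eq_left_of_hasDerivAt_zero_openArcs {ω : ℝ} (hω : ω ∈ Set.Ioo 0 (2 * Real.pi)) {f : ℝ → ℂ}
    (hf : Continuous f) (h : ∀ x ∈ openArcs ω, HasDerivAt f 0 x) :
    ∀ x ∈ Set.Icc (-(ω / 2)) (2 * Real.pi - ω / 2), f x = f (-(ω / 2)) := by
  obtain ⟨h0, h1⟩ := hω
  have hA := eq_left_of_hasDerivAt_zero (a := -(ω / 2)) (b := ω / 2) hf.continuousOn
    fun x hx => h x (Or.inl hx)
  have hB := eq_left_of_hasDerivAt_zero (a := ω / 2) (b := 2 * Real.pi - ω / 2) hf.continuousOn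
    fun x hx => h x (Or.inr hx)
  intro x hx
  rcases le_total x (ω / 2) with hx' | hx'
  · exact hA x ⟨hx.1, hx'⟩
  · rw [hB x ⟨hx', hx.2⟩]
    exact hA _ ⟨by linarith, le_rfl⟩

theorem eq_of_periodic {f g : ℝ → ℂ} {p a : ℝ} (hp : 0 < p) (hf : Function.Periodic f p)
    (hg : Function.Periodic g p) (h : ∀ x ∈ Set.Icc a (a + p), f x = g x) (x : ℝ) : f x = g x := by
  obtain ⟨y, hy, hxy⟩ := (hf.sub hg).exists_mem_Ico hp x a
  have := h y (Set.Ico_subset_Icc_self hy)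
  simp only [Pi.sub_apply, this, sub_self, sub_eq_zero] at hxy
  exact hxy

theorem periodic_deriv {f : ℝ → ℂ} {p : ℝ} (hf : Function.Periodic f p) :
    Function.Periodic (deriv f) p := by
  intro x
  have h : (fun x => f (x + p)) = f := funext hf
  rw [← deriv_comp_add_const, h]

theorem IsAngular.contDiffAt {ω : ℝ} {Φ : ℝ → ℂ} (h : IsAngular ω Φ) {θ : ℝ}
    (hθ : θ ∈ openArcs ω) : ContDiffAt ℝ 2 Φ θ := by
  have h2 : ((2 : ℕ∞) : WithTop ℕ∞) ≤ ((⊤ : ℕ∞) : WithTop ℕ∞) := by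
    exact_mod_cast le_top
  rcases hθ with hθ | hθ
  · exact (h.smooth_minus.contDiffAt (Icc_mem_nhds hθ.1 hθ.2)).of_le h2
  · exact (h.smooth_plus.contDiffAt (Icc_mem_nhds hθ.1 hθ.2)).of_le h2

theorem hasDerivAt_exp_mul (γ : ℂ) (θ : ℝ) :
    HasDerivAt (fun θ : ℝ => exp (γ * θ)) (γ * exp (γ * θ)) θ := by
  have := ((Complex.ofRealCLM.hasDerivAt (x := θ)).const_mul γ).cexp
  simpa [mul_comm] using this

/-- Factorisation ∂² - γ² = (∂ + γ)(∂ - γ), with e^{γθ} as integrating factor of the first factor.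
-/
theorem hasDerivAt_integratingFactor {φ : ℝ → ℂ} {θ : ℝ} (h : ContDiffAt ℝ 2 φ θ) (γ : ℂ) :
    HasDerivAt (fun θ : ℝ => (deriv φ θ - γ * φ θ) * exp (γ * θ))
      ((deriv (deriv φ) θ - γ ^ 2 * φ θ) * exp (γ * θ)) θ := by
  obtain ⟨h1, h2⟩ := hasDerivAt_of_contDiffAt_two h
  refine ((h2.sub (h1.const_mul γ)).mul (hasDerivAt_exp_mul γ θ)).congr_deriv ?_
  simp only [Pi.sub_apply]
  ring

/-- Fredholm condition: multiply by e^{γθ} and integrate over one period. The left side and the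
e^{2γθ} term integrate to 0 by periodicity, and 2πc' is left. -/
theorem resonance_coeff_eq_zero {ω : ℝ} (hω : ω ∈ Set.Ioo 0 (2 * Real.pi)) {Φ : ℝ → ℂ}
    (hΦ : IsAngular ω Φ) {γ : ℂ} (hγ : γ ≠ 0) (hper : exp (γ * (2 * Real.pi)) = 1) {c c' : ℂ}
    (h : ∀ θ ∈ openArcs ω, deriv (deriv Φ) θ - γ ^ 2 * Φ θ =
      c * exp (γ * θ) + c' * exp (-γ * θ)) : c' = 0 := by
  have hcont : Continuous (deriv Φ) := hΦ.contDiff.continuous_deriv le_rfl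
  have key := eq_left_of_hasDerivAt_zero_openArcs hω
    (f := fun θ : ℝ => (deriv Φ θ - γ * Φ θ) * exp (γ * θ)
      - c / (2 * γ) * exp (2 * γ * θ) - c' * θ)
    (by have := hΦ.contDiff.continuous; fun_prop) (fun θ hθ => by
      refine (((hasDerivAt_integratingFactor (hΦ.contDiffAt hθ) γ).sub
        ((hasDerivAt_exp_mul (2 * γ) θ).const_mul (c / (2 * γ)))).sub
        ((Complex.ofRealCLM.hasDerivAt (x := θ)).const_mul c')).congr_deriv ?_
      have e1 : exp (2 * γ * θ) = exp (γ * θ) * exp (γ * θ) := by rw [← exp_add]; ring_nf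
      have e2 : exp (-(γ * θ)) * exp (γ * θ) = 1 := by rw [← exp_add]; simp
      rw [h θ hθ, e1]
      simp only [ofRealCLM_apply, ofReal_one]
      field_simp
      linear_combination c' * e2)
    (2 * Real.pi - ω / 2) ⟨by linarith [hω.2, hω.1], le_rfl⟩
  have hp1 : Φ (2 * Real.pi - ω / 2) = Φ (-(ω / 2)) := by
    rw [← hΦ.periodic (-(ω / 2))]; ring_nf
  have hp2 : deriv Φ (2 * Real.pi - ω / 2) = deriv Φ (-(ω / 2)) := by
    rw [← periodic_deriv hΦ.periodic (-(ω / 2))]; ring_nf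
  have he : exp (γ * ((2 * Real.pi - ω / 2 : ℝ) : ℂ)) = exp (γ * ((-(ω / 2) : ℝ) : ℂ)) := by
    have : γ * ((2 * Real.pi - ω / 2 : ℝ) : ℂ) =
        γ * ((-(ω / 2) : ℝ) : ℂ) + γ * (2 * Real.pi) := by push_cast; ring
    rw [this, exp_add, hper, mul_one]
  have he2 : ∀ θ : ℝ, exp (2 * γ * θ) = exp (γ * θ) * exp (γ * θ) := fun θ => by
    rw [← exp_add]; ring_nf
  simp only [hp1, hp2, he2, he] at key
  have h3 : c' * (2 * Real.pi) = 0 := by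
    push_cast at key
    linear_combination -key
  rcases mul_eq_zero.mp h3 with h3 | h3
  · exact h3
  · exact absurd h3 (by exact_mod_cast Real.two_pi_pos.ne')

/-- The first integrals (Φ' ∓ γΦ)e^{±γθ} involve only Φ and Φ', so they keep the same constant on
both arcs; eliminating Φ' gives Φ. -/
theorem IsAngular.eq_exp_of_ode {ω : ℝ} (hω : ω ∈ Set.Ioo 0 (2 * Real.pi)) {Φ : ℝ → ℂ}
    (hΦ : IsAngular ω Φ) {γ : ℂ} (hγ : γ ≠ 0) (hper : exp (γ * (2 * Real.pi)) = 1)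
    (h : ∀ θ ∈ openArcs ω, deriv (deriv Φ) θ - γ ^ 2 * Φ θ = 0) :
    ∃ c c' : ℂ, ∀ θ, Φ θ = c * exp (γ * θ) + c' * exp (-γ * θ) := by
  have hcont : Continuous (deriv Φ) := hΦ.contDiff.continuous_deriv le_rfl
  have hc0 := hΦ.contDiff.continuous
  have k1 := eq_left_of_hasDerivAt_zero_openArcs hω
    (f := fun θ : ℝ => (deriv Φ θ - γ * Φ θ) * exp (γ * θ)) (by fun_prop) (fun θ hθ =>
      (hasDerivAt_integratingFactor (hΦ.contDiffAt hθ) γ).congr_deriv (by rw [h θ hθ, zero_mul]))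
  have k2 := eq_left_of_hasDerivAt_zero_openArcs hω
    (f := fun θ : ℝ => (deriv Φ θ - (-γ) * Φ θ) * exp (-γ * θ)) (by fun_prop) (fun θ hθ =>
      (hasDerivAt_integratingFactor (hΦ.contDiffAt hθ) (-γ)).congr_deriv (by
        rw [neg_sq, h θ hθ, zero_mul]))
  generalize (deriv Φ (-(ω / 2)) - γ * Φ (-(ω / 2))) * exp (γ * ((-(ω / 2) : ℝ) : ℂ)) = K at k1
  generalize (deriv Φ (-(ω / 2)) - -γ * Φ (-(ω / 2))) * exp (-γ * ((-(ω / 2) : ℝ) : ℂ)) = K' at k2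
  refine ⟨K' / (2 * γ), -K / (2 * γ), eq_of_periodic (a := -(ω / 2)) Real.two_pi_pos hΦ.periodic
    ?_ ?_⟩
  · intro θ
    have e1 : exp (γ * ((θ + 2 * Real.pi : ℝ) : ℂ)) = exp (γ * θ) := by
      push_cast; rw [mul_add, exp_add, hper, mul_one]
    have e2 : exp (-γ * ((θ + 2 * Real.pi : ℝ) : ℂ)) = exp (-γ * θ) := by
      rw [neg_mul, exp_neg, e1, neg_mul, exp_neg]
    simp only [e1, e2]
  · intro θ hθ
    have hθ' : θ ∈ Set.Icc (-(ω / 2)) (2 * Real.pi - ω / 2) := ⟨hθ.1, by linarith [hθ.2]⟩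
    have e2 : exp (-(γ * θ)) * exp (γ * θ) = 1 := by rw [← exp_add]; simp
    simp only [neg_mul] at k2 ⊢
    field_simp
    linear_combination (-exp (-(γ * θ))) * k1 θ hθ' + exp (γ * θ) * k2 θ hθ'
      - (deriv Φ θ - γ * Φ θ) * e2 * (-1) - (deriv Φ θ + γ * Φ θ) * e2

/-- Φ' - cθ is constant over a full turn, so periodicity of Φ' gives c = 0; then Φ is affine and
periodic. -/
theorem IsAngular.eq_zero_of_deriv_deriv_eq_const {ω : ℝ} (hω : ω ∈ Set.Ioo 0 (2 * Real.pi))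
    {Φ : ℝ → ℂ} (hΦ : IsAngular ω Φ) {c : ℂ}
    (h : ∀ θ ∈ openArcs ω, deriv (deriv Φ) θ = c) : c = 0 ∧ ∃ K : ℂ, ∀ θ, Φ θ = K := by
  have hcont : Continuous (deriv Φ) := hΦ.contDiff.continuous_deriv le_rfl
  have hc0 := hΦ.contDiff.continuous
  have hdiff : ∀ θ, HasDerivAt Φ (deriv Φ θ) θ := fun θ =>
    ((hΦ.contDiff.differentiable (by norm_num)) θ).hasDerivAt
  have hmem : 2 * Real.pi - ω / 2 ∈ Set.Icc (-(ω / 2)) (2 * Real.pi - ω / 2) :=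
    ⟨by linarith [hω.2, hω.1], le_rfl⟩
  have hpi : ((2 * Real.pi : ℝ) : ℂ) ≠ 0 := by exact_mod_cast Real.two_pi_pos.ne'
  have k1 := eq_left_of_hasDerivAt_zero_openArcs hω
    (f := fun θ : ℝ => deriv Φ θ - c * θ) (by fun_prop) (fun θ hθ => by
      refine ((hasDerivAt_of_contDiffAt_two (hΦ.contDiffAt hθ)).2.sub
        ((Complex.ofRealCLM.hasDerivAt (x := θ)).const_mul c)).congr_deriv ?_
      simp [h θ hθ])
  have hp1 : Φ (2 * Real.pi - ω / 2) = Φ (-(ω / 2)) := by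
    rw [← hΦ.periodic (-(ω / 2))]; ring_nf
  have hp2 : deriv Φ (2 * Real.pi - ω / 2) = deriv Φ (-(ω / 2)) := by
    rw [← periodic_deriv hΦ.periodic (-(ω / 2))]; ring_nf
  have hc : c = 0 := by
    have := k1 _ hmem
    simp only [hp2] at this
    have h3 : c * ((2 * Real.pi : ℝ) : ℂ) = 0 := by
      push_cast at this ⊢
      linear_combination -this
    exact (mul_eq_zero.mp h3).resolve_right hpi
  refine ⟨hc, ?_⟩
  subst hc
  simp only [zero_mul, sub_zero] at k1
  generalize deriv Φ (-(ω / 2)) = K at k1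
  have k2 := eq_left_of_hasDerivAt_zero_openArcs hω
    (f := fun θ : ℝ => Φ θ - K * θ) (by fun_prop) (fun θ hθ => by
      refine ((hdiff θ).sub
        ((Complex.ofRealCLM.hasDerivAt (x := θ)).const_mul K)).congr_deriv ?_
      have hθ' : θ ∈ Set.Icc (-(ω / 2)) (2 * Real.pi - ω / 2) := by
        rcases hθ with hθ | hθ
        · exact ⟨hθ.1.le, by linarith [hθ.2, hω.2]⟩
        · exact ⟨by linarith [hθ.1, hω.1], hθ.2.le⟩
      simp [k1 θ hθ'])
  have hK : K = 0 := by
    have := k2 _ hmem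
    simp only [hp1] at this
    have h3 : K * ((2 * Real.pi : ℝ) : ℂ) = 0 := by
      push_cast at this ⊢
      linear_combination -this
    exact (mul_eq_zero.mp h3).resolve_right hpi
  subst hK
  simp only [zero_mul, sub_zero] at k2
  refine ⟨Φ (-(ω / 2)), eq_of_periodic (a := -(ω / 2)) Real.two_pi_pos hΦ.periodic
    (fun _ => rfl) fun θ hθ => k2 θ ⟨hθ.1, by linarith [hθ.2]⟩⟩

theorem exp_int_mul_I_mul_two_pi (d : ℤ) : exp ((d : ℂ) * I * (2 * Real.pi)) = 1 := by
  rw [← Complex.exp_int_mul_two_pi_mul_I d]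
  ring_nf

/-- Descending induction on the rank. A topmost coefficient solves the homogeneous equation, hence
is a combination of e^{±idθ}; it is also, up to a nonzero factor, the right-hand side one rank
below, and solvability there forces it to vanish. -/
theorem angular_eq_zero_of_angOp_eq_zero {ω : ℝ} (hω : ω ∈ Set.Ioo 0 (2 * Real.pi)) {d : ℤ}
    (hd : d ≠ 0) {Φ : ℕ → ℝ → ℂ} (hΦ : ∀ q, IsAngular ω (Φ q)) {M N : ℕ}
    (hM : ∀ q, M ≤ q → Φ q = 0) (h : ∀ q, N ≤ q → ∀ θ ∈ openArcs ω, angOp d Φ q θ = 0) :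
    ∀ q, N + 1 ≤ q → Φ q = 0 := by
  have hd' : (d : ℂ) ≠ 0 := by exact_mod_cast hd
  have hγ : (d : ℂ) * I ≠ 0 := mul_ne_zero hd' I_ne_zero
  have hγ2 : ((d : ℂ) * I) ^ 2 = -(d : ℂ) ^ 2 := by rw [mul_pow, I_sq]; ring
  have hper := exp_int_mul_I_mul_two_pi d
  have hper' : exp (-((d : ℂ) * I) * (2 * Real.pi)) = 1 := by
    rw [neg_mul, exp_neg, hper, inv_one]
  have main : ∀ k q, N + 1 ≤ q → M ≤ q + k → Φ q = 0 := by
    intro k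
    induction k with
    | zero => exact fun q _ hq => hM q hq
    | succ k ih =>
      intro q hq hk
      have z1 := ih (q + 1) (by omega) (by omega)
      have z2 := ih (q + 2) (by omega) (by omega)
      obtain ⟨c, c', hc⟩ := (hΦ q).eq_exp_of_ode hω hγ hper fun θ hθ => by
        have := h q (by omega) θ hθ
        simp only [angOp, z1, z2, Pi.zero_apply, mul_zero, add_zero] at this
        rw [hγ2]
        linear_combination this
      -- Since q ≥ N + 1, rank m = q - 1 is at least N, so its equation has no source either.
      obtain ⟨m, rfl⟩ : ∃ m, q = m + 1 := ⟨q - 1, by omega⟩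
      have hres : ∀ θ ∈ openArcs ω, deriv (deriv (Φ m)) θ - ((d : ℂ) * I) ^ 2 * Φ m θ =
          (-(2 * d * (m + 1)) * c) * exp ((d : ℂ) * I * θ) +
            (-(2 * d * (m + 1)) * c') * exp (-((d : ℂ) * I) * θ) := by
        intro θ hθ
        have := h m (by omega) θ hθ
        have z1' : Φ (m + 2) = 0 := z1
        simp only [angOp, z1', Pi.zero_apply, mul_zero, add_zero, hc θ] at this
        rw [hγ2]
        linear_combination this
      have hm : (-(2 * d * (m + 1)) : ℂ) ≠ 0 := by
        have : ((m : ℂ) + 1) ≠ 0 := by exact_mod_cast Nat.succ_ne_zero m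
        simp [hd', this]
      have h1 := resonance_coeff_eq_zero hω (hΦ m) hγ hper hres
      have h2 := resonance_coeff_eq_zero hω (hΦ m) (neg_ne_zero.mpr hγ) hper'
        (c := (-(2 * d * (m + 1)) * c')) (c' := (-(2 * d * (m + 1)) * c)) fun θ hθ => by
          rw [neg_sq, hres θ hθ, neg_neg]; ring
      have hc0 := (mul_eq_zero.mp h2).resolve_left hm
      have hc0' := (mul_eq_zero.mp h1).resolve_left hm
      ext θ
      simp [hc, hc0, hc0']
  exact fun q hq => main M q hq (by omega)

/-- In degree 0 the coupling 2d(q + 1)Φ_{q+1} disappears and rank q sees only rank q + 2. The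
solvability argument therefore skips one rank, and rank N + 1 retains a constant. -/
theorem angular_eq_const_of_angOp_eq_zero {ω : ℝ} (hω : ω ∈ Set.Ioo 0 (2 * Real.pi))
    {Φ : ℕ → ℝ → ℂ} (hΦ : ∀ q, IsAngular ω (Φ q)) {M N : ℕ}
    (hM : ∀ q, M ≤ q → Φ q = 0) (h : ∀ q, N ≤ q → ∀ θ ∈ openArcs ω, angOp 0 Φ q θ = 0) :
    (∀ q, N + 2 ≤ q → Φ q = 0) ∧ ∃ K : ℂ, ∀ θ, Φ (N + 1) θ = K := by
  have h' : ∀ q, N ≤ q → ∀ θ ∈ openArcs ω,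
      deriv (deriv (Φ q)) θ + (q + 2) * (q + 1) * Φ (q + 2) θ = 0 := fun q hq θ hθ => by
    have := h q hq θ hθ
    simp only [angOp, Int.cast_zero] at this
    linear_combination this
  have main : ∀ k q, N + 2 ≤ q → M ≤ q + k → Φ q = 0 := by
    intro k
    induction k with
    | zero => exact fun q _ hq => hM q hq
    | succ k ih =>
      intro q hq hk
      have z2 := ih (q + 2) (by omega) (by omega)
      obtain ⟨-, c, hc⟩ := (hΦ q).eq_zero_of_deriv_deriv_eq_const hω (c := 0) fun θ hθ => by
        simpa [z2] using h' q (by omega) θ hθ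
      obtain ⟨m, rfl⟩ : ∃ m, q = m + 2 := ⟨q - 2, by omega⟩
      obtain ⟨h0, -⟩ := (hΦ m).eq_zero_of_deriv_deriv_eq_const hω (c := -((m + 2) * (m + 1) * c))
        fun θ hθ => by
          have := h' m (by omega) θ hθ
          rw [hc] at this
          linear_combination this
      have hm1 : ((m : ℂ) + 1) ≠ 0 := by exact_mod_cast Nat.succ_ne_zero m
      have hm2 : ((m : ℂ) + 2) ≠ 0 := by exact_mod_cast Nat.succ_ne_zero (m + 1)
      have hc0 : c = 0 := by simpa [hm1, hm2] using h0
      ext θ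
      simp [hc, hc0]
  have hz := fun q hq => main M q hq (by omega)
  refine ⟨hz, ?_⟩
  refine ((hΦ (N + 1)).eq_zero_of_deriv_deriv_eq_const hω (c := 0) fun θ hθ => ?_).2
  simpa [hz (N + 3) (by omega)] using h' (N + 1) (by omega) θ hθ

/-! ### Harmonic quasi-homogeneous functions in one sector -/

theorem exists_const_of_hasDerivAt_zero {f : ℝ → ℂ} {α : ℝ} (hα : 0 < α)
    (h : ∀ x ∈ Set.Ioo (-α) α, HasDerivAt f 0 x) : ∃ K, ∀ x ∈ Set.Ioo (-α) α, f x = K := by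
  refine ⟨f 0, fun x hx => ?_⟩
  rcases le_total 0 x with h0 | h0
  · have hs : Set.Icc 0 x ⊆ Set.Ioo (-α) α := fun y hy => ⟨by linarith [hy.1], hy.2.trans_lt hx.2⟩
    exact eq_left_of_hasDerivAt_zero (fun y hy => (h y (hs hy)).continuousAt.continuousWithinAt)
      (fun y hy => h y (hs (Set.Ioo_subset_Icc_self hy))) x ⟨h0, le_rfl⟩
  · have hs : Set.Icc x 0 ⊆ Set.Ioo (-α) α := fun y hy => ⟨hx.1.trans_le hy.1, by linarith [hy.2]⟩
    exact (eq_left_of_hasDerivAt_zero (fun y hy => (h y (hs hy)).continuousAt.continuousWithinAt)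
      (fun y hy => h y (hs (Set.Ioo_subset_Icc_self hy))) 0 ⟨h0, le_rfl⟩).symm

theorem eqOn_Icc_of_eqOn_Ioo {f g : ℝ → ℂ} {α : ℝ} (hα : 0 < α)
    (hf : ContinuousOn f (Set.Icc (-α) α)) (hg : ContinuousOn g (Set.Icc (-α) α))
    (h : ∀ x ∈ Set.Ioo (-α) α, f x = g x) : ∀ x ∈ Set.Icc (-α) α, f x = g x := by
  have hcl : closure (Set.Ioo (-α) α) = Set.Icc (-α) α := closure_Ioo (by linarith)
  exact Set.EqOn.of_subset_closure (s := Set.Ioo (-α) α) (t := Set.Icc (-α) α) h hf hg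
    Set.Ioo_subset_Icc_self hcl.ge

theorem eq_exp_of_ode {φ : ℝ → ℂ} {α : ℝ} (hα : 0 < α) (hc : ContinuousOn φ (Set.Icc (-α) α))
    (h2 : ∀ θ ∈ Set.Ioo (-α) α, ContDiffAt ℝ 2 φ θ) {γ : ℂ} (hγ : γ ≠ 0)
    (h : ∀ θ ∈ Set.Ioo (-α) α, deriv (deriv φ) θ - γ ^ 2 * φ θ = 0) :
    ∃ c c' : ℂ, ∀ θ ∈ Set.Icc (-α) α, φ θ = c * exp (γ * θ) + c' * exp (-γ * θ) := by
  obtain ⟨K, k1⟩ := exists_const_of_hasDerivAt_zero hα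
    (f := fun θ : ℝ => (deriv φ θ - γ * φ θ) * exp (γ * θ)) (fun θ hθ =>
      (hasDerivAt_integratingFactor (h2 θ hθ) γ).congr_deriv (by rw [h θ hθ, zero_mul]))
  obtain ⟨K', k2⟩ := exists_const_of_hasDerivAt_zero hα
    (f := fun θ : ℝ => (deriv φ θ - (-γ) * φ θ) * exp (-γ * θ)) (fun θ hθ =>
      (hasDerivAt_integratingFactor (h2 θ hθ) (-γ)).congr_deriv (by
        rw [neg_sq, h θ hθ, zero_mul]))
  refine ⟨K' / (2 * γ), -K / (2 * γ), eqOn_Icc_of_eqOn_Ioo hα hc (by fun_prop) fun θ hθ => ?_⟩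
  have e2 : exp (-(γ * θ)) * exp (γ * θ) = 1 := by rw [← exp_add]; simp
  simp only [neg_mul] at k2 ⊢
  field_simp
  linear_combination (-exp (-(γ * θ))) * k1 θ hθ + exp (γ * θ) * k2 θ hθ
      - (deriv φ θ - γ * φ θ) * e2 * (-1) - (deriv φ θ + γ * φ θ) * e2

theorem eq_affine_of_deriv_deriv_eq_zero {φ : ℝ → ℂ} {α : ℝ} (hα : 0 < α)
    (hc : ContinuousOn φ (Set.Icc (-α) α)) (h2 : ∀ θ ∈ Set.Ioo (-α) α, ContDiffAt ℝ 2 φ θ)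
    (h : ∀ θ ∈ Set.Ioo (-α) α, deriv (deriv φ) θ = 0) :
    ∃ c c' : ℂ, ∀ θ ∈ Set.Icc (-α) α, φ θ = c + c' * θ := by
  obtain ⟨K, k1⟩ := exists_const_of_hasDerivAt_zero hα (f := deriv φ) (fun θ hθ =>
      (hasDerivAt_of_contDiffAt_two (h2 θ hθ)).2.congr_deriv (h θ hθ))
  obtain ⟨K', k2⟩ := exists_const_of_hasDerivAt_zero hα (f := fun θ : ℝ => φ θ - K * θ)
    (fun θ hθ => ((hasDerivAt_of_contDiffAt_two (h2 θ hθ)).1.sub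
        ((Complex.ofRealCLM.hasDerivAt (x := θ)).const_mul K)).congr_deriv (by simp [k1 θ hθ]))
  refine ⟨K', K, eqOn_Icc_of_eqOn_Ioo hα hc (by fun_prop) fun θ hθ => ?_⟩
  linear_combination k2 θ hθ

theorem expCoeff_self (σ : ℝ) (κ : ℤ) (q : ℕ) (θ : ℝ) :
    expCoeff σ κ q q θ = exp (κ * (σ * θ * I)) := by
  simp [expCoeff]

theorem expCoeff_zero_succ (σ : ℝ) (m : ℕ) (θ : ℝ) :
    expCoeff σ 0 (m + 1) m θ = (m + 1) * (σ * θ * I) := by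
  simp [expCoeff]

/-- Supplies the multiples of w^d log^M w and of its conjugate that remove the top log power. In
degree 0 they must also leave a constant top coefficient, so that the descent can go on. -/
theorem exists_leading_coeffs {d : ℤ} {M : ℕ} {H : ℕ → ℝ → ℂ} {α : ℝ} (hα : 0 < α)
    (hc : ∀ q, ContinuousOn (H q) (Set.Icc (-α) α))
    (h2 : ∀ q, ∀ θ ∈ Set.Ioo (-α) α, ContDiffAt ℝ 2 (H q) θ)
    (hM : ∀ q, M + 1 ≤ q → H q = 0)
    (hT : ∀ q < M + 1, ∀ θ ∈ Set.Ioo (-α) α, angOp d H q θ = 0)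
    (htop : d ≠ 0 ∨ ∃ K : ℂ, ∀ θ ∈ Set.Icc (-α) α, H M θ = K) :
    ∃ A B : ℂ,
      (∀ θ ∈ Set.Icc (-α) α, H M θ = A * expCoeff 1 d M M θ + B * expCoeff (-1) d M M θ) ∧
      (d ≠ 0 ∨ ∀ m, m + 1 = M → ∃ K : ℂ, ∀ θ ∈ Set.Icc (-α) α,
        H m θ - (A * expCoeff 1 d M m θ + B * expCoeff (-1) d M m θ) = K) := by
  by_cases hd : d = 0
  · subst hd
    obtain ⟨K, hK⟩ := htop.resolve_left (by simp)
    cases M with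
    | zero => exact ⟨K, 0, fun θ hθ => by simp [expCoeff_self, hK θ hθ], Or.inr (by simp)⟩
    | succ m =>
      obtain ⟨c, c', hcc⟩ := eq_affine_of_deriv_deriv_eq_zero hα (hc m) (h2 m) fun θ hθ => by
        have := hT m (by omega) θ hθ
        simpa [angOp, hM (m + 2) (by omega)] using this
      have hm : ((m : ℂ) + 1) ≠ 0 := by exact_mod_cast Nat.succ_ne_zero m
      -- The top coefficient fixes only A + B = K. The difference A - B = c' / (i(m + 1)) is chosen
      -- so that the slope c' of `H m` cancels against the iθ terms given by `expCoeff_zero_succ`.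
      refine ⟨K / 2 + c' / (2 * I * (m + 1)), K / 2 - c' / (2 * I * (m + 1)), fun θ hθ => ?_,
        Or.inr fun m' hm' => ⟨c, fun θ hθ => ?_⟩⟩
      · simp [expCoeff_self, hK θ hθ]
      · obtain rfl : m' = m := by omega
        rw [expCoeff_zero_succ, expCoeff_zero_succ, hcc θ hθ]
        push_cast
        field_simp
        ring
  · have hγ : (d : ℂ) * I ≠ 0 := mul_ne_zero (by exact_mod_cast hd) I_ne_zero
    have hγ2 : ((d : ℂ) * I) ^ 2 = -(d : ℂ) ^ 2 := by rw [mul_pow, I_sq]; ring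
    obtain ⟨c, c', h⟩ := eq_exp_of_ode hα (hc M) (h2 M) hγ fun θ hθ => by
      have := hT M (by omega) θ hθ
      simp only [angOp, hM (M + 1) le_rfl, hM (M + 2) (by omega), Pi.zero_apply, mul_zero,
        add_zero] at this
      rw [hγ2]
      linear_combination this
    refine ⟨c, c', fun θ hθ => ?_, Or.inl hd⟩
    rw [h θ hθ, expCoeff_self, expCoeff_self]
    push_cast
    ring_nf

theorem contDiff_smul_expMono {n : WithTop ℕ∞} (c : ℂ) (σ : ℝ) (a b : ℤ) (q : ℕ) :
    ContDiff ℝ n (c • expMono σ a b q) :=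
  contDiff_const.smul (contDiff_expMono σ a b q)

/-- Peel off the top log power by an explicit harmonic function and recurse on the rest. In degree 0
the condition on the top coefficient is essential: xθ is harmonic with powers of x below 2, but it
is a multiple of Im w², which needs log². -/
theorem exists_mem_logAnsatz_of_harmonic {d : ℤ} {α : ℝ} (hα : 0 < α) {M : ℕ} {H : ℕ → ℝ → ℂ}
    (hc : ∀ q, ContinuousOn (H q) (Set.Icc (-α) α))
    (h2 : ∀ q, ∀ θ ∈ Set.Ioo (-α) α, ContDiffAt ℝ 2 (H q) θ)
    (hM : ∀ q, M ≤ q → H q = 0)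
    (hlap : ∀ s : ℂ, s.im ∈ Set.Ioo (-α) α → Laplacian.laplacian (polar d M H) s = 0)
    (htop : d ≠ 0 ∨ ∀ m, m + 1 = M → ∃ K : ℂ, ∀ θ ∈ Set.Icc (-α) α, H m θ = K) :
    ∃ f ∈ logAnsatz d (fun μ q => μ = 0 ∧ q < M),
      ∀ s : ℂ, s.im ∈ Set.Icc (-α) α → polar d M H s = f s := by
  induction M generalizing H with
  | zero => exact ⟨0, Submodule.zero_mem _, fun s _ => by simp [polar]⟩
  | succ M ih =>
    have hT : ∀ q < M + 1, ∀ θ ∈ Set.Ioo (-α) α, angOp d H q θ = 0 := by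
      intro q hq θ hθ
      refine eq_zero_of_polar_eq_zero (d := d) (M := M + 1) (fun x => ?_) q hq
      rw [← laplacian_polar d (M + 1) H ⟨x, θ⟩ (fun q => h2 q θ hθ) hM]
      exact hlap _ hθ
    obtain ⟨A, B, hAB, htop'⟩ := exists_leading_coeffs hα hc h2 hM hT
      (htop.imp_right fun h => h M rfl)
    set H' : ℕ → ℝ → ℂ := fun q => if q < M then
      (fun θ => H q θ - (A * expCoeff 1 d M q θ + B * expCoeff (-1) d M q θ)) else 0 with hH'
    have hE : ∀ (σ : ℝ) (s : ℂ), expMono σ d 0 M s = polar d (M + 1) (expCoeff σ d M) s := by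
      intro σ s
      simpa using expMono_eq_polar σ d 0 (Nat.lt_succ_self M) s
    set E : ℂ → ℂ := A • expMono 1 d 0 M + B • expMono (-1) d 0 M with hEdef
    have hEmem : E ∈ logAnsatz d (fun μ q => μ = 0 ∧ q < M + 1) :=
      Submodule.add_mem _
        (Submodule.smul_mem _ _ (expMono_mem_logAnsatz (μ := 0) (Or.inl rfl) ⟨rfl, by omega⟩
          (by simp) (by simp)))
        (Submodule.smul_mem _ _ (expMono_mem_logAnsatz (μ := 0) (Or.inr rfl) ⟨rfl, by omega⟩
          (by simp) (by simp)))
    have hElap : ∀ s, Laplacian.laplacian E s = 0 := by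
      intro s
      rw [hEdef, ContDiffAt.laplacian_add
        (contDiff_smul_expMono A _ _ _ _).contDiffAt
        (contDiff_smul_expMono B _ _ _ _).contDiffAt,
        laplacian_smul _ (contDiff_expMono _ _ _ _).contDiffAt,
        laplacian_smul _ (contDiff_expMono _ _ _ _).contDiffAt,
        laplacian_expMono (by norm_num), laplacian_expMono (by norm_num)]
      simp
    have hsplit : ∀ s : ℂ, s.im ∈ Set.Icc (-α) α → polar d (M + 1) H s = polar d M H' s + E s := by
      intro s hs
      simp only [hEdef, Pi.add_apply, Pi.smul_apply, smul_eq_mul, hE, polar, Finset.sum_range_succ,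
        hAB s.im hs]
      have : ∑ q ∈ Finset.range M, (s.re : ℂ) ^ q * H' q s.im =
          ∑ q ∈ Finset.range M, (s.re : ℂ) ^ q * H q s.im -
          (A * ∑ q ∈ Finset.range M, (s.re : ℂ) ^ q * expCoeff 1 d M q s.im +
            B * ∑ q ∈ Finset.range M, (s.re : ℂ) ^ q * expCoeff (-1) d M q s.im) := by
        rw [Finset.mul_sum, Finset.mul_sum, ← Finset.sum_add_distrib, ← Finset.sum_sub_distrib]
        refine Finset.sum_congr rfl fun q hq => ?_
        simp only [hH', if_pos (Finset.mem_range.mp hq)]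
        ring
      rw [this]
      ring
    obtain ⟨f, hf, hfs⟩ := ih (H := H')
      (fun q => by
        by_cases hq : q < M
        · simp only [hH', if_pos hq]
          refine (hc q).sub (Continuous.continuousOn ?_)
          exact (continuous_const.mul (contDiff_expCoeff (n := 0) _ _ _ _).continuous).add
            (continuous_const.mul (contDiff_expCoeff (n := 0) _ _ _ _).continuous)
        · simp only [hH', if_neg hq]
          exact continuousOn_const)
      (fun q θ hθ => by
        by_cases hq : q < M
        · simp only [hH', if_pos hq]
          exact (h2 q θ hθ).sub ((contDiffAt_const.mul (contDiff_expCoeff _ _ _ _).contDiffAt).add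
            (contDiffAt_const.mul (contDiff_expCoeff _ _ _ _).contDiffAt))
        · simp only [hH', if_neg hq]
          exact contDiffAt_const)
      (fun q hq => by simp only [hH', if_neg (not_lt.mpr hq)])
      (fun s hs => by
        have hev : polar d M H' =ᶠ[𝓝 s] polar d (M + 1) H - E := by
          have ho : IsOpen {s : ℂ | s.im ∈ Set.Ioo (-α) α} := isOpen_Ioo.preimage continuous_im
          filter_upwards [ho.mem_nhds hs] with w hw
          simp [hsplit w (Set.Ioo_subset_Icc_self hw)]
        rw [(laplacian_congr_nhds hev).eq_of_nhds, ContDiffAt.laplacian_sub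
          (contDiffAt_polar d (M + 1) H s fun q => h2 q s.im hs)
          (contDiff_of_mem_logAnsatz hEmem).contDiffAt, hlap s hs, hElap, sub_zero])
      (htop'.imp_right fun h m hm => by
        obtain ⟨K, hK⟩ := h m hm
        refine ⟨K, fun θ hθ => ?_⟩
        simp only [hH', if_pos (show m < M by omega)]
        exact hK θ hθ)
    refine ⟨f + E, Submodule.add_mem _ (logAnsatz_mono (fun μ q h => ⟨h.1, by omega⟩) hf) hEmem,
      fun s hs => ?_⟩
    rw [hsplit s hs, hfs s hs, Pi.add_apply]

/-! ### One induction step: from the source to its shadow -/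

theorem two_le_top : (2 : WithTop ℕ∞) ≤ ((⊤ : ℕ∞) : WithTop ℕ∞) := by
  have : ((2 : ℕ∞) : WithTop ℕ∞) ≤ ((⊤ : ℕ∞) : WithTop ℕ∞) := by exact_mod_cast le_top
  exact this

theorem polar_eq_of_le {d : ℤ} {M M' : ℕ} {Φ : ℕ → ℝ → ℂ} (hM : ∀ q, M ≤ q → Φ q = 0)
    (h : M ≤ M') (s : ℂ) : polar d M' Φ s = polar d M Φ s := by
  rw [polar, polar]
  congr 1
  symm
  refine Finset.sum_subset (Finset.range_mono h) fun m _ hm => ?_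
  rw [hM m (by simpa using hm)]
  simp

theorem polar_eq_of_vanish {d : ℤ} {M M' : ℕ} {Φ : ℕ → ℝ → ℂ} (hM : ∀ q, M ≤ q → Φ q = 0)
    (hM' : ∀ q, M' ≤ q → Φ q = 0) (s : ℂ) : polar d M' Φ s = polar d M Φ s := by
  rcases le_total M M' with h | h
  · exact polar_eq_of_le hM h s
  · exact (polar_eq_of_le hM' h s).symm

theorem IsAngular.add {ω : ℝ} {Φ Ψ : ℝ → ℂ} (h : IsAngular ω Φ) (h' : IsAngular ω Ψ) :
    IsAngular ω (Φ + Ψ) :=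
  ⟨h.periodic.add h'.periodic, h.contDiff.add h'.contDiff, h.smooth_minus.add h'.smooth_minus,
    h.smooth_plus.add h'.smooth_plus⟩

theorem IsAngular.const_smul {ω : ℝ} {Φ : ℝ → ℂ} (c : ℂ) (h : IsAngular ω Φ) :
    IsAngular ω (c • Φ) :=
  ⟨fun x => by simp [h.periodic x], contDiff_const.smul h.contDiff,
    contDiffOn_const.smul h.smooth_minus, contDiffOn_const.smul h.smooth_plus⟩

theorem IsAngular.zero {ω : ℝ} : IsAngular ω 0 :=
  ⟨fun _ => rfl, contDiff_const, contDiffOn_const, contDiffOn_const⟩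

theorem exists_arg_exp (s : ℂ) : ∃ n : ℤ, (exp s).arg = s.im + n * (2 * Real.pi) := by
  obtain ⟨n, hn⟩ := Complex.exp_eq_exp_iff_exists_int.mp (Complex.exp_log (Complex.exp_ne_zero s))
  refine ⟨n, ?_⟩
  have := congrArg Complex.im hn
  simpa [Complex.log_im] using this

theorem periodic_arg_exp {Φ : ℝ → ℂ} (h : Function.Periodic Φ (2 * Real.pi)) (s : ℂ) :
    Φ (exp s).arg = Φ s.im := by
  obtain ⟨n, hn⟩ := exists_arg_exp s
  rw [hn]
  exact h.int_mul n s.im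

theorem exists_angular_family {ω : ℝ} {d : ℤ} {v : ({0}ᶜ : Set ℂ) → ℂ} (hv : v ∈ quasiHom ω d) :
    ∃ (M : ℕ) (Φ : ℕ → ℝ → ℂ), (∀ q, IsAngular ω (Φ q)) ∧ (∀ q, M ≤ q → Φ q = 0) ∧
      ∀ s, v ⟨exp s, exp_ne_zero s⟩ = polar d M Φ s := by
  induction hv using Submodule.span_induction with
  | mem v hv =>
    obtain ⟨q, Φ, hΦ, rfl⟩ := hv
    refine ⟨q + 1, fun m => if m = q then Φ else 0, fun m => ?_, fun m hm => ?_, fun s => ?_⟩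
    · dsimp only
      split_ifs
      exacts [hΦ, IsAngular.zero]
    · simp [show m ≠ q by omega]
    · have h1 : (‖exp s‖ : ℂ) = exp s.re := by rw [Complex.norm_exp, ofReal_exp]
      rw [polar, Finset.sum_eq_single q]
      · simp only [if_true]
        rw [h1, ← Complex.exp_int_mul, periodic_arg_exp hΦ.periodic, Complex.norm_exp,
          Real.log_exp, mul_assoc]
      · intro m _ hm
        simp [hm]
      · simp
  | zero => exact ⟨0, fun _ => 0, fun _ => IsAngular.zero, fun _ _ => rfl, fun s => by simp [polar]⟩
  | add v w _ _ hv hw =>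
    obtain ⟨M, Φ, h1, h2, h3⟩ := hv
    obtain ⟨M', Φ', k1, k2, k3⟩ := hw
    refine ⟨max M M', fun q => Φ q + Φ' q, fun q => (h1 q).add (k1 q), fun q hq => ?_, fun s => ?_⟩
    · simp [h2 q (le_trans (le_max_left _ _) hq), k2 q (le_trans (le_max_right _ _) hq)]
    · rw [polar_add, Pi.add_apply, h3, k3, polar_eq_of_le h2 (le_max_left _ _),
        polar_eq_of_le k2 (le_max_right _ _)]
  | smul c v _ hv =>
    obtain ⟨M, Φ, h1, h2, h3⟩ := hv
    refine ⟨M, fun q => c • Φ q, fun q => (h1 q).const_smul c, fun q hq => by simp [h2 q hq],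
      fun s => ?_⟩
    rw [polar_smul, Pi.smul_apply, h3, smul_eq_mul]

theorem angOp_eq_zero_of_vanish {d : ℤ} {M : ℕ} {Φ : ℕ → ℝ → ℂ} (hM : ∀ q, M ≤ q → Φ q = 0)
    {q : ℕ} (hq : M ≤ q) : angOp d Φ q = 0 := by
  ext θ
  have h0 : deriv (0 : ℝ → ℂ) = 0 := by ext; simp
  simp [angOp, hM q hq, hM (q + 1) (by omega), hM (q + 2) (by omega), h0]

theorem polar_sub (d : ℤ) (M : ℕ) (Φ Ψ : ℕ → ℝ → ℂ) (s : ℂ) :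
    polar d M (fun q => Φ q - Ψ q) s = polar d M Φ s - polar d M Ψ s := by
  simp only [polar, ← mul_sub, ← Finset.sum_sub_distrib, Pi.sub_apply]

theorem polar_zero {d : ℤ} {M : ℕ} {Φ : ℕ → ℝ → ℂ} {s : ℂ} (h : ∀ q, q < M → Φ q s.im = 0) :
    polar d M Φ s = 0 := by
  rw [polar, Finset.sum_eq_zero fun q hq => by rw [h q (Finset.mem_range.mp hq), mul_zero],
    mul_zero]

theorem exp_two_mul_polar (d : ℤ) (M : ℕ) (Φ : ℕ → ℝ → ℂ) (s : ℂ) :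
    (Real.exp (2 * s.re) : ℂ) * polar d M Φ s = polar (d + 2) M Φ s := by
  rw [polar, polar, ← mul_assoc, ofReal_exp, ← exp_add]
  congr 2
  push_cast
  ring

theorem angOp_comp_add_const (d : ℤ) (Φ : ℕ → ℝ → ℂ) (c : ℝ) (q : ℕ) (θ : ℝ) :
    angOp d (fun q t => Φ q (t + c)) q θ = angOp d Φ q (θ + c) := by
  have h : deriv (fun t => Φ q (t + c)) = fun t => deriv (Φ q) (t + c) := by
    ext t
    exact deriv_comp_add_const _ _ _
  simp only [angOp, h, deriv_comp_add_const]

/-- Treats both degrees at once: the cutoff K is N + 1 if d ≠ 0 and N + 2 if d = 0, where the top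
coefficient is constant, as `exists_mem_logAnsatz_of_harmonic` requires. -/
theorem IsAngular.exists_bound {ω : ℝ} (hω : ω ∈ Set.Ioo 0 (2 * Real.pi)) {d : ℤ}
    {Φ : ℕ → ℝ → ℂ} (hΦ : ∀ q, IsAngular ω (Φ q)) {M N : ℕ}
    (hM : ∀ q, M ≤ q → Φ q = 0) (h : ∀ q, N ≤ q → ∀ θ ∈ openArcs ω, angOp d Φ q θ = 0) :
    ∃ K, N + 1 ≤ K ∧ (∀ q, q < K → q < N + 1 ∨ (d = 0 ∧ q < N + 2)) ∧ (∀ q, K ≤ q → Φ q = 0) ∧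
      (d ≠ 0 ∨ (N + 2 ≤ K ∧ ∀ m, m + 1 = K → ∃ c : ℂ, ∀ θ, Φ m θ = c)) := by
  by_cases hd : d = 0
  · subst hd
    obtain ⟨h1, c, hc⟩ := angular_eq_const_of_angOp_eq_zero hω hΦ hM h
    refine ⟨N + 2, by omega, fun q hq => Or.inr ⟨rfl, hq⟩, h1, Or.inr ⟨le_rfl, fun m hm => ?_⟩⟩
    obtain rfl : m = N + 1 := by omega
    exact ⟨c, hc⟩
  · exact ⟨N + 1, le_rfl, fun q hq => Or.inl hq, angular_eq_zero_of_angOp_eq_zero hω hd hΦ hM h,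
      Or.inl hd⟩

/-- The conditions on B separate the three origins of monomials: ordinary and resonant particular
solutions for `hB1` and `hB2`, harmonic remainders for `hB0`. Log powers are bounded on the whole
circle before the two sectors are treated separately. -/
theorem shadow_mem_logAnsatz {ω : ℝ} (hω : ω ∈ Set.Ioo 0 (2 * Real.pi)) {d : ℤ}
    {A B : ℕ → ℕ → Prop} {N : ℕ} {U f : ℂ → ℂ}
    (hU : (fun z : ({0}ᶜ : Set ℂ) => U z) ∈ quasiHom ω (d + 2)) (hf : f ∈ logAnsatz d A)
    (hAN : ∀ μ q, A μ q → q < N)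
    (hminus : ∀ s : ℂ, s.im ∈ Set.Ioo (-(ω / 2)) (ω / 2) →
      Laplacian.laplacian U (exp s) = 4 * f s)
    (hplus : ∀ s : ℂ, s.im ∈ Set.Ioo (ω / 2) (2 * Real.pi - ω / 2) →
      Laplacian.laplacian U (exp s) = 0)
    (hB1 : ∀ μ q q', A μ q → q' ≤ q → B (μ + 1) q')
    (hB2 : ∀ μ q, A μ q → d + 1 = μ → B (μ + 1) (q + 1))
    (hB0 : ∀ q, q < N + 1 ∨ (d + 2 = 0 ∧ q < N + 2) → B 0 q) :
    (∃ g ∈ logAnsatz (d + 2) B,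
      ∀ s : ℂ, s.im ∈ Set.Icc (-(ω / 2)) (ω / 2) → U (exp s) = g s) ∧
    (∃ g ∈ logAnsatz (d + 2) B, ∀ s : ℂ,
      s.im ∈ Set.Icc (-(Real.pi - ω / 2)) (Real.pi - ω / 2) → U (-exp s) = g s) := by
  obtain ⟨M, Φ, hΦ, hM, hUΦ⟩ := exists_angular_family hU
  simp only at hUΦ
  obtain ⟨F, -, hF0, hfF⟩ := exists_polar_of_mem_logAnsatz hAN hf
  -- The extra bound q < N + 1 keeps p out of rank N + 1, whose coefficient has to remain constant
  -- in degree 0.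
  obtain ⟨p, hp, hplap⟩ := exists_particular (B := fun μ q => B μ q ∧ q < N + 1)
    (fun μ q q' h h' => ⟨hB1 μ q q' h h', by have := hAN μ q h; omega⟩)
    (fun μ q h h' => ⟨hB2 μ q h h', by have := hAN μ q h; omega⟩) hf
  obtain ⟨P, hPs, hP0, hpP⟩ := exists_polar_of_mem_logAnsatz (fun μ q h => h.2) hp
  have hfun : (fun s => U (exp s)) = polar (d + 2) M Φ := funext hUΦ
  have hlapU : ∀ s : ℂ, s.im ∈ openArcs ω → Laplacian.laplacian (polar (d + 2) M Φ) s =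
      (Real.exp (2 * s.re) : ℂ) * Laplacian.laplacian U (exp s) := by
    intro s hs
    have hcd := contDiffAt_polar (n := 2) (d + 2) M Φ s fun q => (hΦ q).contDiffAt hs
    rw [← hfun] at hcd ⊢
    exact laplacian_comp_exp (contDiffAt_of_comp_exp hcd)
  have hTminus : ∀ q, ∀ θ ∈ Set.Ioo (-(ω / 2)) (ω / 2), angOp (d + 2) Φ q θ = 4 * F q θ := by
    intro q θ hθ
    -- The range is large enough to contain both families and the rank q under study.
    have hz : ∀ x : ℝ, polar (d + 2) (M + N + q + 1)
        (fun q => angOp (d + 2) Φ q - (4 : ℂ) • F q) ⟨x, θ⟩ = 0 := by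
      intro x
      rw [polar_sub, polar_smul, polar_eq_of_le (M := M) (fun q => angOp_eq_zero_of_vanish hM)
        (by omega), polar_eq_of_le (M := N) hF0 (by omega), ← exp_two_mul_polar d N F, ← hfF,
        ← laplacian_polar (d + 2) M Φ ⟨x, θ⟩ (fun q => (hΦ q).contDiffAt (Or.inl hθ)) hM,
        hlapU _ (Or.inl hθ), hminus _ hθ]
      ring
    have := eq_zero_of_polar_eq_zero hz q (by omega)
    simpa [sub_eq_zero] using this
  have hTplus : ∀ q, ∀ θ ∈ Set.Ioo (ω / 2) (2 * Real.pi - ω / 2), angOp (d + 2) Φ q θ = 0 := by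
    intro q θ hθ
    have hz : ∀ x : ℝ, polar (d + 2) (M + q + 1) (angOp (d + 2) Φ) ⟨x, θ⟩ = 0 := by
      intro x
      rw [polar_eq_of_le (M := M) (fun q => angOp_eq_zero_of_vanish hM) (by omega),
        ← laplacian_polar (d + 2) M Φ ⟨x, θ⟩ (fun q => (hΦ q).contDiffAt (Or.inr hθ)) hM,
        hlapU _ (Or.inr hθ), hplus _ hθ, mul_zero]
    exact eq_zero_of_polar_eq_zero hz q (by omega)
  obtain ⟨K, hNK, hKB, hK0, htop⟩ := IsAngular.exists_bound hω hΦ hM (N := N) (d := d + 2)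
    fun q hq θ hθ => by
      rcases hθ with hθ | hθ
      · rw [hTminus q θ hθ, hF0 q hq, Pi.zero_apply, mul_zero]
      · exact hTplus q θ hθ
  have hUK : ∀ s, U (exp s) = polar (d + 2) K Φ s := fun s => by
    rw [hUΦ, polar_eq_of_vanish hM hK0]
  have hpK : p = polar (d + 2) K P := funext fun s => by rw [hpP, polar_eq_of_le hP0 hNK]
  have hmono : logAnsatz (d + 2) (fun μ q => μ = 0 ∧ q < K) ≤ logAnsatz (d + 2) B :=
    logAnsatz_mono fun μ q h => by
      obtain ⟨rfl, h⟩ := h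
      exact hB0 q (hKB q h)
  constructor
  · obtain ⟨g, hg, hgs⟩ := exists_mem_logAnsatz_of_harmonic (d := d + 2) (α := ω / 2) (M := K)
      (H := fun q => Φ q - P q) (by linarith [hω.1])
      (fun q => ((hΦ q).contDiff.continuous.sub (hPs q).continuous).continuousOn)
      (fun q θ hθ => ((hΦ q).contDiffAt (Or.inl hθ)).sub
        ((hPs q).of_le two_le_top).contDiffAt)
      (fun q hq => by rw [hK0 q hq, hP0 q (by omega), sub_zero])
      (fun s hs => by
        have e : polar (d + 2) K (fun q => Φ q - P q) = polar (d + 2) M Φ - p := by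
          ext s
          rw [polar_sub, Pi.sub_apply, hpK, polar_eq_of_vanish hM hK0]
        rw [e, ContDiffAt.laplacian_sub
          (contDiffAt_polar _ M Φ s fun q => (hΦ q).contDiffAt (Or.inl hs))
          (contDiff_of_mem_logAnsatz hp).contDiffAt, hlapU s (Or.inl hs), hminus s hs, hplap]
        ring)
      -- In degree 0 the top rank is at least N + 1, where P vanishes, so subtracting p does not
      -- disturb the constant.
      (htop.imp_right fun h m hm => by
        obtain ⟨c, hc⟩ := h.2 m hm
        exact ⟨c, fun θ _ => by
          rw [Pi.sub_apply, hc, hP0 m (by have := h.1; omega), Pi.zero_apply, sub_zero]⟩)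
    refine ⟨g + p, Submodule.add_mem _ (hmono hg) (logAnsatz_mono (fun μ q h => h.1) hp),
      fun s hs => ?_⟩
    rw [Pi.add_apply, ← hgs s hs, hUK, polar_sub, hpK]
    ring
  -- The variable -z turns the arc by π, making it symmetric about 0. There is no source here, hence
  -- no particular solution.
  · have harc : ∀ θ : ℝ, θ ∈ Set.Ioo (-(Real.pi - ω / 2)) (Real.pi - ω / 2) →
        θ + Real.pi ∈ Set.Ioo (ω / 2) (2 * Real.pi - ω / 2) := fun θ hθ =>
      ⟨by linarith [hθ.1], by linarith [hθ.2]⟩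
    have hcd : ∀ q, ∀ θ ∈ Set.Ioo (-(Real.pi - ω / 2)) (Real.pi - ω / 2),
        ContDiffAt ℝ 2 (fun t => Φ q (t + Real.pi)) θ := fun q θ hθ =>
      ContDiffAt.comp (g := Φ q) (f := fun t : ℝ => t + Real.pi) θ
        ((hΦ q).contDiffAt (Or.inr (harc θ hθ))) (contDiffAt_id.add contDiffAt_const)
    obtain ⟨g, hg, hgs⟩ := exists_mem_logAnsatz_of_harmonic (d := d + 2) (α := Real.pi - ω / 2)
      (M := K) (H := fun q t => Φ q (t + Real.pi)) (by linarith [hω.2])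
      (fun q => ((hΦ q).contDiff.continuous.comp (continuous_add_const _)).continuousOn) hcd
      (fun q hq => by rw [hK0 q hq]; rfl)
      (fun s hs => by
        rw [laplacian_polar _ _ _ _ (fun q => hcd q s.im hs) fun q hq => by rw [hK0 q hq]; rfl]
        refine polar_zero fun q _ => ?_
        rw [angOp_comp_add_const]
        exact hTplus q _ (harc _ hs))
      (htop.imp_right fun h m hm => by
        obtain ⟨c, hc⟩ := h.2 m hm
        exact ⟨c, fun θ _ => hc _⟩)
    refine ⟨g, hmono hg, fun s hs => ?_⟩
    have e : -exp s = exp (s + Real.pi * I) := by rw [exp_add, exp_pi_mul_I]; ring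
    rw [e, hUK, ← hgs s hs]
    simp [polar]

/-! ### Existence: the angular transmission problem -/

theorem contDiff_integral {G : ℝ → ℂ} (hG : ContDiff ℝ (⊤ : ℕ∞) G) (a : ℝ) :
    ContDiff ℝ (⊤ : ℕ∞) (fun t => ∫ s in a..t, G s) ∧
      ∀ t, HasDerivAt (fun t => ∫ s in a..t, G s) (G t) t := by
  have h : ∀ t, HasDerivAt (fun t => ∫ s in a..t, G s) (G t) t := fun t =>
    intervalIntegral.integral_hasDerivAt_right (hG.continuous.intervalIntegrable _ _)
      hG.continuous.stronglyMeasurable.stronglyMeasurableAtFilter hG.continuous.continuousAt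
  refine ⟨?_, h⟩
  rw [contDiff_infty_iff_deriv]
  refine ⟨fun t => (h t).differentiableAt, ?_⟩
  have : deriv (fun t => ∫ s in a..t, G s) = G := funext fun t => (h t).deriv
  rwa [this]

theorem contDiff_exp_mul {n : WithTop ℕ∞} (γ : ℂ) : ContDiff ℝ n fun θ : ℝ => exp (γ * θ) := by
  have h : ContDiff ℝ n (fun s : ℝ => (s : ℂ)) := Complex.ofRealCLM.contDiff
  fun_prop

theorem exists_ode_first_order {G : ℝ → ℂ} (hG : ContDiff ℝ (⊤ : ℕ∞) G) (c : ℂ) (t₀ : ℝ) (y : ℂ) :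
    ∃ φ : ℝ → ℂ, ContDiff ℝ (⊤ : ℕ∞) φ ∧ (∀ t, HasDerivAt φ (c * φ t + G t) t) ∧ φ t₀ = y := by
  obtain ⟨h1, h2⟩ := contDiff_integral ((contDiff_exp_mul (-c)).mul hG) t₀
  refine ⟨fun t => exp (c * t) * (exp (-c * t₀) * y + ∫ s in t₀..t, exp (-c * s) * G s),
    (contDiff_exp_mul c).mul (contDiff_const.add h1), fun t => ?_, ?_⟩
  · refine ((hasDerivAt_exp_mul c t).mul ((h2 t).const_add _)).congr_deriv ?_
    have : exp (c * t) * exp (-c * t) = 1 := by rw [← exp_add]; simp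
    linear_combination G t * this
  · have : exp (c * t₀) * exp (-c * t₀) = 1 := by rw [← exp_add]; simp
    simp only [intervalIntegral.integral_same, add_zero]
    linear_combination y * this

theorem exists_ode_second_order {G : ℝ → ℂ} (hG : ContDiff ℝ (⊤ : ℕ∞) G) (γ : ℂ) (t₀ : ℝ)
    (y y' : ℂ) :
    ∃ φ : ℝ → ℂ, ContDiff ℝ (⊤ : ℕ∞) φ ∧ (∀ t, deriv (deriv φ) t - γ ^ 2 * φ t = G t) ∧
      φ t₀ = y ∧ deriv φ t₀ = y' := by
  obtain ⟨χ, h1, h2, h3⟩ := exists_ode_first_order hG (-γ) t₀ (y' - γ * y)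
  obtain ⟨φ, k1, k2, k3⟩ := exists_ode_first_order h1 γ t₀ y
  have hd : deriv φ = fun t => γ * φ t + χ t := funext fun t => (k2 t).deriv
  refine ⟨φ, k1, fun t => ?_, k3, ?_⟩
  · rw [hd, (((k2 t).const_mul γ).fun_add (h2 t)).deriv]
    ring
  · rw [hd]
    simp only [k3, h3]
    ring

/-- The smooth functions `φ` on `|θ| ≤ ω/2` and `ψ` on `ω/2 ≤ θ ≤ 2π - ω/2` fit together to a
function of class `C^1` on the circle. -/
structure Matched (ω : ℝ) (φ ψ : ℝ → ℂ) : Prop where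
  left : ContDiff ℝ (⊤ : ℕ∞) φ
  right : ContDiff ℝ (⊤ : ℕ∞) ψ
  val : φ (ω / 2) = ψ (ω / 2)
  slope : deriv φ (ω / 2) = deriv ψ (ω / 2)
  val' : ψ (2 * Real.pi - ω / 2) = φ (-(ω / 2))
  slope' : deriv ψ (2 * Real.pi - ω / 2) = deriv φ (-(ω / 2))

theorem differentiable_of_contDiff_top {φ : ℝ → ℂ} (h : ContDiff ℝ (⊤ : ℕ∞) φ) :
    Differentiable ℝ φ := h.differentiable (by simp)

theorem contDiff_deriv_top {φ : ℝ → ℂ} (h : ContDiff ℝ (⊤ : ℕ∞) φ) :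
    ContDiff ℝ (⊤ : ℕ∞) (deriv φ) := (contDiff_infty_iff_deriv.mp h).2

theorem Matched.add {ω : ℝ} {φ ψ φ' ψ' : ℝ → ℂ} (h : Matched ω φ ψ) (h' : Matched ω φ' ψ') :
    Matched ω (φ + φ') (ψ + ψ') := by
  have e : ∀ {f g : ℝ → ℂ}, ContDiff ℝ (⊤ : ℕ∞) f → ContDiff ℝ (⊤ : ℕ∞) g → ∀ x,
      deriv (f + g) x = deriv f x + deriv g x := fun hf hg x =>
    deriv_add (differentiable_of_contDiff_top hf x) (differentiable_of_contDiff_top hg x)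
  refine ⟨h.left.add h'.left, h.right.add h'.right, ?_, ?_, ?_, ?_⟩
  · simp [h.val, h'.val]
  · rw [e h.left h'.left, e h.right h'.right, h.slope, h'.slope]
  · simp [h.val', h'.val']
  · rw [e h.left h'.left, e h.right h'.right, h.slope', h'.slope']

theorem Matched.of_periodic {ω : ℝ} {φ : ℝ → ℂ} (h : ContDiff ℝ (⊤ : ℕ∞) φ)
    (hp : Function.Periodic φ (2 * Real.pi)) : Matched ω φ φ := by
  have e : 2 * Real.pi - ω / 2 = -(ω / 2) + 2 * Real.pi := by ring
  exact ⟨h, h, rfl, rfl, by rw [e, hp], by rw [e, periodic_deriv hp]⟩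

theorem Matched.zero {ω : ℝ} : Matched ω 0 0 :=
  .of_periodic contDiff_const fun _ => rfl

/-- The derivatives are glued first, to a continuous periodic function; its primitive is C^1 and
agrees with φ and ψ on their arcs. Periodicity of the primitive is the condition `val'`. -/
theorem Matched.exists_angular {ω : ℝ} (hω : ω ∈ Set.Ioo 0 (2 * Real.pi)) {φ ψ : ℝ → ℂ}
    (h : Matched ω φ ψ) : ∃ Φ, IsAngular ω Φ ∧ (∀ θ ∈ Set.Icc (-(ω / 2)) (ω / 2), Φ θ = φ θ) ∧
      ∀ θ ∈ Set.Icc (ω / 2) (2 * Real.pi - ω / 2), Φ θ = ψ θ := by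
  obtain ⟨hω0, hω1⟩ := hω
  have hpi : (0 : ℝ) < 2 * Real.pi := Real.two_pi_pos
  have : Fact (0 < 2 * Real.pi) := ⟨hpi⟩
  set β := ω / 2 with hβ
  have hβ0 : -β < β := by linarith
  have hβ1 : β < 2 * Real.pi - β := by linarith
  set g₀ : ℝ → ℂ := fun θ => if θ ≤ β then deriv φ θ else deriv ψ θ with hg₀
  have hg₀c : Continuous g₀ := Continuous.if_le (contDiff_deriv_top h.left).continuous
    (contDiff_deriv_top h.right).continuous continuous_id continuous_const
    (fun θ hθ => by rw [hθ]; exact h.slope)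
  set g : ℝ → ℂ := fun θ => AddCircle.liftIco (2 * Real.pi) (-β) g₀ (θ : AddCircle (2 * Real.pi))
    with hg
  have hends : g₀ (-β) = g₀ (-β + 2 * Real.pi) := by
    simp only [hg₀]
    rw [if_pos hβ0.le, if_neg (by linarith), show -β + 2 * Real.pi = 2 * Real.pi - β by ring]
    exact h.slope'.symm
  have hgc : Continuous g :=
    (AddCircle.liftIco_continuous hends hg₀c.continuousOn).comp (AddCircle.continuous_mk' _)
  have hgp : Function.Periodic g (2 * Real.pi) := fun θ => by simp [hg]
  have hgIco : ∀ θ ∈ Set.Ico (-β) (-β + 2 * Real.pi), g θ = g₀ θ := fun θ hθ =>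
    AddCircle.liftIco_coe_apply hθ
  have hgIcc : ∀ θ ∈ Set.Icc (-β) (-β + 2 * Real.pi), g θ = g₀ θ := fun θ hθ => by
    rcases hθ.2.lt_or_eq with h' | h'
    · exact hgIco θ ⟨hθ.1, h'⟩
    · rw [h', ← hends, hgp]
      exact hgIco _ ⟨le_rfl, by linarith⟩
  have hgφ : ∀ θ ∈ Set.Icc (-β) β, g θ = deriv φ θ := fun θ hθ => by
    rw [hgIcc θ ⟨hθ.1, by linarith [hθ.2]⟩]
    exact if_pos hθ.2
  have hgψ : ∀ θ ∈ Set.Icc β (2 * Real.pi - β), g θ = deriv ψ θ := fun θ hθ => by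
    rw [hgIcc θ ⟨by linarith [hθ.1], by linarith [hθ.2]⟩]
    rcases hθ.1.lt_or_eq with h' | h'
    · exact if_neg (not_le.mpr h')
    · rw [← h']
      simp only [hg₀, le_refl, if_true]
      exact h.slope
  set Φ : ℝ → ℂ := fun θ => φ (-β) + ∫ t in (-β)..θ, g t with hΦ
  have hint : ∀ a b, IntervalIntegrable g MeasureTheory.volume a b := fun a b =>
    hgc.intervalIntegrable a b
  have hderiv : ∀ θ, HasDerivAt Φ (g θ) θ := fun θ =>
    (intervalIntegral.integral_hasDerivAt_right (hint _ _)
      hgc.stronglyMeasurable.stronglyMeasurableAtFilter hgc.continuousAt).const_add _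
  have hftc : ∀ {f : ℝ → ℂ} {a b : ℝ}, ContDiff ℝ (⊤ : ℕ∞) f → a ≤ b →
      (∀ θ ∈ Set.Icc a b, g θ = deriv f θ) → ∫ t in a..b, g t = f b - f a := by
    intro f a b hf hab hfg
    rw [intervalIntegral.integral_congr (g := deriv f) fun θ hθ => hfg θ (by
      rwa [Set.uIcc_of_le hab] at hθ)]
    exact intervalIntegral.integral_deriv_eq_sub (fun θ _ => differentiable_of_contDiff_top hf θ)
      ((contDiff_deriv_top hf).continuous.intervalIntegrable _ _)
  have hΦφ : ∀ θ ∈ Set.Icc (-β) β, Φ θ = φ θ := fun θ hθ => by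
    simp only [hΦ]
    rw [hftc h.left hθ.1 fun t ht => hgφ t ⟨ht.1, ht.2.trans hθ.2⟩]
    ring
  have hΦψ : ∀ θ ∈ Set.Icc β (2 * Real.pi - β), Φ θ = ψ θ := fun θ hθ => by
    simp only [hΦ]
    rw [← intervalIntegral.integral_add_adjacent_intervals (hint (-β) β) (hint β θ),
      hftc h.left hβ0.le hgφ, hftc h.right hθ.1 fun t ht => hgψ t ⟨ht.1, ht.2.trans hθ.2⟩, h.val]
    ring
  refine ⟨Φ, ⟨?_, ?_, ?_, ?_⟩, hΦφ, hΦψ⟩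
  · intro θ
    have h1 := hgp.intervalIntegral_add_eq θ (-β)
    have h2 : Φ (-β + 2 * Real.pi) = Φ (-β) := by
      rw [show -β + 2 * Real.pi = 2 * Real.pi - β by ring, hΦψ _ ⟨hβ1.le, le_rfl⟩,
        hΦφ _ ⟨le_rfl, hβ0.le⟩]
      exact h.val'
    simp only [hΦ] at h2 ⊢
    rw [intervalIntegral.integral_same, add_zero] at h2
    rw [← intervalIntegral.integral_add_adjacent_intervals (hint (-β) θ)
      (hint θ (θ + 2 * Real.pi)), h1]
    linear_combination h2
  · rw [contDiff_one_iff_deriv]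
    refine ⟨fun θ => (hderiv θ).differentiableAt, ?_⟩
    rwa [show deriv Φ = g from funext fun θ => (hderiv θ).deriv]
  · exact h.left.contDiffOn.congr hΦφ
  · exact h.right.contDiffOn.congr hΦψ

/-- The functions t e^{±γt} fail to be periodic by multiples of e^{±γt}, which suffices to prescribe
the jumps of value and slope over one turn, at the price of a resonant right-hand side. -/
theorem exists_resonant_pair {γ : ℂ} (hγ : γ ≠ 0) (hper : exp (γ * (2 * Real.pi)) = 1) (a : ℝ)
    (y y' : ℂ) : ∃ (h : ℝ → ℂ) (c c' : ℂ), ContDiff ℝ (⊤ : ℕ∞) h ∧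
      (∀ t, deriv (deriv h) t - γ ^ 2 * h t = c * exp (γ * t) + c' * exp (-γ * t)) ∧
      h (a + 2 * Real.pi) - h a = y ∧ deriv h (a + 2 * Real.pi) - deriv h a = y' := by
  have hpi : (Real.pi : ℂ) ≠ 0 := by exact_mod_cast Real.pi_ne_zero
  -- For h = A t e^{γt} + B t e^{-γt} the jumps are 2π(Ae^{γa} + Be^{-γa}) and 2πγ(Ae^{γa} -
  -- Be^{-γa}); A and B solve this system.
  set A : ℂ := (y + y' / γ) / (4 * Real.pi) * exp (-γ * a)
  set B : ℂ := (y - y' / γ) / (4 * Real.pi) * exp (γ * a)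
  have hA : A * exp (γ * a) = (y + y' / γ) / (4 * Real.pi) := by
    simp only [A, mul_assoc, ← exp_add]; simp
  have hB : B * exp (-γ * a) = (y - y' / γ) / (4 * Real.pi) := by
    simp only [B, mul_assoc, ← exp_add]; simp
  clear_value A B
  have hA' : A * exp (γ * a) * (4 * Real.pi) = y + y' / γ := by rw [hA]; field_simp
  have hB' : B * exp (-γ * a) * (4 * Real.pi) = y - y' / γ := by rw [hB]; field_simp
  have hδ : γ * (y' / γ) = y' := mul_div_cancel₀ _ hγ
  have hof : ∀ t : ℝ, HasDerivAt (fun t : ℝ => (t : ℂ)) 1 t := fun t => by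
    simpa using (hasDerivAt_id t).ofReal_comp
  have h1 : ∀ t : ℝ, HasDerivAt (fun t : ℝ => A * (t * exp (γ * t)) + B * (t * exp (-γ * t)))
      (A * (1 * exp (γ * t) + t * (γ * exp (γ * t))) +
        B * (1 * exp (-γ * t) + t * (-γ * exp (-γ * t)))) t := fun t =>
    (((hof t).mul (hasDerivAt_exp_mul γ t)).const_mul A).add
      (((hof t).mul (hasDerivAt_exp_mul (-γ) t)).const_mul B)
  have hd := funext fun t => (h1 t).deriv
  have e1 : exp (γ * ((a + 2 * Real.pi : ℝ) : ℂ)) = exp (γ * a) := by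
    push_cast; rw [mul_add, exp_add, hper, mul_one]
  have e2 : exp (-γ * ((a + 2 * Real.pi : ℝ) : ℂ)) = exp (-γ * a) := by
    rw [neg_mul, exp_neg, e1, neg_mul, exp_neg]
  refine ⟨fun t : ℝ => A * (t * exp (γ * t)) + B * (t * exp (-γ * t)), 2 * γ * A, -(2 * γ * B),
    ?_, fun t => ?_, ?_, ?_⟩
  rotate_left
  · rw [hd, ((((hasDerivAt_exp_mul γ t).const_mul 1).fun_add ((hof t).fun_mul
      ((hasDerivAt_exp_mul γ t).const_mul γ))).const_mul A |>.fun_add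
      ((((hasDerivAt_exp_mul (-γ) t).const_mul 1).fun_add ((hof t).fun_mul
      ((hasDerivAt_exp_mul (-γ) t).const_mul (-γ)))).const_mul B)).deriv]
    ring
  · simp only [e1, e2]
    push_cast
    linear_combination (hA' + hB') / 2
  · rw [hd]
    simp only [e1, e2]
    push_cast
    linear_combination γ / 2 * (hA' - hB') + hδ
  · have h : ContDiff ℝ (⊤ : ℕ∞) (fun s : ℝ => (s : ℂ)) := Complex.ofRealCLM.contDiff
    fun_prop

theorem exists_resonant_pair_zero (a : ℝ) (y y' : ℂ) :
    ∃ (h : ℝ → ℂ) (c : ℂ), ContDiff ℝ (⊤ : ℕ∞) h ∧ (∀ t, deriv (deriv h) t = c) ∧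
      h (a + 2 * Real.pi) - h a = y ∧ deriv h (a + 2 * Real.pi) - deriv h a = y' := by
  have hpi : (Real.pi : ℂ) ≠ 0 := by exact_mod_cast Real.pi_ne_zero
  set b : ℂ := y' / (2 * Real.pi)
  set A : ℂ := y / (2 * Real.pi) - b * (a + Real.pi)
  have hof : ∀ t : ℝ, HasDerivAt (fun t : ℝ => (t : ℂ)) 1 t := fun t => by
    simpa using (hasDerivAt_id t).ofReal_comp
  have h1 : ∀ t : ℝ, HasDerivAt (fun t : ℝ => A * t + b / 2 * (t : ℂ) ^ 2) (A + b * t) t :=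
    fun t => (((hof t).const_mul A).add (((hof t).pow 2).const_mul (b / 2))).congr_deriv (by
      push_cast; ring)
  have hd := funext fun t => (h1 t).deriv
  refine ⟨fun t : ℝ => A * t + b / 2 * (t : ℂ) ^ 2, b, ?_, fun t => ?_, ?_, ?_⟩
  rotate_left
  · rw [hd, (((hof t).const_mul b).const_add A).deriv, mul_one]
  · simp only [A]
    push_cast
    field_simp
    ring
  · rw [hd]
    simp only [b]
    push_cast
    field_simp
    ring
  · have h : ContDiff ℝ (⊤ : ℕ∞) (fun s : ℝ => (s : ℂ)) := Complex.ofRealCLM.contDiff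
    fun_prop

/-- Solvability of the angular transmission problem, up to a resonant right-hand side. -/
theorem exists_matched_of_resonant {ω : ℝ} {γ : ℂ} {χ : ℂ → ℂ → ℝ → ℂ}
    (hres : ∀ (a : ℝ) (y y' : ℂ), ∃ (h : ℝ → ℂ) (c c' : ℂ), ContDiff ℝ (⊤ : ℕ∞) h ∧
      (∀ t, deriv (deriv h) t - γ ^ 2 * h t = χ c c' t) ∧
      h (a + 2 * Real.pi) - h a = y ∧ deriv h (a + 2 * Real.pi) - deriv h a = y')
    {F G : ℝ → ℂ} (hF : ContDiff ℝ (⊤ : ℕ∞) F) (hG : ContDiff ℝ (⊤ : ℕ∞) G) :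
    ∃ (φ ψ : ℝ → ℂ) (c c' : ℂ), Matched ω φ ψ ∧
      (∀ t, deriv (deriv φ) t - γ ^ 2 * φ t = F t + χ c c' t) ∧
      ∀ t, deriv (deriv ψ) t - γ ^ 2 * ψ t = G t + χ c c' t := by
  obtain ⟨φ, f1, f2, -, -⟩ := exists_ode_second_order hF γ 0 0 0
  obtain ⟨ψ, g1, g2, g3, g4⟩ := exists_ode_second_order hG γ (ω / 2) (φ (ω / 2)) (deriv φ (ω / 2))
  have e : 2 * Real.pi - ω / 2 = -(ω / 2) + 2 * Real.pi := by ring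
  -- The same h is added on both arcs: it keeps the matching at ω/2 and its jump over 2π cancels the
  -- mismatch at the other ray.
  obtain ⟨h, c, c', h1, h2, h3, h4⟩ := hres (-(ω / 2)) (φ (-(ω / 2)) - ψ (2 * Real.pi - ω / 2))
    (deriv φ (-(ω / 2)) - deriv ψ (2 * Real.pi - ω / 2))
  rw [← e] at h3 h4
  have hd : ∀ {f g : ℝ → ℂ}, ContDiff ℝ (⊤ : ℕ∞) f → ContDiff ℝ (⊤ : ℕ∞) g →
      deriv (f + g) = deriv f + deriv g := fun hf hg => funext fun x =>
    deriv_add (differentiable_of_contDiff_top hf x) (differentiable_of_contDiff_top hg x)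
  refine ⟨φ + h, ψ + h, c, c', ⟨f1.add h1, g1.add h1, ?_, ?_, ?_, ?_⟩, fun t => ?_, fun t => ?_⟩
  · simp [g3]
  · simp [hd f1 h1, hd g1 h1, g4]
  · simp only [Pi.add_apply]
    linear_combination h3
  · simp only [hd f1 h1, hd g1 h1, Pi.add_apply]
    linear_combination h4
  · rw [hd f1 h1, hd (contDiff_deriv_top f1) (contDiff_deriv_top h1)]
    simp only [Pi.add_apply]
    linear_combination f2 t + h2 t
  · rw [hd g1 h1, hd (contDiff_deriv_top g1) (contDiff_deriv_top h1)]
    simp only [Pi.add_apply]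
    linear_combination g2 t + h2 t

theorem angOp_add (d : ℤ) {Φ Ψ : ℕ → ℝ → ℂ} (hΦ : ∀ q, ContDiff ℝ (⊤ : ℕ∞) (Φ q))
    (hΨ : ∀ q, ContDiff ℝ (⊤ : ℕ∞) (Ψ q)) (q : ℕ) :
    angOp d (fun q => Φ q + Ψ q) q = angOp d Φ q + angOp d Ψ q := by
  have hd : ∀ {f g : ℝ → ℂ}, ContDiff ℝ (⊤ : ℕ∞) f → ContDiff ℝ (⊤ : ℕ∞) g →
      deriv (f + g) = deriv f + deriv g := fun hf hg => funext fun x =>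
    deriv_add (differentiable_of_contDiff_top hf x) (differentiable_of_contDiff_top hg x)
  ext θ
  simp only [angOp, hd (hΦ q) (hΨ q), hd (contDiff_deriv_top (hΦ q)) (contDiff_deriv_top (hΨ q)),
    Pi.add_apply]
  ring

theorem contDiff_angOp (d : ℤ) {Φ : ℕ → ℝ → ℂ} (hΦ : ∀ q, ContDiff ℝ (⊤ : ℕ∞) (Φ q)) (q : ℕ) :
    ContDiff ℝ (⊤ : ℕ∞) (angOp d Φ q) := by
  have h0 := hΦ q
  have h1 := hΦ (q + 1)
  have h2 := hΦ (q + 2)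
  have h3 := contDiff_deriv_top (contDiff_deriv_top h0)
  unfold angOp
  fun_prop

/-- The three consecutive coefficients `Φ, χ₁, χ₂` at the ranks `N, N + 1, N + 2`. -/
noncomputable def threeTerms (N : ℕ) (Φ χ₁ χ₂ : ℝ → ℂ) (q : ℕ) : ℝ → ℂ :=
  if q = N then Φ else if q = N + 1 then χ₁ else if q = N + 2 then χ₂ else 0

theorem angOp_threeTerms {d : ℤ} {N : ℕ} {Φ χ₁ χ₂ F : ℝ → ℂ}
    (h0 : ∀ t, deriv (deriv Φ) t + d ^ 2 * Φ t + 2 * d * (N + 1) * χ₁ t +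
      (N + 2) * (N + 1) * χ₂ t = F t)
    (h1 : ∀ t, deriv (deriv χ₁) t + d ^ 2 * χ₁ t + 2 * d * (N + 2) * χ₂ t = 0)
    (h2 : ∀ t, deriv (deriv χ₂) t + d ^ 2 * χ₂ t = 0) :
    angOp d (threeTerms N Φ χ₁ χ₂) N = F ∧ ∀ q, N < q → angOp d (threeTerms N Φ χ₁ χ₂) q = 0 := by
  have e0 : threeTerms N Φ χ₁ χ₂ N = Φ := by simp [threeTerms]
  have e1 : threeTerms N Φ χ₁ χ₂ (N + 1) = χ₁ := by simp [threeTerms]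
  have e2 : threeTerms N Φ χ₁ χ₂ (N + 2) = χ₂ := by simp [threeTerms]
  have e3 : ∀ q, N + 3 ≤ q → threeTerms N Φ χ₁ χ₂ q = 0 := fun q hq => by
    simp [threeTerms, show q ≠ N by omega, show q ≠ N + 1 by omega, show q ≠ N + 2 by omega]
  refine ⟨?_, fun q hq => ?_⟩
  · ext t
    simpa only [angOp, e0, e1, e2] using h0 t
  · obtain rfl | rfl | hq : q = N + 1 ∨ q = N + 2 ∨ N + 3 ≤ q := by omega
    · ext t
      simp only [angOp, e1, e2, e3 (N + 1 + 2) le_rfl, Pi.zero_apply]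
      push_cast
      linear_combination h1 t
    · ext t
      simp only [angOp, e2, e3 (N + 2 + 1) le_rfl, e3 (N + 2 + 2) (by omega), Pi.zero_apply]
      linear_combination h2 t
    · exact angOp_eq_zero_of_vanish e3 hq

theorem threeTerms_vanish {N : ℕ} {Φ χ₁ χ₂ : ℝ → ℂ} {q : ℕ} (hq : N + 3 ≤ q) :
    threeTerms N Φ χ₁ χ₂ q = 0 := by
  simp [threeTerms, show q ≠ N by omega, show q ≠ N + 1 by omega, show q ≠ N + 2 by omega]

theorem matched_threeTerms {ω : ℝ} {N : ℕ} {φ ψ χ₁ χ₂ : ℝ → ℂ} (h : Matched ω φ ψ)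
    (h1 : Matched ω χ₁ χ₁) (h2 : Matched ω χ₂ χ₂) (q : ℕ) :
    Matched ω (threeTerms N φ χ₁ χ₂ q) (threeTerms N ψ χ₁ χ₂ q) := by
  unfold threeTerms
  split_ifs
  exacts [h, h1, h2, Matched.zero]

/-- The resonant right-hand side left by the matching is absorbed by a periodic coefficient of
higher log power: χ₁, one rank up, if d ≠ 0; and χ₂, two ranks up and constant, if d = 0, where
adjacent ranks do not interact. -/
theorem exists_resonant_term {ω : ℝ} (d : ℤ) (N : ℕ) {F G : ℝ → ℂ}
    (hF : ContDiff ℝ (⊤ : ℕ∞) F) (hG : ContDiff ℝ (⊤ : ℕ∞) G) :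
    ∃ φ ψ χ₁ χ₂ : ℝ → ℂ, Matched ω φ ψ ∧ Matched ω χ₁ χ₁ ∧ Matched ω χ₂ χ₂ ∧
      (∀ t, deriv (deriv φ) t + d ^ 2 * φ t + 2 * d * (N + 1) * χ₁ t +
        (N + 2) * (N + 1) * χ₂ t = F t) ∧
      (∀ t, deriv (deriv ψ) t + d ^ 2 * ψ t + 2 * d * (N + 1) * χ₁ t +
        (N + 2) * (N + 1) * χ₂ t = G t) ∧
      (∀ t, deriv (deriv χ₁) t + d ^ 2 * χ₁ t + 2 * d * (N + 2) * χ₂ t = 0) ∧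
      (∀ t, deriv (deriv χ₂) t + d ^ 2 * χ₂ t = 0) := by
  have hN1 : ((N : ℂ) + 1) ≠ 0 := by exact_mod_cast Nat.succ_ne_zero N
  have hN2 : ((N : ℂ) + 2) ≠ 0 := by exact_mod_cast Nat.succ_ne_zero (N + 1)
  have d0 : deriv (0 : ℝ → ℂ) = 0 := by ext; simp
  by_cases hd : d = 0
  · subst hd
    obtain ⟨φ, ψ, c, c', h1, h2, h3⟩ := exists_matched_of_resonant (ω := ω) (γ := 0)
      (χ := fun c _ _ => c) (fun a y y' => by
        obtain ⟨h, c, h1, h2, h3, h4⟩ := exists_resonant_pair_zero a y y'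
        exact ⟨h, c, 0, h1, fun t => by simp [h2], h3, h4⟩) hF hG
    have hc : Matched ω (fun _ => -c / ((N + 2) * (N + 1)))
        (fun _ => -c / ((N + 2) * (N + 1))) := .of_periodic contDiff_const fun _ => rfl
    refine ⟨φ, ψ, 0, fun _ => -c / ((N + 2) * (N + 1)), h1, .zero, hc, fun t => ?_, fun t => ?_,
      fun t => ?_, fun t => ?_⟩
    · simp only [Pi.zero_apply]
      field_simp
      push_cast
      linear_combination h2 t
    · simp only [Pi.zero_apply]
      field_simp
      push_cast
      linear_combination h3 t
    · simp [d0]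
    · simp
  · have hd' : (d : ℂ) ≠ 0 := by exact_mod_cast hd
    have hγ : (d : ℂ) * I ≠ 0 := mul_ne_zero hd' I_ne_zero
    have hγ2 : ((d : ℂ) * I) ^ 2 = -(d : ℂ) ^ 2 := by rw [mul_pow, I_sq]; ring
    have hper := exp_int_mul_I_mul_two_pi d
    obtain ⟨φ, ψ, c, c', h1, h2, h3⟩ := exists_matched_of_resonant (ω := ω) (γ := d * I)
      (χ := fun c c' t => c * exp ((d * I) * t) + c' * exp (-(d * I) * t))
      (exists_resonant_pair hγ hper) hF hG
    -- Normalised so that the coupling 2d(N + 1)χ₁ is exactly minus the resonant term.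
    set K : ℂ := -1 / (2 * d * (N + 1)) with hK
    have hK' : 2 * d * (N + 1) * K = -1 := by rw [hK]; field_simp
    clear_value K
    set χ : ℝ → ℂ := fun t => K * (c * exp ((d * I) * t) + c' * exp (-(d * I) * t)) with hχ
    have hs : ContDiff ℝ (⊤ : ℕ∞) χ :=
      contDiff_const.mul ((contDiff_const.mul (contDiff_exp_mul _)).add
        (contDiff_const.mul (contDiff_exp_mul _)))
    have hχp : Function.Periodic χ (2 * Real.pi) := fun t => by
      have e1 : exp ((d * I) * ((t + 2 * Real.pi : ℝ) : ℂ)) = exp ((d * I) * t) := by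
        push_cast; rw [mul_add, exp_add, hper, mul_one]
      have e2 : exp (-(d * I) * ((t + 2 * Real.pi : ℝ) : ℂ)) = exp (-(d * I) * t) := by
        rw [neg_mul, exp_neg, e1, neg_mul, exp_neg]
      simp only [hχ, e1, e2]
    have hd1 : deriv χ = fun t : ℝ => K * (c * ((d * I) * exp ((d * I) * t)) +
        c' * (-(d * I) * exp (-(d * I) * t))) := funext fun t =>
      ((((hasDerivAt_exp_mul (d * I) t).const_mul c).fun_add
        ((hasDerivAt_exp_mul (-(d * I)) t).const_mul c')).const_mul K).deriv
    have hd2 : ∀ t, deriv (deriv χ) t = -(d : ℂ) ^ 2 * χ t := fun t => by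
      rw [hd1, (((((hasDerivAt_exp_mul (d * I) t).const_mul (d * I)).const_mul c).fun_add
        (((hasDerivAt_exp_mul (-(d * I)) t).const_mul (-(d * I))).const_mul c')).const_mul K).deriv]
      rw [← hγ2]
      simp only [hχ]
      ring
    refine ⟨φ, ψ, χ, 0, h1, .of_periodic hs hχp, .zero, fun t => ?_, fun t => ?_, fun t => ?_,
      fun t => by simp [d0]⟩
    · have := h2 t
      rw [hγ2] at this
      simp only [Pi.zero_apply, hχ]
      linear_combination this + (c * exp ((d * I) * t) + c' * exp (-(d * I) * t)) * hK'
    · have := h3 t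
      rw [hγ2] at this
      simp only [Pi.zero_apply, hχ]
      linear_combination this + (c * exp ((d * I) * t) + c' * exp (-(d * I) * t)) * hK'
    · rw [hd2]
      simp

/-- Induction on the number of ranks of the source. The top rank N is solved with at most two extra
higher ranks; this perturbs no equation above N, and its effect below N goes into the source of the
induction hypothesis. -/
theorem exists_matched_family {ω : ℝ} (d : ℤ) (N : ℕ) {F G : ℕ → ℝ → ℂ}
    (hF : ∀ q, ContDiff ℝ (⊤ : ℕ∞) (F q)) (hG : ∀ q, ContDiff ℝ (⊤ : ℕ∞) (G q))
    (hF0 : ∀ q, N ≤ q → F q = 0) (hG0 : ∀ q, N ≤ q → G q = 0) :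
    ∃ (M : ℕ) (φ ψ : ℕ → ℝ → ℂ), (∀ q, Matched ω (φ q) (ψ q)) ∧
      (∀ q, M ≤ q → φ q = 0 ∧ ψ q = 0) ∧ ∀ q, angOp d φ q = F q ∧ angOp d ψ q = G q := by
  induction N generalizing F G with
  | zero =>
    refine ⟨0, fun _ => 0, fun _ => 0, fun _ => .zero, fun _ _ => ⟨rfl, rfl⟩, fun q => ?_⟩
    rw [hF0 q q.zero_le, hG0 q q.zero_le]
    exact ⟨angOp_eq_zero_of_vanish (M := 0) (fun _ _ => rfl) q.zero_le,
      angOp_eq_zero_of_vanish (M := 0) (fun _ _ => rfl) q.zero_le⟩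
  | succ N ih =>
    obtain ⟨f, g, χ₁, χ₂, m0, m1, m2, h1, h2, h3, h4⟩ := exists_resonant_term (ω := ω) d N
      (hF N) (hG N)
    obtain ⟨hf0, hf1⟩ := angOp_threeTerms h1 h3 h4
    obtain ⟨hg0, hg1⟩ := angOp_threeTerms h2 h3 h4
    have hm := fun q => matched_threeTerms (N := N) m0 m1 m2 q
    have hsub : ∀ {F : ℕ → ℝ → ℂ} {f : ℝ → ℂ}, (∀ q, ContDiff ℝ (⊤ : ℕ∞) (F q)) →
        (∀ q, ContDiff ℝ (⊤ : ℕ∞) (threeTerms N f χ₁ χ₂ q)) → ∀ q, ContDiff ℝ (⊤ : ℕ∞)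
        (if q < N then F q - angOp d (threeTerms N f χ₁ χ₂) q else 0) := by
      intro F f hF hf q
      split_ifs
      · exact (hF q).sub (contDiff_angOp d hf q)
      · exact contDiff_const
    obtain ⟨M, φ, ψ, k1, k2, k3⟩ := ih (hsub hF fun q => (hm q).left)
      (hsub hG fun q => (hm q).right) (fun q hq => if_neg (not_lt.mpr hq))
      (fun q hq => if_neg (not_lt.mpr hq))
    have hfin : ∀ {F φ : ℕ → ℝ → ℂ} {f : ℝ → ℂ}, (∀ q, N + 1 ≤ q → F q = 0) →
        angOp d (threeTerms N f χ₁ χ₂) N = F N →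
        (∀ q, N < q → angOp d (threeTerms N f χ₁ χ₂) q = 0) →
        (∀ q, angOp d φ q = if q < N then F q - angOp d (threeTerms N f χ₁ χ₂) q else 0) →
        ∀ q, angOp d φ q + angOp d (threeTerms N f χ₁ χ₂) q = F q := by
      intro F φ f hF0 h0 h1 hφ q
      rw [hφ]
      rcases lt_trichotomy q N with hq | rfl | hq
      · rw [if_pos hq, sub_add_cancel]
      · rw [if_neg (lt_irrefl _), h0, zero_add]
      · rw [if_neg (by omega), h1 q hq, hF0 q hq, zero_add]
    refine ⟨max M (N + 3), fun q => φ q + threeTerms N f χ₁ χ₂ q,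
      fun q => ψ q + threeTerms N g χ₁ χ₂ q, fun q => (k1 q).add (hm q), fun q hq => ?_,
      fun q => ?_⟩
    · have a := k2 q (le_trans (le_max_left _ _) hq)
      have b : N + 3 ≤ q := le_trans (le_max_right _ _) hq
      simp [a, threeTerms_vanish b]
    · rw [angOp_add d (fun q => (k1 q).left) fun q => (hm q).left,
        angOp_add d (fun q => (k1 q).right) fun q => (hm q).right]
      exact ⟨hfin hF0 hf0 hf1 (fun q => (k3 q).1) q, hfin hG0 hg0 hg1 (fun q => (k3 q).2) q⟩

theorem exists_shadow_step {ω : ℝ} (hω : ω ∈ Set.Ioo 0 (2 * Real.pi)) (d : ℤ) (N : ℕ)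
    {F : ℕ → ℝ → ℂ} (hF : ∀ q, ContDiff ℝ (⊤ : ℕ∞) (F q)) (hF0 : ∀ q, N ≤ q → F q = 0) :
    ∃ (U : ℂ → ℂ) (M : ℕ) (φ : ℕ → ℝ → ℂ), (∀ q, ContDiff ℝ (⊤ : ℕ∞) (φ q)) ∧
      (∀ q, M ≤ q → φ q = 0) ∧
      (∀ s : ℂ, s.im ∈ Set.Ioo (-(ω / 2)) (ω / 2) → U (exp s) = polar (d + 2) M φ s) ∧
      (fun z : ({0}ᶜ : Set ℂ) => U z) ∈ quasiHom ω (d + 2) ∧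
      (∀ s : ℂ, s.im ∈ openArcs ω → ContDiffAt ℝ 2 U (exp s)) ∧
      (∀ s : ℂ, s.im ∈ Set.Ioo (-(ω / 2)) (ω / 2) →
        Laplacian.laplacian U (exp s) = 4 * polar d N F s) ∧
      (∀ s : ℂ, s.im ∈ Set.Ioo (ω / 2) (2 * Real.pi - ω / 2) →
        Laplacian.laplacian U (exp s) = 0) := by
  obtain ⟨M, φ, ψ, hm, hM, hT⟩ := exists_matched_family (ω := ω) (d + 2) N
    (F := fun q => (4 : ℂ) • F q) (G := fun _ => 0) (fun q => contDiff_const.smul (hF q))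
    (fun q => contDiff_const) (fun q hq => by simp [hF0 q hq]) (fun _ _ => rfl)
  choose Φ' h1' h2' h3' using fun q => (hm q).exists_angular hω
  -- The functions chosen rank by rank are controlled only on the two arcs; truncation makes the
  -- family vanish identically from rank M on.
  set Φ : ℕ → ℝ → ℂ := fun q => if q < M then Φ' q else 0 with hΦ
  have h1 : ∀ q, IsAngular ω (Φ q) := fun q => by
    by_cases hq : q < M
    · simpa only [hΦ, if_pos hq] using h1' q
    · simpa only [hΦ, if_neg hq] using IsAngular.zero
  have hM0 : ∀ q, M ≤ q → Φ q = 0 := fun q hq => by simp only [hΦ, if_neg (not_lt.mpr hq)]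
  have h2 : ∀ q, ∀ θ ∈ Set.Icc (-(ω / 2)) (ω / 2), Φ q θ = φ q θ := fun q θ hθ => by
    by_cases hq : q < M
    · simpa only [hΦ, if_pos hq] using h2' q θ hθ
    · simp [hΦ, if_neg hq, (hM q (not_lt.mp hq)).1]
  have h3 : ∀ q, ∀ θ ∈ Set.Icc (ω / 2) (2 * Real.pi - ω / 2), Φ q θ = ψ q θ := fun q θ hθ => by
    by_cases hq : q < M
    · simpa only [hΦ, if_pos hq] using h3' q θ hθ
    · simp [hΦ, if_neg hq, (hM q (not_lt.mp hq)).2]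
  set V : ℕ → ({0}ᶜ : Set ℂ) → ℂ := fun q z =>
    (‖(z : ℂ)‖ : ℂ) ^ (d + 2) * (Real.log ‖(z : ℂ)‖ : ℂ) ^ q * Φ q (z : ℂ).arg
  set U : ℂ → ℂ := fun z => ∑ q ∈ Finset.range M,
    (‖z‖ : ℂ) ^ (d + 2) * (Real.log ‖z‖ : ℂ) ^ q * Φ q z.arg with hU
  have hUp : ∀ s, U (exp s) = polar (d + 2) M Φ s := by
    intro s
    have e1 : (‖exp s‖ : ℂ) = exp s.re := by rw [Complex.norm_exp, ofReal_exp]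
    simp only [hU, polar, Finset.mul_sum]
    refine Finset.sum_congr rfl fun q _ => ?_
    rw [e1, ← Complex.exp_int_mul, periodic_arg_exp (h1 q).periodic, Complex.norm_exp,
      Real.log_exp, mul_assoc]
  have hcdp : ∀ s : ℂ, s.im ∈ openArcs ω → ContDiffAt ℝ 2 (polar (d + 2) M Φ) s := fun s hs =>
    contDiffAt_polar _ M Φ s fun q => (h1 q).contDiffAt hs
  have hfun : (fun s => U (exp s)) = polar (d + 2) M Φ := funext hUp
  have hcd : ∀ s : ℂ, s.im ∈ openArcs ω → ContDiffAt ℝ 2 U (exp s) := fun s hs =>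
    contDiffAt_of_comp_exp (by rw [hfun]; exact hcdp s hs)
  have hlap : ∀ s : ℂ, s.im ∈ openArcs ω → polar (d + 2) M (angOp (d + 2) Φ) s =
      (Real.exp (2 * s.re) : ℂ) * Laplacian.laplacian U (exp s) := fun s hs => by
    rw [← laplacian_comp_exp (hcd s hs), hfun,
      laplacian_polar _ _ _ _ (fun q => (h1 q).contDiffAt hs) hM0]
  have hexp : ∀ s : ℂ, (Real.exp (2 * s.re) : ℂ) ≠ 0 := fun s => by
    exact_mod_cast (Real.exp_pos _).ne'
  have hcongr : ∀ {f g : ℝ → ℂ} {a b θ : ℝ}, (∀ t ∈ Set.Icc a b, f t = g t) →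
      θ ∈ Set.Ioo a b → deriv (deriv f) θ = deriv (deriv g) θ := by
    intro f g a b θ h hθ
    have : f =ᶠ[𝓝 θ] g := by
      filter_upwards [Icc_mem_nhds hθ.1 hθ.2] with t ht using h t ht
    exact this.deriv.deriv_eq
  refine ⟨U, M, φ, fun q => (hm q).left, fun q hq => (hM q hq).1, fun s hs => ?_, ?_, hcd,
    fun s hs => ?_, fun s hs => ?_⟩
  · rw [hUp, polar, polar]
    congr 1
    exact Finset.sum_congr rfl fun q _ => by rw [h2 q _ (Set.Ioo_subset_Icc_self hs)]
  · have : (fun z : ({0}ᶜ : Set ℂ) => U z) = ∑ q ∈ Finset.range M, V q := by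
      ext z
      simp [hU, V]
    rw [this]
    exact Submodule.sum_mem _ fun q _ => Submodule.subset_span ⟨q, Φ q, h1 q, rfl⟩
  · have hs' := Set.Ioo_subset_Icc_self hs
    refine mul_left_cancel₀ (hexp s) ?_
    rw [← hlap s (Or.inl hs)]
    have e : ∀ q, angOp (d + 2) Φ q s.im = 4 * F q s.im := fun q => by
      have := congrFun (hT q).1 s.im
      simp only [angOp, h2 _ _ hs', hcongr (h2 q) hs] at this ⊢
      exact this
    have e' : polar (d + 2) M (angOp (d + 2) Φ) s = polar (d + 2) (M + N) (angOp (d + 2) Φ) s :=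
      (polar_eq_of_le (fun q => angOp_eq_zero_of_vanish hM0) (by omega) s).symm
    rw [e', mul_left_comm, exp_two_mul_polar, ← polar_eq_of_le hF0 (Nat.le_add_left N M), polar,
      polar, Finset.mul_sum, Finset.mul_sum, Finset.mul_sum]
    exact Finset.sum_congr rfl fun q _ => by rw [e]; ring
  · have hs' := Set.Ioo_subset_Icc_self hs
    refine mul_left_cancel₀ (hexp s) ?_
    rw [← hlap s (Or.inr hs), mul_zero]
    refine polar_zero fun q _ => ?_
    have := congrFun (hT q).2 s.im
    simp only [angOp, h3 _ _ hs', hcongr (h3 q) hs] at this ⊢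
    exact this

/-! ### Existence: iteration and symmetrisation -/

theorem exists_exp_of_mem_sectorMinus {ω : ℝ} {z : ℂ} (hz : z ∈ sectorMinus ω) :
    ∃ s : ℂ, exp s = z ∧ s.im ∈ Set.Ioo (-(ω / 2)) (ω / 2) :=
  ⟨Complex.log z, Complex.exp_log hz.1, by
    rw [Complex.log_im]; exact ⟨(abs_lt.mp hz.2).1, (abs_lt.mp hz.2).2⟩⟩

theorem exists_exp_of_mem_sectorPlus {ω : ℝ} {z : ℂ}
    (hz : z ∈ sectorPlus ω) :
    ∃ s : ℂ, exp s = z ∧ s.im ∈ Set.Ioo (ω / 2) (2 * Real.pi - ω / 2) := by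
  obtain ⟨hz0, hz1⟩ := hz
  have h1 := Complex.arg_le_pi z
  have h2 := Complex.neg_pi_lt_arg z
  rcases lt_abs.mp hz1 with h | h
  · exact ⟨Complex.log z, Complex.exp_log hz0, by
      rw [Complex.log_im]; exact ⟨h, by linarith⟩⟩
  · refine ⟨Complex.log z + 2 * Real.pi * I, ?_, ?_⟩
    · rw [exp_add, Complex.exp_log hz0, exp_two_pi_mul_I, mul_one]
    · have : (Complex.log z + 2 * Real.pi * I).im = z.arg + 2 * Real.pi := by
        simp [Complex.log_im]
      rw [this]
      exact ⟨by linarith, by linarith⟩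

theorem abs_arg_conj (z : ℂ) : |(conj z).arg| = |z.arg| := by
  rw [Complex.arg_conj]
  split_ifs with h
  · rw [h]
  · exact abs_neg _

theorem conj_mem_sectorMinus {ω : ℝ} {z : ℂ} (hz : z ∈ sectorMinus ω) : conj z ∈ sectorMinus ω :=
  ⟨by simpa using hz.1, by rw [abs_arg_conj]; exact hz.2⟩

theorem conj_mem_sectorPlus {ω : ℝ} {z : ℂ} (hz : z ∈ sectorPlus ω) : conj z ∈ sectorPlus ω :=
  ⟨by simpa using hz.1, by rw [abs_arg_conj]; exact hz.2⟩

theorem contDiffAt_comp_conj {f : ℂ → ℂ} {z : ℂ} (hf : ContDiffAt ℝ 2 f (conj z)) :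
    ContDiffAt ℝ 2 (fun z => f (conj z)) z :=
  ContDiffAt.comp (g := f) z hf Complex.conjCLE.contDiff.contDiffAt

theorem laplacian_comp_conj (f : ℂ → ℂ) (z : ℂ) :
    Laplacian.laplacian (fun z => f (conj z)) z = Laplacian.laplacian f (conj z) := by
  have key : ∀ v : ℂ, iteratedFDeriv ℝ 2 (fun z => f (conj z)) z ![v, v] =
      iteratedFDeriv ℝ 2 f (conj z) ![conj v, conj v] := by
    intro v
    have h := Complex.conjCLE.iteratedFDerivWithin_comp_right f uniqueDiffOn_univ
      (Set.mem_univ (conj z)) 2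
    simp only [Set.preimage_univ, iteratedFDerivWithin_univ] at h
    have h' : (fun z => f (conj z)) = f ∘ Complex.conjCLE := rfl
    rw [h', h]
    simp only [ContinuousMultilinearMap.compContinuousLinearMap_apply]
    congr 1
    ext i
    fin_cases i <;> rfl
  rw [laplacian_eq_iteratedFDeriv_complexPlane, laplacian_eq_iteratedFDeriv_complexPlane]
  simp only [key, map_one, conj_I]
  congr 1
  simp [iteratedFDeriv_two_apply]

theorem quasiHom_conj {ω : ℝ} {d : ℤ} {v : ({0}ᶜ : Set ℂ) → ℂ} (hv : v ∈ quasiHom ω d) :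
    (fun z => conj (v z)) ∈ quasiHom ω d := by
  induction hv using Submodule.span_induction with
  | mem v hv =>
    obtain ⟨q, Φ, hΦ, rfl⟩ := hv
    refine Submodule.subset_span ⟨q, fun θ => conj (Φ θ), ⟨fun θ => by simp [hΦ.periodic θ],
      Complex.conjCLE.contDiff.comp hΦ.contDiff,
      Complex.conjCLE.contDiff.comp_contDiffOn hΦ.smooth_minus,
      Complex.conjCLE.contDiff.comp_contDiffOn hΦ.smooth_plus⟩, ?_⟩
    ext z
    simp
  | zero =>
    convert Submodule.zero_mem (quasiHom ω d) using 1
    ext z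
    simp
  | add v w _ _ hv hw =>
    convert Submodule.add_mem _ hv hw using 1
    ext z
    simp
  | smul c v _ hv =>
    convert Submodule.smul_mem _ (conj c) hv using 1
    ext z
    simp

theorem IsAngular.comp_neg {ω : ℝ} {Φ : ℝ → ℂ} (h : IsAngular ω Φ) :
    IsAngular ω (fun θ => Φ (-θ)) := by
  refine ⟨fun θ => ?_, h.contDiff.comp contDiff_neg, ?_, ?_⟩
  · show Φ (-(θ + 2 * Real.pi)) = Φ (-θ)
    rw [← h.periodic (-(θ + 2 * Real.pi))]
    ring_nf
  · exact h.smooth_minus.comp contDiff_neg.contDiffOn fun θ hθ =>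
      ⟨by linarith [hθ.2], by linarith [hθ.1]⟩
  · have e : (fun θ => Φ (-θ)) = fun θ => Φ (2 * Real.pi - θ) := by
      ext θ
      rw [← h.periodic (-θ)]
      ring_nf
    rw [e]
    exact h.smooth_plus.comp (contDiff_const.sub contDiff_id).contDiffOn fun θ hθ =>
      ⟨by linarith [hθ.2], by linarith [hθ.1]⟩

theorem quasiHom_comp_conj {ω : ℝ} {d : ℤ} {U : ℂ → ℂ}
    (hU : (fun z : ({0}ᶜ : Set ℂ) => U z) ∈ quasiHom ω d) :
    (fun z : ({0}ᶜ : Set ℂ) => U (conj z)) ∈ quasiHom ω d := by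
  set τ : ({0}ᶜ : Set ℂ) → ({0}ᶜ : Set ℂ) := fun z => ⟨conj z, by
    have hz : (z : ℂ) ≠ 0 := z.2
    simpa using hz⟩
  suffices h : ∀ v ∈ quasiHom ω d, v ∘ τ ∈ quasiHom ω d from h _ hU
  intro v hv
  induction hv using Submodule.span_induction with
  | mem v hv =>
    obtain ⟨q, Φ, hΦ, rfl⟩ := hv
    refine Submodule.subset_span ⟨q, fun θ => Φ (-θ), hΦ.comp_neg, ?_⟩
    ext z
    have e : Φ (conj (z : ℂ)).arg = Φ (-(z : ℂ).arg) := by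
      have hz : (z : ℂ) ≠ 0 := z.2
      have h1 : conj (z : ℂ) = exp (conj (Complex.log z)) := by
        rw [Complex.exp_conj, Complex.exp_log hz]
      rw [h1, periodic_arg_exp hΦ.periodic, Complex.conj_im, Complex.log_im]
    simp [τ, e]
  | zero => exact Submodule.zero_mem (quasiHom ω d)
  | add v w _ _ hv hw => exact Submodule.add_mem _ hv hw
  | smul c v _ hv => exact Submodule.smul_mem _ c hv

/-- `U` has the form `e^{d x} ∑ x^q φ_q(θ)` with smooth coefficients in the open sector
`|θ| < ω/2`. -/
def SmoothInSector (ω : ℝ) (d : ℤ) (U : ℂ → ℂ) : Prop :=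
  ∃ (N : ℕ) (F : ℕ → ℝ → ℂ), (∀ q, ContDiff ℝ (⊤ : ℕ∞) (F q)) ∧ (∀ q, N ≤ q → F q = 0) ∧
    ∀ s : ℂ, s.im ∈ Set.Ioo (-(ω / 2)) (ω / 2) → U (exp s) = polar d N F s

/-- `U'` is a complex shadow of degree `d` generated by `U`. -/
structure IsShadowOf (ω : ℝ) (d : ℤ) (U U' : ℂ → ℂ) : Prop where
  mem : (fun z : ({0}ᶜ : Set ℂ) => U' z) ∈ quasiHom ω d
  contDiff_minus : ∀ z ∈ sectorMinus ω, ContDiffAt ℝ 2 U' z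
  contDiff_plus : ∀ z ∈ sectorPlus ω, ContDiffAt ℝ 2 U' z
  laplacian_minus : ∀ z ∈ sectorMinus ω, Laplacian.laplacian U' z = 4 * U z
  laplacian_plus : ∀ z ∈ sectorPlus ω, Laplacian.laplacian U' z = 0

theorem exists_isShadowOf {ω : ℝ} (hω : ω ∈ Set.Ioo 0 (2 * Real.pi)) {d : ℤ} {U : ℂ → ℂ}
    (hU : SmoothInSector ω d U) :
    ∃ U', SmoothInSector ω (d + 2) U' ∧ IsShadowOf ω (d + 2) U U' := by
  obtain ⟨N, F, hF, hF0, hUF⟩ := hU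
  obtain ⟨U', M, φ, h1, h2, h3, h4, h5, h6, h7⟩ := exists_shadow_step hω d N hF hF0
  refine ⟨U', ⟨M, φ, h1, h2, h3⟩, h4, fun z hz => ?_, fun z hz => ?_, fun z hz => ?_,
    fun z hz => ?_⟩
  · obtain ⟨s, rfl, hs⟩ := exists_exp_of_mem_sectorMinus hz
    exact h5 s (Or.inl hs)
  · obtain ⟨s, rfl, hs⟩ := exists_exp_of_mem_sectorPlus hz
    exact h5 s (Or.inr hs)
  · obtain ⟨s, rfl, hs⟩ := exists_exp_of_mem_sectorMinus hz
    rw [h6 s hs, hUF s hs]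
  · obtain ⟨s, rfl, hs⟩ := exists_exp_of_mem_sectorPlus hz
    exact h7 s hs

theorem exists_complex_shadows {ω : ℝ} (hω : ω ∈ Set.Ioo 0 (2 * Real.pi)) {d : ℤ} {U₀ : ℂ → ℂ}
    (h₀ : SmoothInSector ω d U₀) :
    ∃ U : ℕ → ℂ → ℂ, U 0 = U₀ ∧
      ∀ j, IsShadowOf ω (d + 2 * ((j + 1 : ℕ) : ℤ)) (U j) (U (j + 1)) := by
  -- The smoothness of the current shadow in the sector travels with it, since it is what allows the
  -- next step.
  have step : ∀ (j : ℕ) (U : {U : ℂ → ℂ // SmoothInSector ω (d + 2 * (j : ℤ)) U}),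
      ∃ U' : {U : ℂ → ℂ // SmoothInSector ω (d + 2 * ((j + 1 : ℕ) : ℤ)) U},
        IsShadowOf ω (d + 2 * ((j + 1 : ℕ) : ℤ)) U U' := by
    intro j U
    obtain ⟨U', h1, h2⟩ := exists_isShadowOf hω U.2
    have e : d + 2 * (j : ℤ) + 2 = d + 2 * ((j + 1 : ℕ) : ℤ) := by push_cast; ring
    rw [e] at h1 h2
    exact ⟨⟨U', h1⟩, h2⟩
  choose f hf using step
  set u₀ : {U : ℂ → ℂ // SmoothInSector ω (d + 2 * ((0 : ℕ) : ℤ)) U} := ⟨U₀, by simpa using h₀⟩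
  set seq : ∀ j : ℕ, {U : ℂ → ℂ // SmoothInSector ω (d + 2 * (j : ℤ)) U} := fun j =>
    Nat.rec u₀ (fun j u => f j u) j
  exact ⟨fun j => seq j, rfl, fun j => hf j (seq j)⟩

/-- The real part of the even (`ε = 1`) or odd (`ε = -1`) part of `U` with respect to
conjugation. -/
noncomputable def symmPart (ε : ℝ) (U : ℂ → ℂ) (z : ℂ) : ℝ :=
  ((1 / 2 : ℝ) * (U z + ε * U (conj z))).re

theorem ofReal_symmPart_mem {ω : ℝ} {d : ℤ} (ε : ℝ) {U : ℂ → ℂ}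
    (hU : (fun z : ({0}ᶜ : Set ℂ) => U z) ∈ quasiHom ω d) :
    (fun z : ({0}ᶜ : Set ℂ) => (symmPart ε U z : ℂ)) ∈ quasiHom ω d := by
  have h1 : (fun z : ({0}ᶜ : Set ℂ) => U z + ε * U (conj z)) ∈ quasiHom ω d :=
    Submodule.add_mem _ hU (Submodule.smul_mem _ (ε : ℂ) (quasiHom_comp_conj hU))
  have h2 := Submodule.smul_mem _ (1 / 4 : ℂ) (Submodule.add_mem _ h1 (quasiHom_conj h1))
  convert h2 using 1
  ext z
  simp only [symmPart, Pi.smul_apply, Pi.add_apply, smul_eq_mul, Complex.add_conj,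
    Complex.re_ofReal_mul]
  push_cast
  ring

theorem laplacian_symmPart (ε : ℝ) {U : ℂ → ℂ} {z : ℂ} (h : ContDiffAt ℝ 2 U z)
    (h' : ContDiffAt ℝ 2 U (conj z)) : Laplacian.laplacian (symmPart ε U) z =
      symmPart ε (Laplacian.laplacian U) z := by
  have hc := contDiffAt_comp_conj h'
  have e : symmPart ε U = Complex.reCLM ∘
      (((1 / 2 : ℝ) : ℂ) • (U + (ε : ℂ) • fun z => U (conj z))) := by
    ext z
    simp [symmPart, mul_add]
  have hs : ContDiffAt ℝ 2 ((ε : ℂ) • fun z => U (conj z)) z := contDiffAt_const.smul hc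
  have ha : ContDiffAt ℝ 2 (U + (ε : ℂ) • fun z => U (conj z)) z := h.add hs
  have hb : ContDiffAt ℝ 2 (((1 / 2 : ℝ) : ℂ) • (U + (ε : ℂ) • fun z => U (conj z))) z :=
    contDiffAt_const.smul ha
  rw [e, hb.laplacian_CLM_comp_left, Function.comp,
    laplacian_smul _ ha, h.laplacian_add hs, laplacian_smul _ hc, laplacian_comp_conj]
  simp [symmPart]

/-- Conjugation preserves both sectors and commutes with the Laplacian, so the real even or odd part
of a complex shadow sequence is again one. Only the sector |θ| < ω/2 matters for `u₀`; in particular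
θ/(2π) is allowed, although it jumps on the negative axis and is not odd there. -/
theorem exists_isShadowSeq {ω : ℝ} (hω : ω ∈ Set.Ioo 0 (2 * Real.pi)) {d : ℤ} (p : Fin 2)
    {u₀ : ℂ → ℝ} (h₀ : SmoothInSector ω d (fun z => (u₀ z : ℂ)))
    (hpar : ∀ z ∈ sectorMinus ω, u₀ (conj z) = (-1) ^ (p : ℕ) * u₀ z) :
    ∃ u : ℕ → ℂ → ℝ, u 0 = u₀ ∧ IsShadowSeq ω d p u := by
  obtain ⟨U, hU0, hU⟩ := exists_complex_shadows hω h₀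
  set ε : ℝ := (-1) ^ (p : ℕ) with hε
  have hε2 : ε * ε = 1 := by rw [hε, ← pow_add, ← two_mul, pow_mul]; norm_num
  refine ⟨fun j => if j = 0 then u₀ else symmPart ε (U j), if_pos rfl, ?_, ?_, ?_, ?_⟩
  all_goals
    intro j hj
    obtain ⟨j, rfl⟩ : ∃ i, j = i + 1 := ⟨j - 1, by omega⟩
    simp only [Nat.succ_ne_zero, if_false]
  · exact ofReal_symmPart_mem ε (hU j).mem
  · intro z hz
    have hz' := conj_mem_sectorPlus hz
    rw [laplacian_symmPart ε ((hU j).contDiff_plus z hz) ((hU j).contDiff_plus _ hz')]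
    simp [symmPart, (hU j).laplacian_plus _ hz, (hU j).laplacian_plus _ hz']
  · intro z hz
    have hz' := conj_mem_sectorMinus hz
    have h1 : Laplacian.laplacian (symmPart ε (U (j + 1))) z = 4 * symmPart ε (U j) z := by
      rw [laplacian_symmPart ε ((hU j).contDiff_minus z hz) ((hU j).contDiff_minus _ hz')]
      simp only [symmPart, (hU j).laplacian_minus _ hz, (hU j).laplacian_minus _ hz',
        Complex.re_ofReal_mul, Complex.add_re]
      rw [show (4 * U j z) = ((4 : ℝ) : ℂ) * U j z by push_cast; rfl,
        show (4 * U j (conj z)) = ((4 : ℝ) : ℂ) * U j (conj z) by push_cast; rfl,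
        Complex.re_ofReal_mul, Complex.re_ofReal_mul]
      ring
    rw [h1]
    simp only [Nat.add_sub_cancel]
    congr 1
    -- For the first shadow the source is `u₀` itself, which equals its symmetrised part in the
    -- sector by reality and parity.
    split_ifs with hj0
    · subst hj0
      simp only [symmPart, hU0, hpar z hz, Complex.re_ofReal_mul, Complex.add_re,
        Complex.ofReal_re]
      linear_combination (1 / 2 * u₀ z) * hε2
    · rfl
  · intro z hz
    simp only [symmPart, Complex.conj_conj, Complex.re_ofReal_mul, Complex.add_re]
    linear_combination (-(1 / 2) * (U (j + 1) (conj z)).re) * hε2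

theorem smoothInSector_of_polar {ω : ℝ} {d : ℤ} {U : ℂ → ℂ} (q : ℕ) {φ : ℝ → ℂ}
    (hφ : ContDiff ℝ (⊤ : ℕ∞) φ) (h : ∀ s : ℂ, s.im ∈ Set.Ioo (-(ω / 2)) (ω / 2) →
      U (exp s) = exp (d * s.re) * (s.re : ℂ) ^ q * φ s.im) : SmoothInSector ω d U := by
  refine ⟨q + 1, fun m => if m = q then φ else 0, fun m => ?_, fun m hm => ?_, fun s hs => ?_⟩
  · dsimp only
    split_ifs
    exacts [hφ, contDiff_const]
  · simp [show m ≠ q by omega]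
  · rw [h s hs, polar, Finset.sum_eq_single q]
    · simp [mul_assoc]
    · intro m _ hm
      simp [hm]
    · simp

theorem log_exp_of_mem {ω : ℝ} (hω : ω ∈ Set.Ioo 0 (2 * Real.pi)) {s : ℂ}
    (hs : s.im ∈ Set.Icc (-(ω / 2)) (ω / 2)) : Complex.log (exp s) = s :=
  Complex.log_exp (by linarith [hs.1, hω.2]) (by linarith [hs.2, hω.2])

theorem arg_conj_of_mem_sectorMinus {ω : ℝ} (hω : ω ∈ Set.Ioo 0 (2 * Real.pi)) {z : ℂ}
    (hz : z ∈ sectorMinus ω) : (conj z).arg = -z.arg := by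
  rw [Complex.arg_conj, if_neg]
  intro h
  have := hz.2
  rw [h, abs_of_pos Real.pi_pos] at this
  linarith [hω.2]

theorem cos_parity (x : ℝ) (p : Fin 2) :
    Real.cos (-x - (p : ℕ) * Real.pi / 2) =
      (-1) ^ (p : ℕ) * Real.cos (x - (p : ℕ) * Real.pi / 2) := by
  fin_cases p
  · simp
  · simp [Real.cos_sub_pi_div_two]

theorem contDiff_cos_coeff (k : ℕ) (c b : ℝ) :
    ContDiff ℝ (⊤ : ℕ∞) (fun θ : ℝ => ((c * Real.cos (k * θ - b) : ℝ) : ℂ)) :=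
  Complex.ofRealCLM.contDiff.comp
    (contDiff_const.mul (((contDiff_const.mul contDiff_id).sub contDiff_const).cos))

theorem arg_exp_of_mem {ω : ℝ} (hω : ω ∈ Set.Ioo 0 (2 * Real.pi)) {s : ℂ}
    (hs : s.im ∈ Set.Ioo (-(ω / 2)) (ω / 2)) : (exp s).arg = s.im := by
  rw [← Complex.log_im, log_exp_of_mem hω (Set.Ioo_subset_Icc_self hs)]

theorem exists_isPrimalShadows {ω : ℝ} (hω : ω ∈ Set.Ioo 0 (2 * Real.pi)) (k : ℕ) :
    ∃ s, IsPrimalShadows ω k s := by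
  have h : ∀ p : Fin 2, ∃ u : ℕ → ℂ → ℝ, u 0 = primalLeading k p ∧ IsShadowSeq ω k p u := by
    intro p
    refine exists_isShadowSeq hω p ?_ fun z hz => ?_
    · refine smoothInSector_of_polar 0 (contDiff_cos_coeff k 1 ((p : ℕ) * Real.pi / 2))
        fun s hs => ?_
      rw [primalLeading, arg_exp_of_mem hω hs, Complex.norm_exp, ← Real.exp_nat_mul]
      push_cast
      ring
    · rw [primalLeading, primalLeading, arg_conj_of_mem_sectorMinus hω hz, Complex.norm_conj,
        mul_neg, cos_parity]
      ring
  choose u hu0 hu using h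
  exact ⟨u, fun p => ⟨fun z _ => by rw [hu0], hu p⟩⟩

theorem exists_isDualShadows {ω : ℝ} (hω : ω ∈ Set.Ioo 0 (2 * Real.pi)) (k : ℕ) :
    ∃ κ, IsDualShadows ω k κ := by
  have h : ∀ p : Fin 2, ∃ u : ℕ → ℂ → ℝ,
      u 0 = dualLeading k p ∧ IsShadowSeq ω (-(k : ℤ)) p u := by
    intro p
    by_cases hk : k = 0
    · subst hk
      fin_cases p
      · refine exists_isShadowSeq hω 0 ?_ fun z hz => ?_
        · refine smoothInSector_of_polar 1 (φ := fun _ => ((-(1 / (2 * Real.pi)) : ℝ) : ℂ))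
            contDiff_const fun s hs => ?_
          simp only [dualLeading, if_true, Complex.norm_exp, Real.log_exp, Fin.zero_eta]
          push_cast
          simp
          ring
        · simp [dualLeading]
      · refine exists_isShadowSeq hω 1 ?_ fun z hz => ?_
        · refine smoothInSector_of_polar 0 (φ := fun θ => ((θ / (2 * Real.pi) : ℝ) : ℂ))
            (Complex.ofRealCLM.contDiff.comp (contDiff_id.div_const _)) fun s hs => ?_
          simp [dualLeading, arg_exp_of_mem hω hs]
        · simp only [dualLeading, if_true, Fin.mk_one, Fin.isValue, one_ne_zero, if_false,
            arg_conj_of_mem_sectorMinus hω hz, Fin.val_one, pow_one]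
          ring
    · refine exists_isShadowSeq hω p ?_ fun z hz => ?_
      · refine smoothInSector_of_polar 0
          (contDiff_cos_coeff k (1 / (2 * k * Real.pi)) ((p : ℕ) * Real.pi / 2)) fun s hs => ?_
        rw [dualLeading, if_neg hk, arg_exp_of_mem hω hs, Complex.norm_exp, ← Real.exp_nat_mul,
          ← Real.exp_neg]
        push_cast
        rw [neg_mul]
        ring
      · simp only [dualLeading, if_neg hk, arg_conj_of_mem_sectorMinus hω hz, Complex.norm_conj,
          mul_neg, cos_parity]
        ring
  choose u hu0 hu using h
  exact ⟨u, fun p => ⟨fun z _ => by rw [hu0], hu p⟩⟩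

/-! ### Counting logarithms along the sequence -/

/-- The exponents `(μ, q)` allowed in the shadow of order `j` and degree `d`. -/
def admissible (d : ℤ) (j ε μ q : ℕ) : Prop :=
  μ ≤ j ∧ (d - μ < 0 → q ≤ j) ∧ (0 ≤ d - μ → q ≤ j + ε)

/-- The source of a shadow lives in the sector |θ| < ω/2, so the induction uses membership only
there; the leading term needs no description in the other sector. The number ε is the reserve for
the extra logarithm, unnecessary when the degrees start at d ≥ 0 without logarithm. -/
theorem complex_shadows_mem_logAnsatz {ω : ℝ} (hω : ω ∈ Set.Ioo 0 (2 * Real.pi)) {d : ℤ} {ε : ℕ}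
    (hε : ε = 1 ∨ (ε = 0 ∧ 0 ≤ d)) {U : ℕ → ℂ → ℂ}
    (h₀ : ∃ f ∈ logAnsatz d (admissible d 0 ε),
      ∀ s : ℂ, s.im ∈ Set.Icc (-(ω / 2)) (ω / 2) → U 0 (exp s) = f s)
    (hU : ∀ j, IsShadowOf ω (d + 2 * ((j + 1 : ℕ) : ℤ)) (U j) (U (j + 1))) (j : ℕ) :
    (∃ f ∈ logAnsatz (d + 2 * (j : ℤ)) (admissible (d + 2 * (j : ℤ)) j ε),
      ∀ s : ℂ, s.im ∈ Set.Icc (-(ω / 2)) (ω / 2) → U j (exp s) = f s) ∧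
    (1 ≤ j → ∃ f ∈ logAnsatz (d + 2 * (j : ℤ)) (admissible (d + 2 * (j : ℤ)) j ε),
      ∀ s : ℂ, s.im ∈ Set.Icc (-(Real.pi - ω / 2)) (Real.pi - ω / 2) → U j (-exp s) = f s) := by
  induction j with
  | zero => exact ⟨by simpa using h₀, by simp⟩
  | succ j ih =>
    obtain ⟨⟨f, hf, hfs⟩, -⟩ := ih
    have hj := hU j
    have e : d + 2 * ((j + 1 : ℕ) : ℤ) = d + 2 * (j : ℤ) + 2 := by push_cast; ring
    rw [e] at hj ⊢
    have hd : d ≤ d + 2 * (j : ℤ) := by omega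
    generalize d + 2 * (j : ℤ) = lam at *
    have habs : ∀ {x b : ℝ}, x ∈ Set.Ioo (-b) b → |x| < b := fun h => abs_lt.mpr h
    -- In negative degree every d - μ is negative, so the powers are at most j; otherwise ε may be
    -- added.
    have hbound : ∃ N, (lam < 0 ∧ N = j + 1) ∨ (0 ≤ lam ∧ N = j + 1 + ε) := by
      rcases lt_or_ge lam 0 with h | h
      exacts [⟨_, Or.inl ⟨h, rfl⟩⟩, ⟨_, Or.inr ⟨h, rfl⟩⟩]
    obtain ⟨N, hN⟩ := hbound
    have key := shadow_mem_logAnsatz hω (N := N) (B := admissible (lam + 2) (j + 1) ε) hj.mem hf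
      (fun μ q h => by unfold admissible at h; omega)
      (fun s hs => by
        have harg := arg_exp_of_mem hω hs
        rw [hj.laplacian_minus _ ⟨exp_ne_zero s, by rw [harg]; exact habs hs⟩,
          hfs s (Set.Ioo_subset_Icc_self hs)])
      (fun s hs => hj.laplacian_plus _ ⟨exp_ne_zero s, by
        rcases le_or_gt s.im Real.pi with h | h
        · have : (exp s).arg = s.im := by
            rw [← Complex.log_im, Complex.log_exp (by linarith [hs.1, hω.1, Real.pi_pos]) h]
          rw [this]
          exact hs.1.trans_le (le_abs_self _)
        -- Beyond π the principal argument is θ - 2π, and its absolute value still exceeds ω/2.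
        · have h1 : exp s = exp (s - 2 * Real.pi * I) := by
            rw [exp_sub, exp_two_pi_mul_I, div_one]
          have h2 : (s - 2 * Real.pi * I).im = s.im - 2 * Real.pi := by simp
          have : (exp s).arg = s.im - 2 * Real.pi := by
            rw [h1, ← Complex.log_im, Complex.log_exp (by rw [h2]; linarith)
              (by rw [h2]; linarith [hs.2, hω.1, Real.pi_pos]), h2]
          rw [this]
          exact lt_of_lt_of_le (by linarith [hs.2]) (neg_le_abs _)⟩)
      (fun μ q q' h hq => by unfold admissible at h ⊢; push_cast; omega)
      (fun μ q h hq => by unfold admissible at h ⊢; push_cast; omega)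
      -- The decisive case is the passage from degree -2 to 0: the surviving constant of rank j + 2
      -- forces ε = 1. With ε = 0 it cannot occur, the degrees being nonnegative.
      (fun q hq => ⟨by omega, fun h => by rw [Nat.cast_zero] at h; omega,
        fun h => by rw [Nat.cast_zero] at h; omega⟩)
    exact ⟨key.1, fun _ => key.2⟩

/-! ### Conjugation symmetry and real coefficients -/

theorem expMono_conj (σ : ℝ) (a b : ℤ) (q : ℕ) (s : ℂ) :
    expMono σ a b q (conj s) = conj (expMono σ a b q s) := by
  simp only [expMono, map_mul, map_pow, ← Complex.exp_conj, map_add, map_sub, conj_re, conj_im,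
    conj_ofReal, conj_I, map_intCast, ofReal_neg]
  ring_nf

theorem expMono_one_log {z : ℂ} (hz : z ≠ 0) (a : ℤ) (b q : ℕ) :
    expMono 1 a b q (Complex.log z) = z ^ a * conj z ^ b * Complex.log z ^ q := by
  have h1 : ((Complex.log z).re : ℂ) + (1 : ℝ) * (Complex.log z).im * I = Complex.log z := by
    simp
  have h2 : ((Complex.log z).re : ℂ) - (1 : ℝ) * (Complex.log z).im * I =
      conj (Complex.log z) := by
    apply Complex.ext <;> simp
  rw [expMono, h1, h2, exp_add, Complex.exp_int_mul, Complex.exp_int_mul, Complex.exp_conj,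
    Complex.exp_log hz, zpow_natCast]

theorem expMono_neg_one (a b : ℤ) (q : ℕ) (s : ℂ) :
    expMono (-1) a b q s = conj (expMono 1 a b q s) := by
  rw [← expMono_conj]
  simp [expMono]

theorem expMono_log_mem_ansatzS {D : Set ℂ} (hD : ∀ z ∈ D, z ≠ 0) {σ : ℝ} (hσ : σ = 1 ∨ σ = -1)
    {d : ℤ} {ℓ n μ q : ℕ} (hμ : μ ≤ ℓ) (hq : q ≤ n) :
    (fun z : D => expMono σ (d - μ) μ q (Complex.log z)) ∈ ansatzS D d ℓ n := by
  have h1 : (fun z : D => expMono 1 (d - μ) μ q (Complex.log z)) ∈ ansatzZ D d ℓ n :=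
    Submodule.subset_span ⟨μ, q, hμ, hq, by
      ext z
      exact expMono_one_log (hD z z.2) _ _ _⟩
  rcases hσ with rfl | rfl
  · exact Submodule.mem_sup_left h1
  · refine Submodule.mem_sup_right ⟨_, h1, ?_⟩
    ext z
    exact (expMono_neg_one _ _ _ _).symm

/-- Each monomial satisfies f(s̄) = conj f(s), so the symmetrisation replaces every complex
coefficient by its real part. The free factor c lets the induction pass through complex scalars. -/
theorem symmetrized_mem_ansatzS {D : Set ℂ} (hD : ∀ z ∈ D, z ≠ 0) {d : ℤ} {ℓ n : ℕ}
    {A : ℕ → ℕ → Prop} (hA : ∀ μ q, A μ q → μ ≤ ℓ ∧ q ≤ n) {f : ℂ → ℂ} (hf : f ∈ logAnsatz d A)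
    (c : ℂ) : (fun z : D => ((1 / 2 : ℝ) : ℂ) * (c * f (Complex.log z) +
      conj (c * f (conj (Complex.log z))))) ∈ ansatzS D d ℓ n := by
  induction hf using Submodule.span_induction generalizing c with
  | mem f hf =>
    obtain ⟨σ, μ, q, hσ, h, rfl⟩ := hf
    convert Submodule.smul_mem _ c.re
      (expMono_log_mem_ansatzS hD hσ (d := d) (hA μ q h).1 (hA μ q h).2) using 1
    ext z
    simp only [expMono_conj, map_mul, Complex.conj_conj, Pi.smul_apply, real_smul]
    have := Complex.add_conj c
    push_cast at this ⊢
    linear_combination (1 / 2 * expMono σ (d - μ) μ q (Complex.log z)) * this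
  | zero =>
    convert Submodule.zero_mem (ansatzS D d ℓ n) using 1
    ext z
    simp
  | add f g _ _ hf hg =>
    convert Submodule.add_mem _ (hf c) (hg c) using 1
    ext z
    simp only [Pi.add_apply, map_mul, map_add]
    ring
  | smul a f _ hf =>
    convert hf (c * a) using 1
    ext z
    simp only [Pi.smul_apply, smul_eq_mul, map_mul]
    ring

/-- A function with v(z̄) = conj v(z) equals its own symmetrisation; `hconj` expresses this without
requiring z̄ to lie in D. -/
theorem mem_ansatzS_of_logAnsatz {D : Set ℂ} (hD : ∀ z ∈ D, z ≠ 0) {d : ℤ} {ℓ n : ℕ}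
    {A : ℕ → ℕ → Prop} (hA : ∀ μ q, A μ q → μ ≤ ℓ ∧ q ≤ n) {f : ℂ → ℂ} (hf : f ∈ logAnsatz d A)
    {v : D → ℂ} (hv : ∀ z : D, v z = f (Complex.log z))
    (hconj : ∀ z : D, f (conj (Complex.log z)) = conj (v z)) : v ∈ ansatzS D d ℓ n := by
  convert symmetrized_mem_ansatzS hD hA hf 1 using 1
  ext z
  rw [hconj, ← hv]
  simp
  ring

theorem contDiffAt_of_mem_quasiHom {ω : ℝ} {d : ℤ} {u : ℂ → ℝ}
    (hu : (fun z : ({0}ᶜ : Set ℂ) => (u z : ℂ)) ∈ quasiHom ω d) {s : ℂ} (hs : s.im ∈ openArcs ω) :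
    ContDiffAt ℝ 2 u (exp s) := by
  obtain ⟨M, Φ, hΦ, -, hUΦ⟩ := exists_angular_family hu
  have h1 : ContDiffAt ℝ 2 (fun z => (u z : ℂ)) (exp s) := by
    refine contDiffAt_of_comp_exp ?_
    have : (fun s => ((u (exp s) : ℝ) : ℂ)) = polar d M Φ := funext hUΦ
    rw [this]
    exact contDiffAt_polar d M Φ s fun q => (hΦ q).contDiffAt hs
  exact Complex.reCLM.contDiff.contDiffAt.comp (exp s) h1

theorem isShadowOf_of_isShadowSeq {ω : ℝ} {d : ℤ}
    {u v : ℕ → ℂ → ℝ} {p p' : Fin 2} (hu : IsShadowSeq ω d p u) (hv : IsShadowSeq ω d p' v)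
    (c : ℂ) (j : ℕ) :
    IsShadowOf ω (d + 2 * ((j + 1 : ℕ) : ℤ)) (fun z => u j z + c * v j z)
      (fun z => u (j + 1) z + c * v (j + 1) z) := by
  have h1 : 1 ≤ j + 1 := by omega
  have hminus : ∀ z ∈ sectorMinus ω,
      ContDiffAt ℝ 2 (u (j + 1)) z ∧ ContDiffAt ℝ 2 (v (j + 1)) z := by
    intro z hz
    obtain ⟨s, rfl, hs⟩ := exists_exp_of_mem_sectorMinus hz
    exact ⟨contDiffAt_of_mem_quasiHom (hu.mem _ h1) (Or.inl hs),
      contDiffAt_of_mem_quasiHom (hv.mem _ h1) (Or.inl hs)⟩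
  have hplus : ∀ z ∈ sectorPlus ω, ContDiffAt ℝ 2 (u (j + 1)) z ∧ ContDiffAt ℝ 2 (v (j + 1)) z := by
    intro z hz
    obtain ⟨s, rfl, hs⟩ := exists_exp_of_mem_sectorPlus hz
    exact ⟨contDiffAt_of_mem_quasiHom (hu.mem _ h1) (Or.inr hs),
      contDiffAt_of_mem_quasiHom (hv.mem _ h1) (Or.inr hs)⟩
  have hof : ∀ {f : ℂ → ℝ} {z : ℂ}, ContDiffAt ℝ 2 f z →
      ContDiffAt ℝ 2 (Complex.ofRealCLM ∘ f) z := fun hf =>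
    Complex.ofRealCLM.contDiff.contDiffAt.comp _ hf
  have hcd : ∀ {f g : ℂ → ℝ} {z : ℂ}, ContDiffAt ℝ 2 f z → ContDiffAt ℝ 2 g z →
      ContDiffAt ℝ 2 (fun z => (f z : ℂ) + c * g z) z := fun hf hg =>
    (hof hf).add (contDiffAt_const.mul (hof hg))
  have hlap : ∀ {f g : ℂ → ℝ} {z : ℂ}, ContDiffAt ℝ 2 f z → ContDiffAt ℝ 2 g z →
      Laplacian.laplacian (fun z => (f z : ℂ) + c * g z) z =
        ((Laplacian.laplacian f z : ℝ) : ℂ) + c * (Laplacian.laplacian g z : ℝ) := by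
    intro f g z hf hg
    have e : (fun z => (f z : ℂ) + c * g z) =
        (Complex.ofRealCLM ∘ f) + c • (Complex.ofRealCLM ∘ g) := rfl
    have hs : ContDiffAt ℝ 2 (c • (Complex.ofRealCLM ∘ g)) z := contDiffAt_const.smul (hof hg)
    rw [e, (hof hf).laplacian_add hs, laplacian_smul _ (hof hg), hf.laplacian_CLM_comp_left,
      hg.laplacian_CLM_comp_left]
    rfl
  refine ⟨Submodule.add_mem _ (hu.mem _ h1) (Submodule.smul_mem _ c (hv.mem _ h1)),
    fun z hz => hcd (hminus z hz).1 (hminus z hz).2, fun z hz => hcd (hplus z hz).1 (hplus z hz).2,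
    fun z hz => ?_, fun z hz => ?_⟩
  · rw [hlap (hminus z hz).1 (hminus z hz).2, hu.laplacian_minus _ h1 z hz,
      hv.laplacian_minus _ h1 z hz]
    simp only [Nat.add_sub_cancel]
    push_cast
    ring
  · rw [hlap (hplus z hz).1 (hplus z hz).2, hu.laplacian_plus _ h1 z hz,
      hv.laplacian_plus _ h1 z hz]
    simp

/-- With u even and v odd, both real, u + iτv has the conjugation symmetry; τ = 1 is the primal case
and τ = -1 the dual one. -/
theorem couple_mem_ansatz {ω : ℝ} (hω : ω ∈ Set.Ioo 0 (2 * Real.pi)) {d : ℤ} {ε : ℕ}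
    (hε : ε = 1 ∨ (ε = 0 ∧ 0 ≤ d)) {u v : ℕ → ℂ → ℝ} (hu : IsShadowSeq ω d 0 u)
    (hv : IsShadowSeq ω d 1 v) {τ : ℝ}
    (h₀ : ∃ f ∈ logAnsatz d (admissible d 0 ε), ∀ s : ℂ, s.im ∈ Set.Icc (-(ω / 2)) (ω / 2) →
      (u 0 (exp s) : ℂ) + τ * I * v 0 (exp s) = f s) {j : ℕ} (hj : 1 ≤ j) {n : ℕ}
    (hn : ∀ μ q, admissible (d + 2 * (j : ℤ)) j ε μ q → q ≤ n) :
    ((fun z => (u j z : ℂ) + τ * I * v j z,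
      fun w => (u j (-(w : ℂ)) : ℂ) + τ * I * v j (-(w : ℂ))) :
      Couple ω) ∈ ansatz ω (d + 2 * (j : ℤ)) j n := by
  obtain ⟨⟨f, hf, hfs⟩, hplus⟩ := complex_shadows_mem_logAnsatz hω hε
    (U := fun j z => (u j z : ℂ) + τ * I * v j z) h₀
    (isShadowOf_of_isShadowSeq hu hv (τ * I)) j
  obtain ⟨g, hg, hgs⟩ := hplus hj
  have hA : ∀ μ q, admissible (d + 2 * (j : ℤ)) j ε μ q → μ ≤ j ∧ q ≤ n := fun μ q h =>
    ⟨h.1, hn μ q h⟩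
  have hconj : ∀ z : ℂ, z ≠ 0 → (u j (conj z) : ℂ) + τ * I * v j (conj z) =
      conj ((u j z : ℂ) + τ * I * v j z) := by
    intro z hz
    have h1 := hu.parity j hj z hz
    have h2 := hv.parity j hj z hz
    rw [h1, h2]
    simp
  have habs : ∀ {x b : ℝ}, |x| ≤ b → x ∈ Set.Icc (-b) b ∧ -x ∈ Set.Icc (-b) b := fun h =>
    ⟨abs_le.mp h, abs_le.mp (by rwa [abs_neg])⟩
  constructor
  · refine mem_ansatzS_of_logAnsatz (fun z hz => hz.1) hA hf (fun z => ?_) fun z => ?_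
    all_goals
      obtain ⟨z, hz0, hz1⟩ := z
      obtain ⟨ha, hb⟩ := habs hz1
      dsimp only
    · rw [← hfs _ (by rwa [Complex.log_im]), Complex.exp_log hz0]
    · rw [← hfs _ (by rwa [Complex.conj_im, Complex.log_im]), Complex.exp_conj,
        Complex.exp_log hz0, hconj z hz0]
  · refine mem_ansatzS_of_logAnsatz (fun z hz => hz.1) hA hg (fun z => ?_) fun z => ?_
    all_goals
      obtain ⟨z, hz0, hz1⟩ := z
      obtain ⟨ha, hb⟩ := habs hz1
      dsimp only
    · rw [← hgs _ (by rwa [Complex.log_im]), Complex.exp_log hz0]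
    · rw [← hgs _ (by rwa [Complex.conj_im, Complex.log_im]), Complex.exp_conj,
        Complex.exp_log hz0, ← map_neg, hconj (-z) (neg_ne_zero.mpr hz0)]

/-! ### Leading terms, couples and conclusion -/

/-- The two leading terms combine to z^k, a single monomial without logarithm; this includes k = 0,
where the odd one is 0. -/
theorem primal_leading_mem {ω : ℝ} (hω : ω ∈ Set.Ioo 0 (2 * Real.pi)) {k : ℕ}
    {s : Fin 2 → ℕ → ℂ → ℝ} (hs : IsPrimalShadows ω k s) :
    ∃ f ∈ logAnsatz (k : ℤ) (admissible k 0 0), ∀ t : ℂ, t.im ∈ Set.Icc (-(ω / 2)) (ω / 2) →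
      (s 0 0 (exp t) : ℂ) + (1 : ℝ) * I * s 1 0 (exp t) = f t := by
  refine ⟨expMono 1 k 0 0, expMono_mem_logAnsatz (μ := 0) (Or.inl rfl) ⟨le_rfl, by simp, by simp⟩
    (by simp) (by simp), fun t ht => ?_⟩
  have harg : (exp t).arg = t.im := by rw [← Complex.log_im, log_exp_of_mem hω ht]
  rw [(hs 0).1 _ (exp_ne_zero t), (hs 1).1 _ (exp_ne_zero t)]
  have e1 : exp (k * (t.re + t.im * I)) =
      Real.exp t.re ^ k * (Real.cos (k * t.im) + Real.sin (k * t.im) * I) := by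
    rw [mul_add, exp_add, ofReal_exp, ← exp_nat_mul, ← mul_assoc, exp_mul_I]
    push_cast
    ring
  simp only [primalLeading, harg, Complex.norm_exp, expMono]
  simp only [Fin.val_zero, Fin.val_one, Nat.cast_zero, zero_mul, zero_div, sub_zero, Nat.cast_one,
    one_mul, Real.cos_sub_pi_div_two, Int.cast_natCast, Int.cast_zero, ofReal_one, add_zero,
    pow_zero, mul_one, e1]
  push_cast
  ring

/-- The combination is z^{-k}/(2kπ), or -log z/(2π) when k = 0; this logarithm in degree 0 already
uses the reserve ε = 1. -/
theorem dual_leading_mem {ω : ℝ} (hω : ω ∈ Set.Ioo 0 (2 * Real.pi)) {k : ℕ}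
    {κ : Fin 2 → ℕ → ℂ → ℝ} (hκ : IsDualShadows ω k κ) :
    ∃ f ∈ logAnsatz (-(k : ℤ)) (admissible (-k) 0 1),
      ∀ t : ℂ, t.im ∈ Set.Icc (-(ω / 2)) (ω / 2) →
      (κ 0 0 (exp t) : ℂ) + (-1 : ℝ) * I * κ 1 0 (exp t) = f t := by
  by_cases hk : k = 0
  · subst hk
    refine ⟨((-(1 / (2 * Real.pi)) : ℝ) : ℂ) • expMono 1 0 0 1, Submodule.smul_mem _ _
      (expMono_mem_logAnsatz (μ := 0) (Or.inl rfl) ⟨le_rfl, by simp, by simp⟩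
      (by simp) (by simp)), fun t ht => ?_⟩
    have harg : (exp t).arg = t.im := by rw [← Complex.log_im, log_exp_of_mem hω ht]
    rw [(hκ 0).1 _ (exp_ne_zero t), (hκ 1).1 _ (exp_ne_zero t)]
    simp only [dualLeading, harg, Complex.norm_exp, Real.log_exp, expMono, Pi.smul_apply,
      smul_eq_mul]
    simp only [if_true, Fin.isValue, one_ne_zero, if_false, CharP.cast_eq_zero,
      Int.cast_zero, zero_mul, add_zero, exp_zero, one_mul, pow_one, ofReal_one]
    push_cast
    ring
  · refine ⟨((1 / (2 * k * Real.pi) : ℝ) : ℂ) • expMono 1 (-k) 0 0, Submodule.smul_mem _ _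
      (expMono_mem_logAnsatz (μ := 0) (Or.inl rfl) ⟨le_rfl, by simp, by simp⟩
      (by simp) (by simp)), fun t ht => ?_⟩
    have harg : (exp t).arg = t.im := by rw [← Complex.log_im, log_exp_of_mem hω ht]
    rw [(hκ 0).1 _ (exp_ne_zero t), (hκ 1).1 _ (exp_ne_zero t)]
    have e1 : exp (-k * (t.re + t.im * I)) =
        (Real.exp t.re ^ k : ℂ)⁻¹ * (Real.cos (k * t.im) - Real.sin (k * t.im) * I) := by
      rw [mul_add, exp_add, ofReal_exp, ← exp_nat_mul, ← exp_neg, ← mul_assoc, exp_mul_I]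
      push_cast
      rw [neg_mul, neg_mul, Complex.cos_neg, Complex.sin_neg]
      ring
    simp only [dualLeading, if_neg hk, harg, Complex.norm_exp, expMono, Pi.smul_apply, smul_eq_mul]
    simp only [Fin.val_zero, Fin.val_one, Nat.cast_zero, zero_mul, zero_div, sub_zero,
      Nat.cast_one, one_mul, Real.cos_sub_pi_div_two, Int.cast_neg, Int.cast_natCast,
      Int.cast_zero, ofReal_one, add_zero, pow_zero, mul_one, e1]
    push_cast
    ring

/-- Passing from z to -z turns |arg z| into π - |arg z|; the real axis is treated apart because of
the branch of `arg`. -/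
theorem neg_mem_domPlus {ω : ℝ} {z : ℂ} (hz : z ≠ 0) (h : z ∉ domMinus ω) : -z ∈ domPlus ω := by
  have h1 : ω / 2 < |z.arg| := not_le.mp fun h' => h ⟨hz, h'⟩
  refine ⟨neg_ne_zero.mpr hz, ?_⟩
  have h2 := Complex.arg_le_pi z
  have h3 := Complex.neg_pi_lt_arg z
  rcases lt_trichotomy z.im 0 with him | him | him
  · rw [Complex.arg_neg_eq_arg_add_pi_of_im_neg him]
    rw [abs_of_neg (Complex.arg_neg_iff.mpr him)] at h1
    rw [abs_of_nonneg (by linarith)]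
    linarith
  · rcases lt_or_ge z.re 0 with hre | hre
    · have e : z.arg = Real.pi := Complex.arg_eq_pi_iff.mpr ⟨hre, him⟩
      rw [e, abs_of_pos Real.pi_pos] at h1
      have e' : (-z).arg = 0 := Complex.arg_eq_zero_iff.mpr ⟨by simp [hre.le], by simp [him]⟩
      rw [e', abs_zero]
      linarith
    · have e : z.arg = 0 := Complex.arg_eq_zero_iff.mpr ⟨hre, him⟩
      have e' : (-z).arg = Real.pi := Complex.arg_eq_pi_iff.mpr ⟨by
        have : z.re ≠ 0 := fun h0 => hz (Complex.ext h0 him)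
        simpa using lt_of_le_of_ne hre this.symm, by simp [him]⟩
      rw [e, abs_zero] at h1
      rw [e', abs_of_pos Real.pi_pos]
      linarith
  · rw [Complex.arg_neg_eq_arg_sub_pi_of_im_pos him]
    rw [abs_of_nonneg (Complex.arg_nonneg_iff.mpr him.le)] at h1
    rw [abs_of_nonpos (by linarith)]
    linarith

theorem couple_at_eq {ω : ℝ} {z : ℂ} (hz : z ≠ 0) (f : ℂ → ℂ) :
    Couple.at ((fun z => f z, fun w => f (-(w : ℂ))) : Couple ω) z = f z := by
  unfold Couple.at
  split_ifs with h h'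
  · rfl
  · simp
  · exact absurd (neg_mem_domPlus hz h) h'

end CornerShadow

theorem mainTheorem2 (ω : ℝ) (hω : ω ∈ Set.Ioo 0 (2 * Real.pi)) (k : ℕ) :
    -- shadows exist
    (∃ s, CornerShadow.IsPrimalShadows ω k s) ∧
    (∃ κ, CornerShadow.IsDualShadows ω k κ) ∧
    -- primal shadows
    (∀ s, CornerShadow.IsPrimalShadows ω k s → ∀ j : ℕ, 1 ≤ j →
      CornerShadow.primalCouple ω s j ∈ CornerShadow.ansatz ω ((k : ℤ) + 2 * (j : ℤ)) j j ∧
      ∀ r θ : ℝ, 0 < r →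
        s 0 j (r * Complex.exp (θ * Complex.I)) =
          ((CornerShadow.primalCouple ω s j).at (r * Complex.exp (θ * Complex.I))).re ∧
        (k ≠ 0 → s 1 j (r * Complex.exp (θ * Complex.I)) =
          ((CornerShadow.primalCouple ω s j).at (r * Complex.exp (θ * Complex.I))).im)) ∧
    -- dual shadows
    (∀ κ, CornerShadow.IsDualShadows ω k κ → ∀ j : ℕ, 1 ≤ j →
      (-(k : ℤ) + 2 * (j : ℤ) < 0 →
        CornerShadow.dualCouple ω κ j ∈ CornerShadow.ansatz ω (-(k : ℤ) + 2 * (j : ℤ)) j j) ∧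
      (0 ≤ -(k : ℤ) + 2 * (j : ℤ) →
        CornerShadow.dualCouple ω κ j ∈
          CornerShadow.ansatz ω (-(k : ℤ) + 2 * (j : ℤ)) j (j + 1)) ∧
      ∀ r θ : ℝ, 0 < r →
        κ 0 j (r * Complex.exp (θ * Complex.I)) =
          ((CornerShadow.dualCouple ω κ j).at (r * Complex.exp (θ * Complex.I))).re ∧
        (k ≠ 0 → κ 1 j (r * Complex.exp (θ * Complex.I)) =
          -((CornerShadow.dualCouple ω κ j).at (r * Complex.exp (θ * Complex.I))).im)) := by
  have hne : ∀ r θ : ℝ, 0 < r → (r * Complex.exp (θ * Complex.I) : ℂ) ≠ 0 := fun r θ hr =>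
    mul_ne_zero (by exact_mod_cast hr.ne') (Complex.exp_ne_zero _)
  refine ⟨CornerShadow.exists_isPrimalShadows hω k, CornerShadow.exists_isDualShadows hω k,
    fun s hs j hj => ⟨?_, fun r θ hr => ?_⟩, fun κ hκ j hj => ?_⟩
  -- All primal degrees k + 2j are nonnegative, so ε = 0 is allowed.
  · have h := CornerShadow.couple_mem_ansatz hω (Or.inr ⟨rfl, by omega⟩) (hs 0).2 (hs 1).2
      (CornerShadow.primal_leading_mem hω hs) hj (n := j)
      (fun μ q h => by unfold CornerShadow.admissible at h; omega)
    simpa [CornerShadow.primalCouple] using h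
  · have h := CornerShadow.couple_at_eq (ω := ω) (hne r θ hr)
      (fun z => (s 0 j z : ℂ) + Complex.I * (s 1 j z : ℂ))
    rw [CornerShadow.primalCouple, h]
    simp
  · have h := fun n hn => CornerShadow.couple_mem_ansatz hω (Or.inl rfl) (hκ 0).2 (hκ 1).2
      (CornerShadow.dual_leading_mem hω hκ) hj (n := n) hn
    have e : CornerShadow.dualCouple ω κ j =
        ((fun z => (κ 0 j z : ℂ) + ((-1 : ℝ) : ℂ) * Complex.I * κ 1 j z,
          fun w => (κ 0 j (-(w : ℂ)) : ℂ) + ((-1 : ℝ) : ℂ) * Complex.I * κ 1 j (-(w : ℂ))) :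
          CornerShadow.Couple ω) := by
      simp [CornerShadow.dualCouple, sub_eq_add_neg]
    refine ⟨fun hneg => ?_, fun hpos => ?_, fun r θ hr => ?_⟩
    · rw [e]
      -- In negative degree d - μ < 0 for all μ, so the reserve ε = 1 has not yet been used.
      exact h j fun μ q h => by unfold CornerShadow.admissible at h; omega
    · rw [e]
      exact h (j + 1) fun μ q h => by unfold CornerShadow.admissible at h; omega
    · have h := CornerShadow.couple_at_eq (ω := ω) (hne r θ hr)
        (fun z => (κ 0 j z : ℂ) - Complex.I * (κ 1 j z : ℂ))
      rw [CornerShadow.dualCouple, h]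
      simp
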